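/- **Setting.** Let $(Y_i,X_i)$, $1\le i\le n$, be independent centered Gaussian vectors of $\mathbb R^q\times\mathbb R^p$ with positive definite covariance $\Sigma^*$ (blocks $\Sigma^*_{yy},\Sigma^*_{yx},\Sigma^*_{xx}$), let $\Omega^*=(\Sigma^*)^{-1}$ (blocks $\Omega^*_{yy},\Omega^*_{yx},\Omega^*_{xx}$) and $\theta^*=(\Omega^*_{yy},\Omega^*_{yx})$, and let $|S|$ be the number of non-zero entries of $\theta^*$. Let $S^{(n)}_{yy}=\frac1n\sum Y_iY_i^t$, $S^{(n)}_{yx}=\frac1n\sum Y_iX_i^t$, $S^{(n)}_{xx}=\frac1n\sum X_iX_i^t$. Write $|\cdot|_1$, $|\cdot|_\infty$ for the elementwise norms, $|\cdot|_1^-$ for $|\cdot|_1$ deprived of the diagonal, $\langle\!\langle A,B\rangle\!\rangle=\mathrm{tr}(A^tB)$, $\|\cdot\|_F$ and $\|\cdot\|_2$ for the Frobenius and spectral norms. Let $L\in\mathbb R^{p\times p}$ be symmetric positive definite and $\beta\ge1$. Assume (H$_1$) $\Sigma^*_{xx}$ and $\Omega^*_{yy}$ are positive definite, $\Omega^*_{yx}\ne0$,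 and $\Omega^*_{yx}L\Omega^{*t}_{yx}$ is positive definite. For $\lambda,\mu,\eta\geq 0$ let $\widehat\theta=(\widehat\Omega_{yy},\widehat\Omega_{yx})$ denote a global minimizer, over symmetric positive definite $\Omega_{yy}\in\mathbb R^{q\times q}$ and $\Omega_{yx}\in\mathbb R^{q\times p}$, of $$-\ln\det\Omega_{yy}+\langle\!\langle S^{(n)}_{yy},\Omega_{yy}\rangle\!\rangle+2\langle\!\langle S^{(n)}_{yx},\Omega_{yx}\rangle\!\rangle+\langle\!\langle S^{(n)}_{xx},\Omega_{yx}^t\Omega_{yy}^{-1}\Omega_{yx}\rangle\!\rangle+\eta\langle\!\langle L,\Omega_{yx}^t\Omega_{yy}^{-1}\Omega_{yx}\rangle\!\rangle^\beta+\lambda|\Omega_{yy}|_1^-+\mu|\Omega_{yx}|_1 .$$ Let $h_a=|A_n|_\infty$ and $h_b=|B_n|_\infty$, where $$A_n=(S^{(n)}_{yy}-\Sigma^*_{yy})-\Omega_{yy}^{*-1}\Omega^*_{yx}(S^{(n)}_{xx}-\Sigma^*_{xx})\Omega_{yx}^{*t}\Omega_{yy}^{*-1},\qquad B_n=2\big((S^{(n)}_{yx}-\Sigma^*_{yx})+\Omega_{yy}^{*-1}\Omega^*_{yx}(S^{(n)}_{xx}-\Sigma^*_{xx})\big).$$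 **Constants.** Fix $d_\lambda>c_\lambda>1$, $d_\mu>c_\mu>1$, $e_\lambda,e_\mu>0$ and put $$s_L=\langle\!\langle L,\Omega_{yx}^{*t}\Omega_{yy}^{*-1}\Omega^*_{yx}\rangle\!\rangle,\quad \ell_a=|\Omega_{yy}^{*-1}\Omega^*_{yx}L\Omega_{yx}^{*t}\Omega_{yy}^{*-1}|_\infty,\quad \ell_b=2|\Omega_{yy}^{*-1}\Omega^*_{yx}L|_\infty,\quad \kappa=\eta\beta s_L^{\beta-1},$$ $$\overline\eta=\frac{1}{\beta s_L^{\beta-1}}\min\Big\{\tfrac{(c_\lambda-1)\lambda}{c_\lambda\ell_a},\tfrac{(c_\mu-1)\mu}{c_\mu\ell_b},\tfrac{e_\lambda h_a}{\ell_a},\tfrac{e_\mu h_b}{\ell_b}\Big\},\qquad \Lambda=\{(\lambda,\mu,\eta):c_\lambda h_a\le\lambda\le d_\lambda h_a,\ c_\mu h_b\le\mu\le d_\mu h_b,\ 0\le\eta\le\overline\eta\},$$ $$\alpha=\frac{\max\{\frac{(c_\lambda+1)\lambda}{c_\lambda}+\kappa\ell_a,\ \frac{(c_\mu+1)\mu}{c_\mu}+\kappa\ell_b\}}{\min\{\frac{(c_\lambda-1)\lambda}{c_\lambda}-\kappa\ell_a,\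 \frac{(c_\mu-1)\mu}{c_\mu}-\kappa\ell_b\}},\qquad s_\alpha=|S|\Big[1+\frac{12\alpha^2\lambda_{\max}(\Sigma^*_{xx})}{\lambda_{\min}(\Sigma^*_{xx})}\Big],$$ $$\underline\omega_L=\frac{\lambda_{\min}(\Omega^*_{yx}L\Omega^{*t}_{yx})}{4\lambda_{\max}(\Omega^*_{yy})},\quad \overline\omega_L=\frac{4\lambda_{\max}(\Omega^*_{yx}L\Omega^{*t}_{yx})}{\lambda_{\min}(\Omega^*_{yy})},\quad \overline\omega_S=\frac{4\lambda_{\max}(\Omega^*_{yx}\Sigma^*_{xx}\Omega^{*t}_{yx})}{\lambda_{\min}(\Omega^*_{yy})},$$ $$r^*=\min\Big\{\frac{\lambda_{\min}(\Omega^*_{yy})}2,\ \frac{\frac{\sqrt{10}-\sqrt7}{\sqrt5}\sqrt{\lambda_{\max}(\Omega^*_{yx}\Sigma^*_{xx}\Omega^{*t}_{yx})}}{\frac{3\sqrt3}{2\sqrt2}\sqrt{\lambda_{\max}(\Sigma^*_{xx})}},\ \frac{\lambda_{\min}(\Omega^*_{yx}L\Omega^{*t}_{yx})}{4\|L\Omega^{*t}_{yx}\|_2},\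 \frac{(\sqrt2-1)\sqrt{\lambda_{\max}(\Omega^*_{yx}L\Omega^{*t}_{yx})}}{\sqrt{\lambda_{\max}(L)}}\Big\},$$ $$c_{\lambda,\mu}=\max\Big\{\frac{(c_\lambda+1)d_\lambda}{c_\lambda}+e_\lambda,\ \frac{(c_\mu+1)d_\mu}{c_\mu}+e_\mu\Big\},\qquad m^*=|\mathrm{diag}(\Sigma^*)|_\infty+|\mathrm{diag}(\Omega_{yy}^{*-1}\Omega^*_{yx}\Sigma^*_{xx}\Omega_{yx}^{*t}\Omega_{yy}^{*-1})|_\infty .$$ For $\epsilon_S,\epsilon_L>0$ with $\epsilon_S\overline\omega_S+\eta\beta p^{\beta-1}\overline\omega_L^{\,\beta}\epsilon_L<1$ let $a_1=1-\epsilon_S\overline\omega_S-\eta\beta p^{\beta-1}\overline\omega_L^{\,\beta}\epsilon_L$, $a_2=\frac{2\epsilon_S}{2+\epsilon_S}$, $a_3=\eta\beta(q\,\underline\omega_L)^{\beta-1}\frac{2\epsilon_L}{2+\epsilon_L}$ and $$\gamma=\min\Big\{\frac{a_1}{8\lambda_{\max}^2(\Omega^*_{yy})},\ \frac{a_2\lambda_{\min}(\Sigma^*_{xx})}{40\lambda_{\max}(\Omega^*_{yy})}+\frac{a_3\lambda_{\min}(L)}{4\lambda_{\max}(\Omega^*_{yy})}\Big\}.$$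 **Theorem.** There are absolute constants $b_1,b_2>0$ such that, in the above setting, for all $0<b_3<1$, the following holds with probability at least $1-e^{-b_2n}-b_3$: for all $(\lambda,\mu,\eta)\in\Lambda$ for which the denominator of $\alpha$ is positive (it is always non-negative on $\Lambda$; when it is $0$, $\alpha=n_0=+\infty$ and nothing is claimed) and all admissible $\epsilon_S,\epsilon_L$ as above, if $n>n_0$, where $$n_0=\max\Big\{\frac{(\ln(10(p+q)^2)-\ln b_3)\,c_{\lambda,\mu}^2\,|S|\,(16m^*)^2}{r^{*2}\gamma^2},\ b_1(q+\lceil s_\alpha\rceil\ln(p+q)),\ \ln(10(p+q)^2)-\ln b_3\Big\},$$ then a minimizer $\widehat\theta$ exists, and every minimizer satisfies $$\|\widehat\theta-\theta^*\|_F\le\frac{16\,m^*\,c_{\lambda,\mu}\sqrt{|S|}}{\gamma}\sqrt{\frac{\ln(10(p+q)^2)-\ln b_3}{n}} .$$ -/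

import Mathlib

open Matrix MeasureTheory ProbabilityTheory

noncomputable section

namespace PGGM

/-! ### Matrix notation -/

/-- Largest eigenvalue (used for symmetric matrices only). -/
def lamMax {d : ℕ} (A : Matrix (Fin d) (Fin d) ℝ) : ℝ := sSup (spectrum ℝ A)

/-- Smallest eigenvalue (used for symmetric matrices only). -/
def lamMin {d : ℕ} (A : Matrix (Fin d) (Fin d) ℝ) : ℝ := sInf (spectrum ℝ A)

open scoped Matrix.Norms.L2Operator in
/-- Spectral norm, i.e. the operator norm between Euclidean spaces. -/
def specNorm {k l : ℕ} (A : Matrix (Fin k) (Fin l) ℝ) : ℝ := ‖A‖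

/-- Frobenius inner product `tr (Aᵗ B)`. -/
def frobInner {k l : ℕ} (A B : Matrix (Fin k) (Fin l) ℝ) : ℝ := (Aᵀ * B).trace

/-- Elementwise sup norm. -/
def maxNorm {k l : ℕ} (A : Matrix (Fin k) (Fin l) ℝ) : ℝ := ⨆ ij : Fin k × Fin l, |A ij.1 ij.2|

/-- Sup norm of the diagonal. -/
def diagMax {ι : Type*} (A : Matrix ι ι ℝ) : ℝ := ⨆ i, |A i i|

/-- Elementwise `ℓ¹` norm. -/
def l1Norm {k l : ℕ} (A : Matrix (Fin k) (Fin l) ℝ) : ℝ := ∑ i, ∑ j, |A i j|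

/-- Elementwise `ℓ¹` norm deprived of the diagonal terms. -/
def l1NormOff {k : ℕ} (A : Matrix (Fin k) (Fin k) ℝ) : ℝ :=
  ∑ i, ∑ j, if i = j then 0 else |A i j|

/-! ### The model

The coordinates `Fin q ⊕ Fin p` of an observation are those of the response `Y`, then those of the
predictor `X`. -/

/-- Covariance `Sig` of `(Y, X)`, structure matrix `L` and shape `β` of the prior. -/
structure Model (p q : ℕ) where
  Sig : Matrix (Fin q ⊕ Fin p) (Fin q ⊕ Fin p) ℝ
  L : Matrix (Fin p) (Fin p) ℝ
  β : ℝ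

/-- The constants `c_λ, d_λ, e_λ, c_μ, d_μ, e_μ`. -/
structure Tuning where
  cl : ℝ
  dl : ℝ
  el : ℝ
  cm : ℝ
  dm : ℝ
  em : ℝ

/-- The regularization parameters `(λ, μ, η)`. -/
structure Reg where
  lam : ℝ
  mu : ℝ
  eta : ℝ

/-- `1 < c_λ < d_λ`, `1 < c_μ < d_μ`, `e_λ > 0`, `e_μ > 0`. -/
structure Tuning.Valid (T : Tuning) : Prop where
  one_lt_cl : 1 < T.cl
  cl_lt_dl : T.cl < T.dl
  el_pos : 0 < T.el
  one_lt_cm : 1 < T.cm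
  cm_lt_dm : T.cm < T.dm
  em_pos : 0 < T.em

/-- A parameter `θ = (Ω_yy, Ω_yx)`. -/
abbrev Param (p q : ℕ) : Type := Matrix (Fin q) (Fin q) ℝ × Matrix (Fin q) (Fin p) ℝ

/-- Frobenius distance of two parameters, seen as `q × (q + p)` matrices. -/
def frobDist {p q : ℕ} (θ θ' : Param p q) : ℝ :=
  √((∑ i, ∑ j, (θ.1 i j - θ'.1 i j) ^ 2) + ∑ i, ∑ j, (θ.2 i j - θ'.2 i j) ^ 2)

namespace Model

variable {p q : ℕ} (M : Model p q)

/-- `Σ*_yy`. -/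
def Syy : Matrix (Fin q) (Fin q) ℝ := M.Sig.toBlocks₁₁

/-- `Σ*_yx`. -/
def Syx : Matrix (Fin q) (Fin p) ℝ := M.Sig.toBlocks₁₂

/-- `Σ*_xx`. -/
def Sxx : Matrix (Fin p) (Fin p) ℝ := M.Sig.toBlocks₂₂

/-- `Ω*_yy`, a block of the precision matrix. -/
def Oyy : Matrix (Fin q) (Fin q) ℝ := (M.Sig⁻¹).toBlocks₁₁

/-- `Ω*_yx`, a block of the precision matrix. -/
def Oyx : Matrix (Fin q) (Fin p) ℝ := (M.Sig⁻¹).toBlocks₁₂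

/-- The true parameter `θ*`. -/
def theta : Param p q := (M.Oyy, M.Oyx)

/-- Hypothesis (H₁). -/
structure H1 : Prop where
  Sxx_posDef : M.Sxx.PosDef
  Oyy_posDef : M.Oyy.PosDef
  Oyx_ne_zero : M.Oyx ≠ 0
  OLO_posDef : (M.Oyx * M.L * M.Oyxᵀ).PosDef

/-- `|S|`, the number of non-zero entries of `θ* = (Ω*_yy, Ω*_yx)`. -/
def cardS : ℕ :=
  {ij : Fin q × Fin q | M.Oyy ij.1 ij.2 ≠ 0}.ncard +
    {ij : Fin q × Fin p | M.Oyx ij.1 ij.2 ≠ 0}.ncard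

/-- The penalized likelihood at `θ`, as a function of the sample covariance `S`. -/
def objective (R : Reg) (S : Matrix (Fin q ⊕ Fin p) (Fin q ⊕ Fin p) ℝ) (θ : Param p q) : ℝ :=
  -Real.log θ.1.det + frobInner S.toBlocks₁₁ θ.1 + 2 * frobInner S.toBlocks₁₂ θ.2
    + frobInner S.toBlocks₂₂ (θ.2ᵀ * θ.1⁻¹ * θ.2)
    + R.eta * frobInner M.L (θ.2ᵀ * θ.1⁻¹ * θ.2) ^ M.β
    + R.lam * l1NormOff θ.1 + R.mu * l1Norm θ.2

/-- `θ` is a global minimizer of the penalized likelihood over `Θ = 𝕊₊₊^q × ℝ^{q × p}`. -/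
def IsEstimator (R : Reg) (S : Matrix (Fin q ⊕ Fin p) (Fin q ⊕ Fin p) ℝ) (θ : Param p q) : Prop :=
  θ.1.PosDef ∧ ∀ θ' : Param p q, θ'.1.PosDef → M.objective R S θ ≤ M.objective R S θ'

/-! ### The random quantities `h_a`, `h_b`, as functions of the sample covariance -/

/-- The matrix `A_n`. -/
def matA (S : Matrix (Fin q ⊕ Fin p) (Fin q ⊕ Fin p) ℝ) : Matrix (Fin q) (Fin q) ℝ :=
  (S.toBlocks₁₁ - M.Syy) - M.Oyy⁻¹ * M.Oyx * (S.toBlocks₂₂ - M.Sxx) * M.Oyxᵀ * M.Oyy⁻¹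

/-- The matrix `B_n`. -/
def matB (S : Matrix (Fin q ⊕ Fin p) (Fin q ⊕ Fin p) ℝ) : Matrix (Fin q) (Fin p) ℝ :=
  (2 : ℝ) • ((S.toBlocks₁₂ - M.Syx) + M.Oyy⁻¹ * M.Oyx * (S.toBlocks₂₂ - M.Sxx))

/-- `h_a`. -/
def ha (S : Matrix (Fin q ⊕ Fin p) (Fin q ⊕ Fin p) ℝ) : ℝ := maxNorm (M.matA S)

/-- `h_b`. -/
def hb (S : Matrix (Fin q ⊕ Fin p) (Fin q ⊕ Fin p) ℝ) : ℝ := maxNorm (M.matB S)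

/-! ### Constants -/

/-- `\underline{ω}_L`. -/
def omegaLLow : ℝ := lamMin (M.Oyx * M.L * M.Oyxᵀ) / (4 * lamMax M.Oyy)

/-- `\overline{ω}_L`. -/
def omegaLUp : ℝ := 4 * lamMax (M.Oyx * M.L * M.Oyxᵀ) / lamMin M.Oyy

/-- `\overline{ω}_S`. -/
def omegaSUp : ℝ := 4 * lamMax (M.Oyx * M.Sxx * M.Oyxᵀ) / lamMin M.Oyy

/-- `s_L`. -/
def sL : ℝ := frobInner M.L (M.Oyxᵀ * M.Oyy⁻¹ * M.Oyx)

/-- `ℓ_a`. -/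
def ella : ℝ := maxNorm (M.Oyy⁻¹ * M.Oyx * M.L * M.Oyxᵀ * M.Oyy⁻¹)

/-- `ℓ_b`. -/
def ellb : ℝ := 2 * maxNorm (M.Oyy⁻¹ * M.Oyx * M.L)

/-- `\overline{η}`, the upper bound of the band for `η`. -/
def etaBar (T : Tuning) (R : Reg) (S : Matrix (Fin q ⊕ Fin p) (Fin q ⊕ Fin p) ℝ) : ℝ :=
  min (min ((T.cl - 1) * R.lam / (T.cl * M.ella)) ((T.cm - 1) * R.mu / (T.cm * M.ellb)))
      (min (T.el * M.ha S / M.ella) (T.em * M.hb S / M.ellb))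
    / (M.β * M.sL ^ (M.β - 1))

/-- `(λ, μ, η) ∈ Λ`. -/
structure InBand (T : Tuning) (R : Reg) (S : Matrix (Fin q ⊕ Fin p) (Fin q ⊕ Fin p) ℝ) :
    Prop where
  lam_mem : R.lam ∈ Set.Icc (T.cl * M.ha S) (T.dl * M.ha S)
  mu_mem : R.mu ∈ Set.Icc (T.cm * M.hb S) (T.dm * M.hb S)
  eta_mem : R.eta ∈ Set.Icc 0 (M.etaBar T R S)

/-- The numerator of `α`. -/
def alphaNum (T : Tuning) (R : Reg) : ℝ :=
  max ((T.cl + 1) * R.lam / T.cl + R.eta * M.β * M.sL ^ (M.β - 1) * M.ella)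
    ((T.cm + 1) * R.mu / T.cm + R.eta * M.β * M.sL ^ (M.β - 1) * M.ellb)

/-- The denominator of `α`; it is non-negative for `(λ, μ, η) ∈ Λ`. -/
def alphaDen (T : Tuning) (R : Reg) : ℝ :=
  min ((T.cl - 1) * R.lam / T.cl - R.eta * M.β * M.sL ^ (M.β - 1) * M.ella)
    ((T.cm - 1) * R.mu / T.cm - R.eta * M.β * M.sL ^ (M.β - 1) * M.ellb)

/-- `α`. -/
def alpha (T : Tuning) (R : Reg) : ℝ := M.alphaNum T R / M.alphaDen T R

/-- `s_α`. -/
def sAlpha (T : Tuning) (R : Reg) : ℝ :=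
  M.cardS * (1 + 12 * M.alpha T R ^ 2 * lamMax M.Sxx / lamMin M.Sxx)

/-- `r₁*`. -/
def r1 : ℝ := lamMin M.Oyy / 2

/-- `r₂*`. -/
def r2 : ℝ :=
  ((√10 - √7) / √5 * √(lamMax (M.Oyx * M.Sxx * M.Oyxᵀ))) / (3 * √3 / (2 * √2) * √(lamMax M.Sxx))

/-- `r₃*`. -/
def r3 : ℝ := lamMin (M.Oyx * M.L * M.Oyxᵀ) / (4 * specNorm (M.L * M.Oyxᵀ))

/-- `r₄*`. -/
def r4 : ℝ := (√2 - 1) * √(lamMax (M.Oyx * M.L * M.Oyxᵀ)) / √(lamMax M.L)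

/-- `r*`. -/
def rStar : ℝ := min (min M.r1 M.r2) (min M.r3 M.r4)

/-- `a₁`. -/
def a1 (R : Reg) (εS εL : ℝ) : ℝ :=
  1 - εS * M.omegaSUp - R.eta * M.β * (p : ℝ) ^ (M.β - 1) * M.omegaLUp ^ M.β * εL

/-- `a₂`. -/
def a2 (εS : ℝ) : ℝ := 2 * εS / (2 + εS)

/-- `a₃`; the factor `q` is the size of the matrix `Ω_yy⁻¹ Ω_yx L Ω_yxᵗ`, whose trace is at least
`q` times its smallest eigenvalue. -/
def a3 (R : Reg) (εL : ℝ) : ℝ :=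
  R.eta * M.β * ((q : ℝ) * M.omegaLLow) ^ (M.β - 1) * (2 * εL / (2 + εL))

/-- `γ`, the constant of strong local convexity. -/
def gam (R : Reg) (εS εL : ℝ) : ℝ :=
  min (M.a1 R εS εL / (8 * lamMax M.Oyy ^ 2))
    (a2 εS * lamMin M.Sxx / (40 * lamMax M.Oyy) + M.a3 R εL * lamMin M.L / (4 * lamMax M.Oyy))

/-- `m*`, with the diagonal of the covariance matrix of the whole vector `(Y, X)`. -/
def mStar : ℝ :=
  diagMax M.Sig + diagMax (M.Oyy⁻¹ * M.Oyx * M.Sxx * M.Oyxᵀ * M.Oyy⁻¹)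

end Model

/-- `c_{λ,μ}`. -/
def Tuning.cLamMu (T : Tuning) : ℝ :=
  max ((T.cl + 1) * T.dl / T.cl + T.el) ((T.cm + 1) * T.dm / T.cm + T.em)

/-- `ln (10 (p + q)²) - ln b₃`. -/
def logTerm (p q : ℕ) (b₃ : ℝ) : ℝ := Real.log (10 * ((p : ℝ) + q) ^ 2) - Real.log b₃

/-- The minimal number of observations `n₀`. -/
def Model.nZero {p q : ℕ} (M : Model p q) (T : Tuning) (R : Reg) (εS εL b₁ b₃ : ℝ) : ℝ :=
  max (logTerm p q b₃ * T.cLamMu ^ 2 * M.cardS * (16 * M.mStar) ^ 2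
      / (M.rStar ^ 2 * M.gam R εS εL ^ 2))
    (max (b₁ * (q + ⌈M.sAlpha T R⌉₊ * Real.log ((p : ℝ) + q))) (logTerm p q b₃))

/-- The upper bound of the estimation error. -/
def Model.errorBound {p q : ℕ} (M : Model p q) (T : Tuning) (R : Reg) (εS εL b₃ : ℝ) (n : ℕ) : ℝ :=
  16 * M.mStar * T.cLamMu * √(M.cardS) / M.gam R εS εL * √(logTerm p q b₃ / n)

/-- Sample covariance `(1/n) ∑ zᵢ zᵢᵗ` of the observations `zᵢ = (yᵢ, xᵢ)`; its blocks are
`S_yy`, `S_yx` and `S_xx`. -/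
def sampleCov {p q n : ℕ} (z : Fin n → EuclideanSpace ℝ (Fin q ⊕ Fin p)) :
    Matrix (Fin q ⊕ Fin p) (Fin q ⊕ Fin p) ℝ :=
  Matrix.of fun a b => (1 / (n : ℝ)) * ∑ i, z i a * z i b

end PGGM

end

/-! The objective is convex in θ = (Ω_yy, Ω_yx). It therefore suffices that it exceeds its value at
θ* on the shell between the claimed error and the radius `r1`, within which the curvature is
controlled. Convexity carries the strict inequality to all larger distances, and compactness of the
ball of radius `r1` provides a minimizer (`estimator_of_objective_lt`).

The increment from θ* to θ* + Δ is at least a Bregman remainder `rem` plus the ℓ¹ balance `alphaDen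
* l1Compl - alphaNum * l1On` (`objective_theta_add_ge`). Indeed the gradient of the likelihood at θ*
is (A_n, B_n), whose entries are dominated by λ and μ, and the gradient of the prior is bounded
through κℓ_a and κℓ_b. If the balance is positive, nonnegativity of `rem` is enough. Otherwise Δ
lies in a cone where its ℓ¹ norm is comparable to the one on the support of θ*. There `rem` is at
least γ‖Δ‖² (`rem_ge_gam`), while the loss is at most c_{λ,μ} H √|S| ‖Δ‖ when H bounds h_a and h_b.
The quadratic term wins as soon as ‖Δ‖ exceeds the claimed error (`objective_lt_of_norm`).

For the curvature, the remainder of -log det is bounded below by a form relative to Ω*_yy. The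
matrix fractional function has an exact remainder, a square in Δ_yx - Δ_yy Ω*_yy⁻¹ Ω*_yx. Young's
inequality isolates Δ_yx, and the price in Δ_yy is paid by the log-determinant (`rem_ge`). Two facts
about the sample covariance of the predictors enter: an upper bound on the range of Ω*_yxᵗ
(`RangeBound`), and a lower bound up to an ℓ¹ term (`SparseBound`).

On the probabilistic side, quadratic forms of the sample covariance are chi-squared variables up to
scale (`chiSq_tail`). Nets make their concentration uniform on a subspace (`subspace_tail`). The
range of Ω*_yxᵗ costs dimension q. A union over spans of s coordinates, followed by Maurey's
empirical method (`quad_ge_of_sparse`), gives the lower bound for all vectors. Polarization controls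
the entries of A_n and B_n (`score_tail`). A single event serves all (λ, μ, η), because s is taken
as large as the sample size permits rather than adapted to s_α. -/

namespace PGGM

/-! ### Symmetric matrices -/

section Toolkit

variable {m n : Type*} [Fintype m] [Fintype n]

open scoped MatrixOrder in
lemma exists_eq_transpose_mul_self [DecidableEq n] {A : Matrix n n ℝ} (hA : A.PosSemidef) :
    ∃ C : Matrix n n ℝ, A = Cᵀ * C := by
  obtain ⟨C, hC⟩ := CStarAlgebra.nonneg_iff_eq_star_mul_self.1 hA.nonneg
  exact ⟨C, by rw [hC, star_eq_conjTranspose, conjTranspose_eq_transpose_of_trivial]⟩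

lemma transpose_eq_of_isHermitian {n : Type*} {A : Matrix n n ℝ} (hA : A.IsHermitian) : Aᵀ = A := by
  rw [← conjTranspose_eq_transpose_of_trivial]; exact hA

lemma posSemidef_conj {A : Matrix n n ℝ} (hA : A.PosSemidef) (B : Matrix m n ℝ) :
    (B * A * Bᵀ).PosSemidef := by
  simpa [conjTranspose_eq_transpose_of_trivial] using hA.mul_mul_conjTranspose_same B

lemma posSemidef_conj' {A : Matrix n n ℝ} (hA : A.PosSemidef) (B : Matrix n m ℝ) :
    (Bᵀ * A * B).PosSemidef := by
  simpa [conjTranspose_eq_transpose_of_trivial] using hA.conjTranspose_mul_mul_same B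

lemma trace_mul_nonneg [DecidableEq n] {A B : Matrix n n ℝ} (hA : A.PosSemidef) (hB : B.PosSemidef) :
    0 ≤ (A * B).trace := by
  obtain ⟨C, rfl⟩ := exists_eq_transpose_mul_self hB
  rw [← Matrix.mul_assoc, trace_mul_comm, ← Matrix.mul_assoc]
  exact (posSemidef_conj hA C).trace_nonneg

lemma trace_mul_le [DecidableEq n] {A A' B : Matrix n n ℝ} (h : (A' - A).PosSemidef) (hB : B.PosSemidef) :
    (A * B).trace ≤ (A' * B).trace := by
  have := trace_mul_nonneg h hB
  rw [Matrix.sub_mul, trace_sub] at this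
  linarith

lemma quad_nonneg {A : Matrix n n ℝ} (hA : A.PosSemidef) (x : n → ℝ) : 0 ≤ x ⬝ᵥ A *ᵥ x := by
  simpa using hA.dotProduct_mulVec_nonneg x

lemma posSemidef_of_quad {A : Matrix n n ℝ} (h : Aᵀ = A) (hA : ∀ x : n → ℝ, 0 ≤ x ⬝ᵥ A *ᵥ x) :
    A.PosSemidef :=
  PosSemidef.of_dotProduct_mulVec_nonneg
    (by rw [IsHermitian, conjTranspose_eq_transpose_of_trivial, h]) (by simpa using hA)

lemma quad_smul_one_sub [DecidableEq n] (c : ℝ) (A : Matrix n n ℝ) (x : n → ℝ) :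
    x ⬝ᵥ (c • (1 : Matrix n n ℝ) - A) *ᵥ x = c * (x ⬝ᵥ x) - x ⬝ᵥ A *ᵥ x := by
  rw [sub_mulVec, dotProduct_sub, smul_mulVec, one_mulVec, dotProduct_smul, smul_eq_mul]

/-- A positive definite and a symmetric matrix are simultaneously congruent to the identity and to
a diagonal matrix. -/
lemma exists_simultaneous_diagonal [DecidableEq n] {A U : Matrix n n ℝ} (hA : A.PosDef) (hU : U.IsHermitian) :
    ∃ (K : Matrix n n ℝ) (ν : n → ℝ), IsUnit K ∧ A = Kᵀ * K ∧ U = Kᵀ * diagonal ν * K := by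
  obtain ⟨C, hC⟩ := exists_eq_transpose_mul_self hA.posSemidef
  have hCu : IsUnit C := by
    have := hA.isUnit
    rw [hC, isUnit_iff_isUnit_det, det_mul, det_transpose] at this
    rw [isUnit_iff_isUnit_det]
    exact isUnit_of_mul_isUnit_left this
  have hCd : IsUnit C.det := (isUnit_iff_isUnit_det C).1 hCu
  set N := (C⁻¹)ᵀ * U * C⁻¹ with hN
  have hNH : N.IsHermitian := by
    rw [hN, ← conjTranspose_eq_transpose_of_trivial]
    exact isHermitian_conjTranspose_mul_mul _ hU
  have hs := hNH.spectral_theorem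
  set O : Matrix n n ℝ := (hNH.eigenvectorUnitary : Matrix n n ℝ) with hO
  have hOO : O * Oᵀ = 1 := by
    rw [← conjTranspose_eq_transpose_of_trivial, ← star_eq_conjTranspose]
    exact Unitary.coe_mul_star_self _
  have hN' : N = O * diagonal hNH.eigenvalues * Oᵀ := by
    rw [Unitary.conjStarAlgAut_apply] at hs
    rw [← conjTranspose_eq_transpose_of_trivial, ← star_eq_conjTranspose]
    exact hs
  refine ⟨Oᵀ * C, hNH.eigenvalues, ?_, ?_, ?_⟩
  · refine IsUnit.mul ?_ hCu
    rw [isUnit_iff_isUnit_det]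
    exact IsUnit.of_mul_eq_one O.det (by rw [← det_mul, mul_eq_one_comm.1 hOO, det_one])
  · rw [transpose_mul, transpose_transpose, Matrix.mul_assoc, ← Matrix.mul_assoc O, hOO,
      Matrix.one_mul, hC]
  · have : Cᵀ * N * C = U := by
      rw [hN]
      have h1 : Cᵀ * (C⁻¹)ᵀ = 1 := by rw [← transpose_mul, nonsing_inv_mul _ hCd, transpose_one]
      calc Cᵀ * ((C⁻¹)ᵀ * U * C⁻¹) * C = (Cᵀ * (C⁻¹)ᵀ) * U * (C⁻¹ * C) := by
            simp only [Matrix.mul_assoc]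
        _ = U := by rw [h1, nonsing_inv_mul _ hCd, Matrix.one_mul, Matrix.mul_one]
    calc U = Cᵀ * (O * diagonal hNH.eigenvalues * Oᵀ) * C :=
          this.symm.trans (congrArg (fun X => Cᵀ * X * C) hN')
      _ = _ := by rw [transpose_mul, transpose_transpose]; simp only [Matrix.mul_assoc]

lemma posSemidef_conj_iff [DecidableEq n] {K M : Matrix n n ℝ} (hK : IsUnit K) :
    (Kᵀ * M * K).PosSemidef ↔ M.PosSemidef := by
  rw [← conjTranspose_eq_transpose_of_trivial, ← star_eq_conjTranspose]
  exact hK.posSemidef_star_left_conjugate_iff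

lemma posDef_conj_iff [DecidableEq n] {K M : Matrix n n ℝ} (hK : IsUnit K) :
    (Kᵀ * M * K).PosDef ↔ M.PosDef := by
  rw [← conjTranspose_eq_transpose_of_trivial, ← star_eq_conjTranspose]
  exact hK.posDef_star_left_conjugate_iff

lemma inv_conj [DecidableEq n] {K M : Matrix n n ℝ} :
    (Kᵀ * M * K)⁻¹ = K⁻¹ * M⁻¹ * (K⁻¹)ᵀ := by
  rw [Matrix.mul_inv_rev, Matrix.mul_inv_rev, transpose_nonsing_inv, Matrix.mul_assoc]

/-- The spectral data of `U` relative to `A`. -/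
lemma exists_relative_eigenvalues [DecidableEq n] {A U : Matrix n n ℝ} (hA : A.PosDef) (hU : U.IsHermitian)
    (hAU : (A + U).PosDef) :
    ∃ ν : n → ℝ, (∀ i, 0 < 1 + ν i) ∧
      Real.log (A + U).det = Real.log A.det + ∑ i, Real.log (1 + ν i) ∧
      (A⁻¹ * U).trace = ∑ i, ν i ∧
      (A⁻¹ * (U * (A + U)⁻¹ * U)).trace = ∑ i, ν i ^ 2 / (1 + ν i) ∧
      (∀ c : ℝ, (c • A - U).PosSemidef → ∀ i, ν i ≤ c) ∧
      (∀ c : ℝ, (U + c • A).PosSemidef → ∀ i, -c ≤ ν i) := by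
  obtain ⟨K, ν, hK, hAK, hUK⟩ := exists_simultaneous_diagonal hA hU
  have hKd : IsUnit K.det := (isUnit_iff_isUnit_det K).1 hK
  have hAK1 : A = Kᵀ * 1 * K := by rw [Matrix.mul_one, hAK]
  have hsum : A + U = Kᵀ * diagonal (fun i => 1 + ν i) * K := by
    rw [hAK1, hUK, ← Matrix.add_mul, ← Matrix.mul_add, ← diagonal_one, diagonal_add]
  have hpos : ∀ i, 0 < 1 + ν i := by
    rw [hsum, posDef_conj_iff hK, posDef_diagonal_iff] at hAU
    exact hAU
  have hKK : (K⁻¹)ᵀ * Kᵀ = 1 := by rw [← transpose_mul, mul_nonsing_inv _ hKd, transpose_one]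
  have hKK' : K * K⁻¹ = 1 := mul_nonsing_inv _ hKd
  have hinv : A⁻¹ = K⁻¹ * (K⁻¹)ᵀ := by rw [hAK1, inv_conj, inv_one, Matrix.mul_one]
  have hinv1 : (A + U)⁻¹ = K⁻¹ * diagonal (fun i => (1 + ν i)⁻¹) * (K⁻¹)ᵀ := by
    rw [hsum, inv_conj]
    congr 2
    refine inv_eq_right_inv ?_
    rw [diagonal_mul_diagonal, ← diagonal_one]
    congr 1
    ext i
    exact mul_inv_cancel₀ (hpos i).ne'
  refine ⟨ν, hpos, ?_, ?_, ?_, ?_, ?_⟩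
  · have hd : (A + U).det = A.det * ∏ i, (1 + ν i) := by
      rw [hsum, hAK, det_mul, det_mul, det_mul, det_diagonal]; ring
    rw [hd, Real.log_mul hA.det_pos.ne' (Finset.prod_pos fun i _ => hpos i).ne',
      Real.log_prod (fun i _ => (hpos i).ne')]
  · rw [hinv, hUK]
    calc (K⁻¹ * (K⁻¹)ᵀ * (Kᵀ * diagonal ν * K)).trace
        = (K⁻¹ * (((K⁻¹)ᵀ * Kᵀ) * diagonal ν * K)).trace := by simp only [Matrix.mul_assoc]
      _ = ((diagonal ν * K) * K⁻¹).trace := by rw [hKK, Matrix.one_mul, trace_mul_comm]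
      _ = ∑ i, ν i := by rw [Matrix.mul_assoc, hKK', Matrix.mul_one, trace_diagonal]
  · have h2 : A⁻¹ * (U * (A + U)⁻¹ * U) =
        K⁻¹ * (diagonal (fun i => ν i ^ 2 / (1 + ν i)) * K) := by
      rw [hinv, hinv1, hUK]
      calc K⁻¹ * (K⁻¹)ᵀ * (Kᵀ * diagonal ν * K * (K⁻¹ * diagonal (fun i => (1 + ν i)⁻¹) * (K⁻¹)ᵀ)
            * (Kᵀ * diagonal ν * K))
          = K⁻¹ * (((K⁻¹)ᵀ * Kᵀ) * diagonal ν * (K * K⁻¹) * diagonal (fun i => (1 + ν i)⁻¹)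
            * ((K⁻¹)ᵀ * Kᵀ) * diagonal ν * K) := by simp only [Matrix.mul_assoc]
        _ = _ := by
          rw [hKK, hKK', Matrix.one_mul, Matrix.mul_one, Matrix.mul_one, diagonal_mul_diagonal,
            diagonal_mul_diagonal]
          congr 3
          ext i
          rw [div_eq_mul_inv]; ring
    rw [h2, trace_mul_comm, Matrix.mul_assoc, hKK', Matrix.mul_one, trace_diagonal]
  · intro c hc i
    have : c • A - U = Kᵀ * diagonal (fun i => c - ν i) * K := by
      rw [hAK1, hUK, ← Matrix.smul_mul, ← Matrix.mul_smul, ← Matrix.sub_mul, ← Matrix.mul_sub,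
        ← diagonal_one, ← diagonal_smul, diagonal_sub]
      congr 3
      ext i; simp
    rw [this, posSemidef_conj_iff hK, posSemidef_diagonal_iff] at hc
    linarith [hc i]
  · intro c hc i
    have : U + c • A = Kᵀ * diagonal (fun i => ν i + c) * K := by
      rw [hAK1, hUK, ← Matrix.smul_mul, ← Matrix.mul_smul, ← Matrix.add_mul, ← Matrix.mul_add,
        ← diagonal_one, ← diagonal_smul, diagonal_add]
      congr 3
      ext i; simp
    rw [this, posSemidef_conj_iff hK, posSemidef_diagonal_iff] at hc
    linarith [hc i]

/-- Inversion reverses the order between a positive definite matrix and a scalar. -/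
lemma inv_sub_smul_one_posSemidef [DecidableEq n] {A : Matrix n n ℝ} (hA : A.PosDef) {c : ℝ} (hc : 0 < c)
    (h : (c • (1 : Matrix n n ℝ) - A).PosSemidef) :
    (A⁻¹ - c⁻¹ • (1 : Matrix n n ℝ)).PosSemidef := by
  have hU : (c • (1 : Matrix n n ℝ)).IsHermitian := by
    simp [IsHermitian, conjTranspose_eq_transpose_of_trivial]
  obtain ⟨K, ν, hK, hAK, hUK⟩ := exists_simultaneous_diagonal hA hU
  have hAK1 : A = Kᵀ * 1 * K := by rw [Matrix.mul_one, hAK]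
  have hν : ∀ i, 1 ≤ ν i := by
    have : c • (1 : Matrix n n ℝ) - A = Kᵀ * diagonal (fun i => ν i - 1) * K := by
      rw [hUK, hAK1, ← Matrix.sub_mul, ← Matrix.mul_sub, ← diagonal_one, diagonal_sub]
    rw [this, posSemidef_conj_iff hK, posSemidef_diagonal_iff] at h
    intro i; linarith [h i]
  have hc1 : c⁻¹ • (1 : Matrix n n ℝ) = (c • (1 : Matrix n n ℝ))⁻¹ := by
    symm
    refine inv_eq_right_inv ?_
    rw [Matrix.smul_mul, Matrix.mul_smul, smul_smul, mul_inv_cancel₀ hc.ne', one_smul,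
      Matrix.one_mul]
  have hd : (diagonal ν)⁻¹ = diagonal fun i => (ν i)⁻¹ := by
    refine inv_eq_right_inv ?_
    rw [diagonal_mul_diagonal, ← diagonal_one]
    congr 1
    ext i
    exact mul_inv_cancel₀ (by linarith [hν i])
  rw [hc1, hUK, inv_conj, hAK1, inv_conj, inv_one, hd, ← Matrix.sub_mul, ← Matrix.mul_sub,
    ← diagonal_one, diagonal_sub]
  apply posSemidef_conj
  rw [posSemidef_diagonal_iff]
  intro i
  have := inv_le_one_of_one_le₀ (hν i)
  linarith

end Toolkit

/-! ### Extreme eigenvalues -/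

section Eigen

variable {d : ℕ} {A : Matrix (Fin d) (Fin d) ℝ}

lemma finite_spectrum (A : Matrix (Fin d) (Fin d) ℝ) (hA : A.IsHermitian) :
    (spectrum ℝ A).Finite := by
  rw [hA.spectrum_real_eq_range_eigenvalues]; exact Set.finite_range _

lemma isHermitian_smul_one (c : ℝ) : (c • (1 : Matrix (Fin d) (Fin d) ℝ)).IsHermitian := by
  simp [IsHermitian, conjTranspose_eq_transpose_of_trivial]

lemma smul_one_sub_posSemidef (hA : A.IsHermitian) {c : ℝ} (h : ∀ i, hA.eigenvalues i ≤ c) :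
    (c • (1 : Matrix (Fin d) (Fin d) ℝ) - A).PosSemidef := by
  rw [posSemidef_iff_isHermitian_and_spectrum_nonneg]
  refine ⟨(isHermitian_smul_one c).sub hA, fun x hx => ?_⟩
  rw [← Algebra.algebraMap_eq_smul_one, ← spectrum.singleton_sub_eq,
    hA.spectrum_real_eq_range_eigenvalues] at hx
  obtain ⟨_, rfl, _, ⟨i, rfl⟩, rfl⟩ := hx
  exact sub_nonneg.2 (h i)

lemma sub_smul_one_posSemidef (hA : A.IsHermitian) {c : ℝ} (h : ∀ i, c ≤ hA.eigenvalues i) :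
    (A - c • (1 : Matrix (Fin d) (Fin d) ℝ)).PosSemidef := by
  rw [posSemidef_iff_isHermitian_and_spectrum_nonneg]
  refine ⟨hA.sub (isHermitian_smul_one c), fun x hx => ?_⟩
  rw [← Algebra.algebraMap_eq_smul_one, ← spectrum.sub_singleton_eq,
    hA.spectrum_real_eq_range_eigenvalues] at hx
  obtain ⟨_, ⟨i, rfl⟩, _, rfl, rfl⟩ := hx
  exact sub_nonneg.2 (h i)

lemma eigenvalues_le_lamMax (hA : A.IsHermitian) (i : Fin d) : hA.eigenvalues i ≤ lamMax A := by
  refine le_csSup (finite_spectrum A hA).bddAbove ?_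
  rw [hA.spectrum_real_eq_range_eigenvalues]; exact ⟨i, rfl⟩

lemma lamMin_le_eigenvalues (hA : A.IsHermitian) (i : Fin d) : lamMin A ≤ hA.eigenvalues i := by
  refine csInf_le (finite_spectrum A hA).bddBelow ?_
  rw [hA.spectrum_real_eq_range_eigenvalues]; exact ⟨i, rfl⟩

lemma lamMax_sub_posSemidef (hA : A.IsHermitian) :
    (lamMax A • (1 : Matrix (Fin d) (Fin d) ℝ) - A).PosSemidef :=
  smul_one_sub_posSemidef hA (eigenvalues_le_lamMax hA)

lemma sub_lamMin_posSemidef (hA : A.IsHermitian) :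
    (A - lamMin A • (1 : Matrix (Fin d) (Fin d) ℝ)).PosSemidef :=
  sub_smul_one_posSemidef hA (lamMin_le_eigenvalues hA)

lemma lamMin_le_lamMax (hA : A.IsHermitian) (hd : 0 < d) : lamMin A ≤ lamMax A :=
  (lamMin_le_eigenvalues hA ⟨0, hd⟩).trans (eigenvalues_le_lamMax hA ⟨0, hd⟩)

/-- A finite nonempty spectrum attains its infimum, which is thus a positive eigenvalue. In
dimension 0 the infimum of the empty set would be 0. -/
lemma lamMin_pos (hA : A.PosDef) (hd : 0 < d) : 0 < lamMin A := by
  have hne : (spectrum ℝ A).Nonempty := by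
    rw [hA.1.spectrum_real_eq_range_eigenvalues]; exact ⟨_, ⟨0, hd⟩, rfl⟩
  have := hne.csInf_mem (finite_spectrum A hA.1)
  rw [hA.1.spectrum_real_eq_range_eigenvalues] at this
  obtain ⟨i, hi⟩ := this
  have h0 := hA.eigenvalues_pos i
  rw [hi, ← hA.1.spectrum_real_eq_range_eigenvalues] at h0
  exact h0

lemma lamMax_pos (hA : A.PosDef) (hd : 0 < d) : 0 < lamMax A :=
  (lamMin_pos hA hd).trans_le (lamMin_le_lamMax hA.1 hd)

lemma quad_le_lamMax (hA : A.IsHermitian) (x : Fin d → ℝ) :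
    x ⬝ᵥ A *ᵥ x ≤ lamMax A * (x ⬝ᵥ x) := by
  have := quad_nonneg (lamMax_sub_posSemidef hA) x
  rw [quad_smul_one_sub] at this
  linarith

lemma lamMin_le_quad (hA : A.IsHermitian) (x : Fin d → ℝ) :
    lamMin A * (x ⬝ᵥ x) ≤ x ⬝ᵥ A *ᵥ x := by
  have := quad_nonneg (sub_lamMin_posSemidef hA) x
  rw [← neg_sub, neg_mulVec, dotProduct_neg, quad_smul_one_sub] at this
  linarith

lemma diag_le_lamMax (hA : A.IsHermitian) (j : Fin d) : A j j ≤ lamMax A := by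
  have := quad_le_lamMax hA (Pi.single j 1)
  simpa using this

end Eigen

end PGGM

/-! ### Expansions and convexity of the objective. -/

namespace PGGM

/-! ### The Frobenius inner product -/

section Frob

variable {k l m : ℕ}

lemma frobInner_eq_sum (A B : Matrix (Fin k) (Fin l) ℝ) :
    frobInner A B = ∑ i, ∑ j, A i j * B i j := by
  rw [frobInner, trace, Finset.sum_comm]
  simp [mul_apply]

lemma frobInner_add_right (A B C : Matrix (Fin k) (Fin l) ℝ) :
    frobInner A (B + C) = frobInner A B + frobInner A C := by
  simp [frobInner, Matrix.mul_add]

lemma frobInner_sub_right (A B C : Matrix (Fin k) (Fin l) ℝ) :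
    frobInner A (B - C) = frobInner A B - frobInner A C := by
  simp [frobInner, Matrix.mul_sub]

lemma frobInner_smul_right (c : ℝ) (A B : Matrix (Fin k) (Fin l) ℝ) :
    frobInner A (c • B) = c * frobInner A B := by
  simp [frobInner]

lemma frobInner_add_left (A B C : Matrix (Fin k) (Fin l) ℝ) :
    frobInner (A + B) C = frobInner A C + frobInner B C := by
  simp [frobInner, Matrix.add_mul]

lemma frobInner_sub_left (A B C : Matrix (Fin k) (Fin l) ℝ) :
    frobInner (A - B) C = frobInner A C - frobInner B C := by
  simp [frobInner, Matrix.sub_mul]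

lemma frobInner_smul_left (c : ℝ) (A B : Matrix (Fin k) (Fin l) ℝ) :
    frobInner (c • A) B = c * frobInner A B := by
  simp [frobInner]

lemma frobInner_transpose_mul (S : Matrix (Fin l) (Fin m) ℝ) (X : Matrix (Fin k) (Fin l) ℝ)
    (V : Matrix (Fin k) (Fin m) ℝ) : frobInner S (Xᵀ * V) = frobInner (X * S) V := by
  rw [frobInner, frobInner, transpose_mul, Matrix.mul_assoc]

lemma frobInner_mul_right (S : Matrix (Fin l) (Fin m) ℝ) (V : Matrix (Fin l) (Fin k) ℝ)
    (X : Matrix (Fin k) (Fin m) ℝ) : frobInner S (V * X) = frobInner (S * Xᵀ) V := by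
  rw [frobInner, frobInner, transpose_mul, transpose_transpose, ← Matrix.mul_assoc, trace_mul_comm,
    Matrix.mul_assoc]

lemma frobInner_transpose (A B : Matrix (Fin k) (Fin l) ℝ) :
    frobInner Aᵀ Bᵀ = frobInner A B := by
  simp only [frobInner_eq_sum, transpose_apply]
  exact Finset.sum_comm

/-- Positive semidefinite weights make `X ↦ ⟪S, Xᵀ H X⟫` a sum of squares. -/
lemma exists_frobInner_conj_eq_sum_sq {S : Matrix (Fin l) (Fin l) ℝ} (hS : S.PosSemidef)
    {H : Matrix (Fin k) (Fin k) ℝ} (hH : H.PosSemidef) :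
    ∃ (F : Matrix (Fin l) (Fin l) ℝ) (G : Matrix (Fin k) (Fin k) ℝ),
      ∀ X : Matrix (Fin k) (Fin l) ℝ,
        frobInner S (Xᵀ * H * X) = ∑ i, ∑ j, (G * X * Fᵀ) i j ^ 2 := by
  obtain ⟨F, rfl⟩ := exists_eq_transpose_mul_self hS
  obtain ⟨G, rfl⟩ := exists_eq_transpose_mul_self hH
  refine ⟨F, G, fun X => ?_⟩
  have : ∑ i, ∑ j, (G * X * Fᵀ) i j ^ 2 = frobInner (G * X * Fᵀ) (G * X * Fᵀ) := by
    rw [frobInner_eq_sum]; simp [sq]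
  rw [this, frobInner_mul_right (G * X * Fᵀ) (G * X) Fᵀ, transpose_transpose,
    Matrix.mul_assoc (G * X), ← frobInner_transpose_mul (Fᵀ * F) (G * X) (G * X), transpose_mul]
  simp only [Matrix.mul_assoc]

lemma frobInner_conj_nonneg {S : Matrix (Fin l) (Fin l) ℝ} (hS : S.PosSemidef)
    {H : Matrix (Fin k) (Fin k) ℝ} (hH : H.PosSemidef) (X : Matrix (Fin k) (Fin l) ℝ) :
    0 ≤ frobInner S (Xᵀ * H * X) := by
  obtain ⟨F, G, h⟩ := exists_frobInner_conj_eq_sum_sq hS hH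
  rw [h]
  positivity

/-- Young's inequality for the form `X ↦ ⟪S, Xᵀ H X⟫`. -/
lemma frobInner_conj_sub_ge {S : Matrix (Fin l) (Fin l) ℝ} (hS : S.PosSemidef)
    {H : Matrix (Fin k) (Fin k) ℝ} (hH : H.PosSemidef) (V Y : Matrix (Fin k) (Fin l) ℝ)
    {ε : ℝ} (hε : 0 < ε) :
    (2 * ε / (2 + ε) * frobInner S (Vᵀ * H * V) - ε * frobInner S (Yᵀ * H * Y)) / 2
      ≤ frobInner S ((V - Y)ᵀ * H * (V - Y)) := by
  obtain ⟨F, G, h⟩ := exists_frobInner_conj_eq_sum_sq hS hH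
  rw [h, h, h, Finset.mul_sum, Finset.mul_sum, ← Finset.sum_sub_distrib, Finset.sum_div]
  refine Finset.sum_le_sum fun i _ => ?_
  rw [Finset.mul_sum, Finset.mul_sum, ← Finset.sum_sub_distrib, Finset.sum_div]
  refine Finset.sum_le_sum fun j _ => ?_
  rw [Matrix.mul_sub, Matrix.sub_mul, Matrix.sub_apply]
  generalize (G * V * Fᵀ) i j = x
  generalize (G * Y * Fᵀ) i j = y
  have h2 : (0 : ℝ) < 2 + ε := by linarith
  have h3 : (x - y) ^ 2 - (2 * ε / (2 + ε) * x ^ 2 - ε * y ^ 2) / 2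
      = (2 * x - (2 + ε) * y) ^ 2 / (2 * (2 + ε)) := by
    field_simp
    ring
  have h4 : 0 ≤ (2 * x - (2 + ε) * y) ^ 2 / (2 * (2 + ε)) := by positivity
  linarith

end Frob

/-! ### The matrix fractional function -/

section Phi

variable {p q : ℕ}

/-- `⟪S, Bᵗ A⁻¹ B⟫` for `θ = (A, B)`. -/
noncomputable def phi (S : Matrix (Fin p) (Fin p) ℝ) (θ : Param p q) : ℝ :=
  frobInner S (θ.2ᵀ * θ.1⁻¹ * θ.2)

/-- The differential of `phi S` at `θ`. -/
noncomputable def phiLin (S : Matrix (Fin p) (Fin p) ℝ) (θ Δ : Param p q) : ℝ :=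
  2 * frobInner (θ.1⁻¹ * θ.2 * S) Δ.2 - frobInner (θ.1⁻¹ * θ.2 * S * θ.2ᵀ * θ.1⁻¹) Δ.1

/-- The Bregman divergence of `phi S`. -/
noncomputable def phiRem (S : Matrix (Fin p) (Fin p) ℝ) (θ Δ : Param p q) : ℝ :=
  frobInner S ((Δ.2 - Δ.1 * θ.1⁻¹ * θ.2)ᵀ * (θ.1 + Δ.1)⁻¹ * (Δ.2 - Δ.1 * θ.1⁻¹ * θ.2))

lemma inv_transpose_of_posDef {A : Matrix (Fin q) (Fin q) ℝ} (hA : A.PosDef) : (A⁻¹)ᵀ = A⁻¹ :=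
  transpose_eq_of_isHermitian hA.inv.1

/-- With X = A⁻¹B one has B + V = (A + U)X + W, where W = V - UX. Expanding against (A + U)⁻¹ leaves
constant and linear terms in (U, V) and the single square WᵗHW with H = (A + U)⁻¹, so nothing is
lost to a Taylor estimate. -/
lemma fractional_expansion {A U : Matrix (Fin q) (Fin q) ℝ} (hA : A.PosDef) (hAU : (A + U).PosDef)
    (B V : Matrix (Fin q) (Fin p) ℝ) :
    (B + V)ᵀ * (A + U)⁻¹ * (B + V) = Bᵀ * A⁻¹ * B + ((A⁻¹ * B)ᵀ * V + Vᵀ * (A⁻¹ * B)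
      - (A⁻¹ * B)ᵀ * (U * (A⁻¹ * B)))
      + (V - U * A⁻¹ * B)ᵀ * (A + U)⁻¹ * (V - U * A⁻¹ * B) := by
  have hAd : IsUnit A.det := (isUnit_iff_isUnit_det A).1 hA.isUnit
  have hAUd : IsUnit (A + U).det := (isUnit_iff_isUnit_det _).1 hAU.isUnit
  have hAt := transpose_eq_of_isHermitian hA.1
  have hAUt := transpose_eq_of_isHermitian hAU.1
  set X := A⁻¹ * B with hX
  have hAX : A * X = B := by rw [hX, ← Matrix.mul_assoc, mul_nonsing_inv _ hAd, Matrix.one_mul]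
  have hUt : Uᵀ = U := by
    have : (A + U)ᵀ = A + U := hAUt
    rw [transpose_add, hAt] at this
    exact add_left_cancel this
  have hUX : U * A⁻¹ * B = U * X := by rw [hX, Matrix.mul_assoc]
  rw [hUX]
  set W := V - U * X with hW
  have hBV : B + V = (A + U) * X + W := by rw [Matrix.add_mul, hAX, hW]; abel
  have hBX : Bᵀ * A⁻¹ * B = Xᵀ * (A * X) := by
    rw [hAX, hX, transpose_mul, inv_transpose_of_posDef hA]
  have h1 : ((A + U) * X + W)ᵀ * (A + U)⁻¹ * ((A + U) * X + W)
      = Xᵀ * ((A + U) * X) + Xᵀ * W + Wᵀ * X + Wᵀ * (A + U)⁻¹ * W := by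
    rw [transpose_add, transpose_mul, hAUt]
    calc (Xᵀ * (A + U) + Wᵀ) * (A + U)⁻¹ * ((A + U) * X + W)
        = Xᵀ * ((A + U) * (A + U)⁻¹) * ((A + U) * X + W)
          + Wᵀ * ((A + U)⁻¹ * (A + U)) * X + Wᵀ * (A + U)⁻¹ * W := by
            simp only [Matrix.add_mul, Matrix.mul_add, Matrix.mul_assoc]; abel
      _ = _ := by
        rw [mul_nonsing_inv _ hAUd, nonsing_inv_mul _ hAUd, Matrix.mul_one, Matrix.mul_one,
          Matrix.mul_add]
  rw [hBV, h1, hBX]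
  have h2 : Xᵀ * W = Xᵀ * V - Xᵀ * (U * X) := by rw [hW, Matrix.mul_sub]
  have h3 : Wᵀ * X = Vᵀ * X - Xᵀ * (U * X) := by
    rw [hW, transpose_sub, transpose_mul, hUt, Matrix.sub_mul, Matrix.mul_assoc]
  rw [h2, h3, Matrix.add_mul, Matrix.mul_add]
  abel

lemma phi_add {S : Matrix (Fin p) (Fin p) ℝ} (hS : Sᵀ = S) {θ Δ : Param p q} (h : θ.1.PosDef)
    (h' : (θ.1 + Δ.1).PosDef) : phi S (θ + Δ) = phi S θ + phiLin S θ Δ + phiRem S θ Δ := by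
  rw [phi, phi, phiLin, phiRem, Prod.fst_add, Prod.snd_add, fractional_expansion h h',
    frobInner_add_right, frobInner_add_right, frobInner_sub_right, frobInner_add_right]
  have h1 : frobInner S (Δ.2ᵀ * (θ.1⁻¹ * θ.2)) = frobInner (θ.1⁻¹ * θ.2 * S) Δ.2 := by
    rw [← frobInner_transpose, transpose_mul, transpose_transpose, hS, frobInner_transpose_mul]
  have h2 : frobInner S ((θ.1⁻¹ * θ.2)ᵀ * (Δ.1 * (θ.1⁻¹ * θ.2)))
      = frobInner (θ.1⁻¹ * θ.2 * S * θ.2ᵀ * θ.1⁻¹) Δ.1 := by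
    rw [frobInner_transpose_mul, frobInner_mul_right, transpose_mul, inv_transpose_of_posDef h]
    simp only [Matrix.mul_assoc]
  rw [h1, h2, frobInner_transpose_mul]
  ring

lemma phi_nonneg {S : Matrix (Fin p) (Fin p) ℝ} (hS : S.PosSemidef) {θ : Param p q}
    (h : θ.1.PosDef) : 0 ≤ phi S θ :=
  frobInner_conj_nonneg hS h.inv.posSemidef _

lemma phiRem_nonneg {S : Matrix (Fin p) (Fin p) ℝ} (hS : S.PosSemidef) {θ Δ : Param p q}
    (h : (θ.1 + Δ.1).PosDef) : 0 ≤ phiRem S θ Δ :=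
  frobInner_conj_nonneg hS h.inv.posSemidef _

lemma phiLin_smul (S : Matrix (Fin p) (Fin p) ℝ) (θ Δ : Param p q) (c : ℝ) :
    phiLin S θ (c • Δ) = c * phiLin S θ Δ := by
  rw [phiLin, phiLin, Prod.smul_fst, Prod.smul_snd, frobInner_smul_right, frobInner_smul_right]
  ring

end Phi

/-! ### The log-determinant -/

/-- The Bregman divergence of `-log det`. -/
noncomputable def logDetRem {q : ℕ} (A U : Matrix (Fin q) (Fin q) ℝ) : ℝ :=
  -Real.log (A + U).det + Real.log A.det + (A⁻¹ * U).trace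

lemma logDetRem_nonneg {q : ℕ} {A U : Matrix (Fin q) (Fin q) ℝ} (hA : A.PosDef)
    (hAU : (A + U).PosDef) : 0 ≤ logDetRem A U := by
  have hU : U.IsHermitian := by simpa using hAU.1.sub hA.1
  obtain ⟨ν, h0, h1, h2, -⟩ := exists_relative_eigenvalues hA hU hAU
  rw [logDetRem, h1, h2]
  have : ∑ i, Real.log (1 + ν i) ≤ ∑ i, ν i := Finset.sum_le_sum fun i _ => by
    linarith [Real.log_le_sub_one_of_pos (h0 i)]
  linarith

/-- This is x ≤ sinh x at x = log t. -/
lemma log_le_half_sub_inv {t : ℝ} (ht : 1 ≤ t) : Real.log t ≤ (t - t⁻¹) / 2 := by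
  have h := Real.self_le_sinh_iff.2 (Real.log_nonneg ht)
  rwa [Real.sinh_log (by linarith)] at h

/-- For x ≥ 0 the logarithm is bounded by the hyperbolic sine; for x ≤ 0 a rational lower bound is
applied to log (1 + x)⁻¹. In the second case the slack has the sign of 1 + 2x, which is where -1/2
comes from. -/
lemma sub_log_one_add_ge {x : ℝ} (h1 : -(1 / 2) ≤ x) : x ^ 2 / (1 + x) / 3 ≤ x - Real.log (1 + x) := by
  have hpos : 0 < 1 + x := by linarith
  rcases le_total 0 x with h0 | h0
  · have h := log_le_half_sub_inv (t := 1 + x) (by linarith)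
    have : x - ((1 + x) - (1 + x)⁻¹) / 2 - x ^ 2 / (1 + x) / 3 = x ^ 2 / (6 * (1 + x)) := by
      field_simp; ring
    have h6 : 0 ≤ x ^ 2 / (6 * (1 + x)) := by positivity
    linarith
  · have hy : 0 ≤ (1 + x)⁻¹ - 1 := by
      rw [sub_nonneg]; exact (one_le_inv₀ hpos).2 (by linarith)
    have h := Real.le_log_one_add_of_nonneg hy
    rw [add_sub_cancel, Real.log_inv] at h
    have e : 2 * ((1 + x)⁻¹ - 1) / ((1 + x)⁻¹ - 1 + 2) = -(2 * x) / (2 + x) := by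
      have h2 : 2 + x ≠ 0 := by linarith
      have e1 : (1 + x)⁻¹ - 1 = -x / (1 + x) := by field_simp; ring
      have e2 : (1 + x)⁻¹ - 1 + 2 = (2 + x) / (1 + x) := by field_simp; ring
      rw [e2, e1]
      field_simp
    rw [e] at h
    have h2 : 0 < 2 + x := by linarith
    have : x + -(2 * x) / (2 + x) - x ^ 2 / (1 + x) / 3
        = x ^ 2 * (1 + 2 * x) / (3 * (1 + x) * (2 + x)) := by
      field_simp; ring
    have h6 : 0 ≤ x ^ 2 * (1 + 2 * x) / (3 * (1 + x) * (2 + x)) := by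
      have : 0 ≤ 1 + 2 * x := by linarith
      positivity
    linarith

/-- The scalar inequality is summed over the eigenvalues of U relative to A. The form is kept with
(A + U)⁻¹ inside so that it can absorb the cross terms of the fractional function, which carry the
same factor. -/
lemma logDetRem_ge {q : ℕ} {A U : Matrix (Fin q) (Fin q) ℝ} (hA : A.PosDef)
    (hAU : (A + U).PosDef) (h : (U + (1 / 2 : ℝ) • A).PosSemidef) :
    (A⁻¹ * (U * (A + U)⁻¹ * U)).trace / 3 ≤ logDetRem A U := by
  have hU : U.IsHermitian := by simpa using hAU.1.sub hA.1
  obtain ⟨ν, h0, h1, h2, h3, -, h4⟩ := exists_relative_eigenvalues hA hU hAU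
  rw [logDetRem, h1, h2, h3]
  have : (∑ i, ν i ^ 2 / (1 + ν i)) / 3 ≤ ∑ i, (ν i - Real.log (1 + ν i)) := by
    rw [Finset.sum_div]
    exact Finset.sum_le_sum fun i _ => sub_log_one_add_ge (h4 _ h i)
  rw [Finset.sum_sub_distrib] at this
  linarith

/-- The tangent line inequality for `x ↦ x ^ β`. -/
lemma rpow_ge_tangent {x y β : ℝ} (hx : 0 ≤ x) (hy : 0 ≤ y) (hβ : 1 ≤ β) :
    y ^ β + β * y ^ (β - 1) * (x - y) ≤ x ^ β := by
  rcases hy.eq_or_lt with rfl | hy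
  · rw [Real.zero_rpow (by linarith)]
    -- At y = 0 the slope vanishes only for β > 1, since 0 ^ 0 = 1.
    rcases hβ.eq_or_lt with rfl | hβ
    · simp
    · rw [Real.zero_rpow (by linarith)]
      simpa using Real.rpow_nonneg hx β
  · have h := one_add_mul_self_le_rpow_one_add (s := x / y - 1) (by
      have : 0 ≤ x / y := by positivity
      linarith) hβ
    rw [add_sub_cancel, Real.div_rpow hx hy.le, le_div_iff₀ (Real.rpow_pos_of_pos hy _)] at h
    refine le_trans (le_of_eq ?_) h
    rw [Real.rpow_sub_one hy.ne']
    field_simp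

/-! ### The objective -/

namespace Model

variable {p q : ℕ} (M : Model p q)

/-- The objective without its `ℓ¹` penalties. -/
noncomputable def smooth (R : Reg) (S : Matrix (Fin q ⊕ Fin p) (Fin q ⊕ Fin p) ℝ)
    (θ : Param p q) : ℝ :=
  -Real.log θ.1.det + frobInner S.toBlocks₁₁ θ.1 + 2 * frobInner S.toBlocks₁₂ θ.2
    + phi S.toBlocks₂₂ θ + R.eta * phi M.L θ ^ M.β

/-- The differential of the smooth part. -/
noncomputable def smoothLin (R : Reg) (S : Matrix (Fin q ⊕ Fin p) (Fin q ⊕ Fin p) ℝ)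
    (θ Δ : Param p q) : ℝ :=
  -(θ.1⁻¹ * Δ.1).trace + frobInner S.toBlocks₁₁ Δ.1 + 2 * frobInner S.toBlocks₁₂ Δ.2
    + phiLin S.toBlocks₂₂ θ Δ + R.eta * (M.β * phi M.L θ ^ (M.β - 1)) * phiLin M.L θ Δ

lemma objective_eq (R : Reg) (S : Matrix (Fin q ⊕ Fin p) (Fin q ⊕ Fin p) ℝ) (θ : Param p q) :
    M.objective R S θ = M.smooth R S θ + (R.lam * l1NormOff θ.1 + R.mu * l1Norm θ.2) := by
  rw [objective, smooth, phi, phi]; ring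

lemma smoothLin_smul (R : Reg) (S : Matrix (Fin q ⊕ Fin p) (Fin q ⊕ Fin p) ℝ)
    (θ Δ : Param p q) (c : ℝ) : M.smoothLin R S θ (c • Δ) = c * M.smoothLin R S θ Δ := by
  rw [smoothLin, smoothLin, phiLin_smul, phiLin_smul, Prod.smul_fst, Prod.smul_snd,
    frobInner_smul_right, frobInner_smul_right, Matrix.mul_smul, trace_smul, smul_eq_mul]
  ring

variable {M}

/-- The power β is the only source of inequality: its tangent line is used at `phi M.L θ`, and all
other terms expand exactly. -/
lemma smooth_add_ge {R : Reg} {S : Matrix (Fin q ⊕ Fin p) (Fin q ⊕ Fin p) ℝ}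
    (hS : S.toBlocks₂₂ᵀ = S.toBlocks₂₂) (hL : M.L.PosDef) (hβ : 1 ≤ M.β) (hη : 0 ≤ R.eta)
    {θ Δ : Param p q} (h : θ.1.PosDef) (h' : (θ.1 + Δ.1).PosDef) :
    M.smooth R S θ + M.smoothLin R S θ Δ + (logDetRem θ.1 Δ.1 + phiRem S.toBlocks₂₂ θ Δ
      + R.eta * (M.β * phi M.L θ ^ (M.β - 1)) * phiRem M.L θ Δ) ≤ M.smooth R S (θ + Δ) := by
  have h1 := phi_add (transpose_eq_of_isHermitian hL.1) h h'
  have h2 := rpow_ge_tangent (phi_nonneg (θ := θ + Δ) hL.posSemidef h')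
    (phi_nonneg hL.posSemidef h) hβ
  have h3 := mul_le_mul_of_nonneg_left h2 hη
  rw [smooth, smooth, smoothLin, logDetRem, phi_add hS h h', Prod.fst_add, Prod.snd_add,
    frobInner_add_right, frobInner_add_right]
  rw [h1] at h3 ⊢
  linarith

lemma smooth_add_ge_lin {R : Reg} {S : Matrix (Fin q ⊕ Fin p) (Fin q ⊕ Fin p) ℝ}
    (hS : S.toBlocks₂₂.PosSemidef) (hL : M.L.PosDef) (hβ : 1 ≤ M.β) (hη : 0 ≤ R.eta)
    {θ Δ : Param p q} (h : θ.1.PosDef) (h' : (θ.1 + Δ.1).PosDef) :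
    M.smooth R S θ + M.smoothLin R S θ Δ ≤ M.smooth R S (θ + Δ) := by
  have h1 := smooth_add_ge (R := R) (transpose_eq_of_isHermitian hS.1) hL hβ hη h h'
  have h2 := logDetRem_nonneg h h'
  have h3 := phiRem_nonneg hS h'
  have h4 : 0 ≤ R.eta * (M.β * phi M.L θ ^ (M.β - 1)) * phiRem M.L θ Δ := by
    have := phiRem_nonneg hL.posSemidef h'
    have := phi_nonneg hL.posSemidef h
    positivity
  linarith

lemma l1Norm_convex {k l : ℕ} (A B : Matrix (Fin k) (Fin l) ℝ) {t : ℝ} (h0 : 0 ≤ t) (h1 : t ≤ 1) :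
    l1Norm (A + t • (B - A)) ≤ (1 - t) * l1Norm A + t * l1Norm B := by
  simp only [l1Norm, Finset.mul_sum, ← Finset.sum_add_distrib]
  refine Finset.sum_le_sum fun i _ => Finset.sum_le_sum fun j _ => ?_
  have : (A + t • (B - A)) i j = (1 - t) * A i j + t * B i j := by simp; ring
  rw [this]
  refine (abs_add_le _ _).trans ?_
  rw [abs_mul, abs_mul, abs_of_nonneg h0, abs_of_nonneg (by linarith : 0 ≤ 1 - t)]

lemma l1NormOff_convex {k : ℕ} (A B : Matrix (Fin k) (Fin k) ℝ) {t : ℝ} (h0 : 0 ≤ t)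
    (h1 : t ≤ 1) : l1NormOff (A + t • (B - A)) ≤ (1 - t) * l1NormOff A + t * l1NormOff B := by
  simp only [l1NormOff, Finset.mul_sum, ← Finset.sum_add_distrib]
  refine Finset.sum_le_sum fun i _ => Finset.sum_le_sum fun j _ => ?_
  split_ifs
  · simp
  have : (A + t • (B - A)) i j = (1 - t) * A i j + t * B i j := by simp; ring
  rw [this]
  refine (abs_add_le _ _).trans ?_
  rw [abs_mul, abs_mul, abs_of_nonneg h0, abs_of_nonneg (by linarith : 0 ≤ 1 - t)]

lemma posDef_segment {A B : Matrix (Fin q) (Fin q) ℝ} (hA : A.PosDef) (hB : B.PosDef) {t : ℝ}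
    (h0 : 0 ≤ t) (h1 : t ≤ 1) : (A + t • (B - A)).PosDef := by
  rcases h1.eq_or_lt with rfl | h1
  · simpa using hB
  · have : A + t • (B - A) = (1 - t) • A + t • B := by
      rw [smul_sub, sub_smul, one_smul]; abel
    rw [this]
    exact (hA.smul (by linarith : 0 < 1 - t)).add_posSemidef (hB.posSemidef.smul h0)

/-- Both endpoints are compared with the tangent at the intermediate point. The displacements are -t
and 1 - t times the same direction, so the linear terms cancel in the average with weights 1 - t and
t. -/
lemma objective_convex {R : Reg} {S : Matrix (Fin q ⊕ Fin p) (Fin q ⊕ Fin p) ℝ}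
    (hS : S.toBlocks₂₂.PosSemidef) (hL : M.L.PosDef) (hβ : 1 ≤ M.β) (hη : 0 ≤ R.eta)
    (hlam : 0 ≤ R.lam) (hmu : 0 ≤ R.mu) {θ θ' : Param p q} (h : θ.1.PosDef) (h' : θ'.1.PosDef)
    {t : ℝ} (h0 : 0 ≤ t) (h1 : t ≤ 1) :
    M.objective R S (θ + t • (θ' - θ)) ≤ (1 - t) * M.objective R S θ + t * M.objective R S θ' := by
  set θt := θ + t • (θ' - θ) with hθt
  have ht : θt.1.PosDef := posDef_segment h h' h0 h1
  have e1 : θt + (-t) • (θ' - θ) = θ := by rw [hθt, neg_smul]; abel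
  have e2 : θt + (1 - t) • (θ' - θ) = θ' := by rw [hθt, sub_smul, one_smul]; abel
  have i1 := smooth_add_ge_lin (M := M) (R := R) (Δ := (-t) • (θ' - θ)) hS hL hβ hη ht
    (by rw [← Prod.fst_add, e1]; exact h)
  have i2 := smooth_add_ge_lin (M := M) (R := R) (Δ := (1 - t) • (θ' - θ)) hS hL hβ hη ht
    (by rw [← Prod.fst_add, e2]; exact h')
  rw [e1, smoothLin_smul] at i1
  rw [e2, smoothLin_smul] at i2
  have j1 := mul_le_mul_of_nonneg_left i1 (by linarith : 0 ≤ 1 - t)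
  have j2 := mul_le_mul_of_nonneg_left i2 h0
  have k1 := mul_le_mul_of_nonneg_left (l1NormOff_convex θ.1 θ'.1 h0 h1) hlam
  have k2 := mul_le_mul_of_nonneg_left (l1Norm_convex θ.2 θ'.2 h0 h1) hmu
  rw [objective_eq, objective_eq, objective_eq]
  have f1 : θt.1 = θ.1 + t • (θ'.1 - θ.1) := rfl
  have f2 : θt.2 = θ.2 + t • (θ'.2 - θ.2) := rfl
  rw [f1, f2]
  nlinarith

end Model

end PGGM

/-! ### First order at θ*: score, prior and penalties. -/

namespace PGGM

/-! ### Elementwise norms -/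

section Norms

variable {k l : ℕ}

lemma abs_le_maxNorm (A : Matrix (Fin k) (Fin l) ℝ) (i : Fin k) (j : Fin l) :
    |A i j| ≤ maxNorm A :=
  le_ciSup (f := fun ij : Fin k × Fin l => |A ij.1 ij.2|) (Set.finite_range _).bddAbove (i, j)

lemma maxNorm_nonneg (A : Matrix (Fin k) (Fin l) ℝ) : 0 ≤ maxNorm A :=
  Real.iSup_nonneg fun _ => abs_nonneg _

lemma maxNorm_le {A : Matrix (Fin k) (Fin l) ℝ} {c : ℝ} (hc : 0 ≤ c) (h : ∀ i j, |A i j| ≤ c) :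
    maxNorm A ≤ c :=
  Real.iSup_le (fun ij => h ij.1 ij.2) hc

lemma abs_le_diagMax {ι : Type*} [Finite ι] (A : Matrix ι ι ℝ) (i : ι) : |A i i| ≤ diagMax A :=
  le_ciSup (f := fun i => |A i i|) (Set.finite_range _).bddAbove i

lemma diagMax_nonneg {ι : Type*} (A : Matrix ι ι ℝ) : 0 ≤ diagMax A :=
  Real.iSup_nonneg fun _ => abs_nonneg _

lemma abs_frobInner_le (A B : Matrix (Fin k) (Fin l) ℝ) :
    |frobInner A B| ≤ maxNorm A * l1Norm B := by
  rw [frobInner_eq_sum, l1Norm, Finset.mul_sum]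
  refine (Finset.abs_sum_le_sum_abs _ _).trans (Finset.sum_le_sum fun i _ => ?_)
  rw [Finset.mul_sum]
  refine (Finset.abs_sum_le_sum_abs _ _).trans (Finset.sum_le_sum fun j _ => ?_)
  rw [abs_mul]
  exact mul_le_mul_of_nonneg_right (abs_le_maxNorm A i j) (abs_nonneg _)

lemma frobInner_self_nonneg (A : Matrix (Fin k) (Fin l) ℝ) : 0 ≤ frobInner A A := by
  rw [frobInner_eq_sum]
  exact Finset.sum_nonneg fun i _ => Finset.sum_nonneg fun j _ => mul_self_nonneg _

end Norms

/-! ### Parameters as families of entries -/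

section Entries

variable {p q : ℕ}

/-- The entries of a parameter. -/
def entry (θ : Param p q) : (Fin q × Fin q) ⊕ (Fin q × Fin p) → ℝ :=
  Sum.elim (fun ij => θ.1 ij.1 ij.2) fun ij => θ.2 ij.1 ij.2

lemma sum_entry (θ : Param p q) (f : ℝ → ℝ) :
    ∑ x, f (entry θ x) = (∑ i, ∑ j, f (θ.1 i j)) + ∑ i, ∑ j, f (θ.2 i j) := by
  simp [entry, Fintype.sum_sum_type, Fintype.sum_prod_type]

/-- The squared Frobenius norm of a parameter. -/
noncomputable def normSq (Δ : Param p q) : ℝ := frobInner Δ.1 Δ.1 + frobInner Δ.2 Δ.2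

lemma normSq_eq_sum (Δ : Param p q) : normSq Δ = ∑ x, entry Δ x ^ 2 := by
  rw [sum_entry Δ (· ^ 2), normSq, frobInner_eq_sum, frobInner_eq_sum]
  simp [sq]

lemma normSq_nonneg (Δ : Param p q) : 0 ≤ normSq Δ :=
  add_nonneg (frobInner_self_nonneg _) (frobInner_self_nonneg _)

lemma frobDist_eq (θ θ' : Param p q) : frobDist θ θ' = √(normSq (θ - θ')) := by
  rw [frobDist, normSq, frobInner_eq_sum, frobInner_eq_sum]
  simp [sq]

lemma normSq_smul (c : ℝ) (Δ : Param p q) : normSq (c • Δ) = c ^ 2 * normSq Δ := by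
  simp only [normSq, Prod.smul_fst, Prod.smul_snd, frobInner_smul_left, frobInner_smul_right]
  ring

open Classical in
/-- The support of `θ*`. -/
noncomputable def Model.supp (M : Model p q) : Finset ((Fin q × Fin q) ⊕ (Fin q × Fin p)) :=
  Finset.univ.filter fun x => entry M.theta x ≠ 0

lemma Model.mem_supp (M : Model p q) (x : (Fin q × Fin q) ⊕ (Fin q × Fin p)) :
    x ∈ M.supp ↔ entry M.theta x ≠ 0 := by
  simp [Model.supp]

lemma Model.cardS_eq (M : Model p q) : M.cardS = M.supp.card := by
  classical
  have h1 : {ij : Fin q × Fin q | M.Oyy ij.1 ij.2 ≠ 0}.ncard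
      = (Finset.univ.filter fun ij : Fin q × Fin q => M.Oyy ij.1 ij.2 ≠ 0).card := by
    rw [← Set.ncard_coe_finset]; simp
  have h2 : {ij : Fin q × Fin p | M.Oyx ij.1 ij.2 ≠ 0}.ncard
      = (Finset.univ.filter fun ij : Fin q × Fin p => M.Oyx ij.1 ij.2 ≠ 0).card := by
    rw [← Set.ncard_coe_finset]; simp
  rw [Model.cardS, h1, h2, ← Finset.card_disjSum]
  congr 1
  ext x
  rw [Model.mem_supp]
  rcases x with x | x <;> simp [entry, Model.theta]

open Classical in
/-- The `ℓ¹` norm on the support of `θ*`. -/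
noncomputable def Model.l1On (M : Model p q) (Δ : Param p q) : ℝ := ∑ x ∈ M.supp, |entry Δ x|

open Classical in
/-- The `ℓ¹` norm off the support of `θ*`. -/
noncomputable def Model.l1Compl (M : Model p q) (Δ : Param p q) : ℝ :=
  ∑ x ∈ M.suppᶜ, |entry Δ x|

lemma Model.l1On_nonneg (M : Model p q) (Δ : Param p q) : 0 ≤ M.l1On Δ :=
  Finset.sum_nonneg fun _ _ => abs_nonneg _

lemma Model.l1Compl_nonneg (M : Model p q) (Δ : Param p q) : 0 ≤ M.l1Compl Δ :=
  Finset.sum_nonneg fun _ _ => abs_nonneg _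

lemma Model.l1On_add_l1Compl (M : Model p q) (Δ : Param p q) :
    M.l1On Δ + M.l1Compl Δ = l1Norm Δ.1 + l1Norm Δ.2 := by
  classical
  rw [Model.l1On, Model.l1Compl, Finset.sum_add_sum_compl, sum_entry Δ (fun x => |x|), l1Norm,
    l1Norm]

lemma Model.l1On_sq_le (M : Model p q) (Δ : Param p q) :
    M.l1On Δ ^ 2 ≤ M.cardS * normSq Δ := by
  rw [Model.l1On, M.cardS_eq, normSq_eq_sum]
  refine sq_sum_le_card_mul_sum_sq.trans ?_
  simp only [sq_abs]
  exact mul_le_mul_of_nonneg_left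
    (Finset.sum_le_sum_of_subset_of_nonneg (Finset.subset_univ _) fun _ _ _ => sq_nonneg _)
    (Nat.cast_nonneg _)

end Entries

namespace Model

variable {p q : ℕ} {M : Model p q}

/-! ### Blocks of the precision matrix -/

lemma pos_of_H1 (h : M.H1) : 0 < q ∧ 0 < p := by
  have : ∃ i j, M.Oyx i j ≠ 0 := by
    by_contra! hc
    exact h.Oyx_ne_zero (by ext i j; exact hc i j)
  obtain ⟨i, j, -⟩ := this
  exact ⟨i.pos, j.pos⟩

/-- The invertible matrix Ω*_yx L Ω*_yxᵗ has rank q, and its rank is at most that of Ω*_yx. This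
lets p replace q in the upper bound of `sL`. -/
lemma q_le_p (h : M.H1) : q ≤ p := by
  have h1 := rank_of_isUnit _ h.OLO_posDef.isUnit
  rw [Fintype.card_fin] at h1
  rw [← h1]
  exact (rank_mul_le_left _ _).trans ((rank_mul_le_left _ _).trans (by
    simpa using rank_le_width M.Oyx))

lemma precision_blocks (hSig : M.Sig.PosDef) :
    M.Oyy * M.Syy + M.Oyx * M.Syxᵀ = 1 ∧ M.Oyy * M.Syx + M.Oyx * M.Sxx = 0 := by
  have hd : IsUnit M.Sig.det := (isUnit_iff_isUnit_det _).1 hSig.isUnit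
  have h21 : M.Sig.toBlocks₂₁ = M.Syxᵀ := by
    ext i j
    have := congrFun (congrFun (transpose_eq_of_isHermitian hSig.1) (Sum.inr i)) (Sum.inl j)
    simpa [Syx, toBlocks₂₁, toBlocks₁₂] using this.symm
  have key : ∀ X : Matrix (Fin q ⊕ Fin p) (Fin q ⊕ Fin p) ℝ, X * M.Sig = 1 →
      X.toBlocks₁₁ * M.Syy + X.toBlocks₁₂ * M.Syxᵀ = 1 ∧
        X.toBlocks₁₁ * M.Syx + X.toBlocks₁₂ * M.Sxx = 0 := by
    intro X h
    rw [← fromBlocks_toBlocks X, ← fromBlocks_toBlocks M.Sig, fromBlocks_multiply,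
      ← fromBlocks_one, fromBlocks_inj, h21] at h
    exact ⟨h.1, h.2.1⟩
  exact key _ (nonsing_inv_mul _ hd)

lemma Sxx_isHermitian (hSig : M.Sig.PosDef) : M.Sxx.IsHermitian := by
  ext i j
  exact congrFun (congrFun hSig.1 (Sum.inr i)) (Sum.inr j)

/-- The regression of Y on X has coefficient -Ω*_yy⁻¹Ω*_yx. Together with `Syy_eq`, where Ω*_yy⁻¹ is
the residual covariance, this identifies A_n and B_n with the likelihood gradient at θ*. -/
lemma Syx_eq (hSig : M.Sig.PosDef) (h : M.H1) : M.Syx = -(M.Oyy⁻¹ * M.Oyx * M.Sxx) := by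
  have hd : IsUnit M.Oyy.det := (isUnit_iff_isUnit_det _).1 h.Oyy_posDef.isUnit
  have h1 := (precision_blocks hSig).2
  have h2 : M.Oyy⁻¹ * (M.Oyy * M.Syx) = M.Oyy⁻¹ * -(M.Oyx * M.Sxx) := by
    rw [eq_neg_of_add_eq_zero_left h1]
  rwa [← Matrix.mul_assoc, nonsing_inv_mul _ hd, Matrix.one_mul, Matrix.mul_neg,
    ← Matrix.mul_assoc] at h2

lemma Syy_eq (hSig : M.Sig.PosDef) (h : M.H1) :
    M.Syy = M.Oyy⁻¹ + M.Oyy⁻¹ * M.Oyx * M.Sxx * M.Oyxᵀ * M.Oyy⁻¹ := by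
  have hd : IsUnit M.Oyy.det := (isUnit_iff_isUnit_det _).1 h.Oyy_posDef.isUnit
  have h1 := (precision_blocks hSig).1
  have h2 : M.Oyy⁻¹ * (M.Oyy * M.Syy) = M.Oyy⁻¹ * (1 - M.Oyx * M.Syxᵀ) := by
    rw [eq_sub_of_add_eq h1]
  rw [← Matrix.mul_assoc, nonsing_inv_mul _ hd, Matrix.one_mul, Matrix.mul_sub, Matrix.mul_one,
    Syx_eq hSig h, transpose_neg, transpose_mul, transpose_mul,
    inv_transpose_of_posDef h.Oyy_posDef,
    transpose_eq_of_isHermitian (Sxx_isHermitian hSig)] at h2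
  rw [h2, Matrix.mul_neg, Matrix.mul_neg, sub_neg_eq_add]
  simp only [Matrix.mul_assoc]

lemma matA_eq (hSig : M.Sig.PosDef) (h : M.H1) (S : Matrix (Fin q ⊕ Fin p) (Fin q ⊕ Fin p) ℝ) :
    M.matA S = S.toBlocks₁₁ - M.Oyy⁻¹ - M.Oyy⁻¹ * M.Oyx * S.toBlocks₂₂ * M.Oyxᵀ * M.Oyy⁻¹ := by
  rw [matA, Syy_eq hSig h]
  simp only [Matrix.mul_sub, Matrix.sub_mul]
  abel

lemma matB_eq (hSig : M.Sig.PosDef) (h : M.H1) (S : Matrix (Fin q ⊕ Fin p) (Fin q ⊕ Fin p) ℝ) :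
    M.matB S = (2 : ℝ) • (S.toBlocks₁₂ + M.Oyy⁻¹ * M.Oyx * S.toBlocks₂₂) := by
  rw [matB, Syx_eq hSig h]
  simp only [Matrix.mul_sub]
  congr 1
  abel

/-- `κ`. -/
noncomputable def kap (M : Model p q) (R : Reg) : ℝ := R.eta * M.β * M.sL ^ (M.β - 1)

lemma smoothLin_theta (hSig : M.Sig.PosDef) (h : M.H1) (R : Reg)
    (S : Matrix (Fin q ⊕ Fin p) (Fin q ⊕ Fin p) ℝ) (Δ : Param p q) :
    M.smoothLin R S M.theta Δ = frobInner (M.matA S) Δ.1 + frobInner (M.matB S) Δ.2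
      + M.kap R * phiLin M.L M.theta Δ := by
  have h1 : (M.Oyy⁻¹ * Δ.1).trace = frobInner M.Oyy⁻¹ Δ.1 := by
    rw [frobInner, inv_transpose_of_posDef h.Oyy_posDef]
  have h2 : phi M.L M.theta = M.sL := rfl
  rw [smoothLin, matA_eq hSig h, matB_eq hSig h, h2, kap, phiLin]
  simp only [theta, frobInner_sub_left, frobInner_smul_left, frobInner_add_left, h1]
  ring

lemma abs_phiLin_theta_le (Δ : Param p q) :
    |phiLin M.L M.theta Δ| ≤ M.ella * l1Norm Δ.1 + M.ellb * l1Norm Δ.2 := by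
  have h1 := abs_frobInner_le (M.Oyy⁻¹ * M.Oyx * M.L * M.Oyxᵀ * M.Oyy⁻¹) Δ.1
  have h2 := abs_frobInner_le (M.Oyy⁻¹ * M.Oyx * M.L) Δ.2
  rw [phiLin, ella, ellb]
  simp only [theta]
  rw [abs_le] at h1 h2 ⊢
  constructor <;> nlinarith [h1.1, h1.2, h2.1, h2.2]

/-- Duality of the ℓ¹ and sup norms, applied separately to the two blocks of the likelihood gradient
and to that of the prior. -/
lemma smoothLin_theta_ge (hSig : M.Sig.PosDef) (h : M.H1) {R : Reg} (hk : 0 ≤ M.kap R)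
    (S : Matrix (Fin q ⊕ Fin p) (Fin q ⊕ Fin p) ℝ) (Δ : Param p q) :
    -((M.ha S + M.kap R * M.ella) * l1Norm Δ.1 + (M.hb S + M.kap R * M.ellb) * l1Norm Δ.2)
      ≤ M.smoothLin R S M.theta Δ := by
  rw [smoothLin_theta hSig h]
  have h1 := (abs_le.1 (abs_frobInner_le (M.matA S) Δ.1)).1
  have h2 := (abs_le.1 (abs_frobInner_le (M.matB S) Δ.2)).1
  have h3 := mul_le_mul_of_nonneg_left (abs_le.1 (M.abs_phiLin_theta_le Δ)).1 hk
  rw [ha, hb]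
  linarith

/-- Effect of the penalties and of the gradient at `θ*`, entry by entry. -/
lemma penalty_entry_ge {c lam k h a u num den : ℝ} (hc : 1 < c) (hlam : c * h ≤ lam)
    (h0 : 0 ≤ h) (hnum : (c + 1) * lam / c + k ≤ num) (hden : den ≤ (c - 1) * lam / c - k) :
    (if a ≠ 0 then -(num * |u|) else den * |u|)
      ≤ lam * (|a + u| - |a|) - (h + k) * |u| := by
  have hc0 : 0 < c := by linarith
  have hl : h ≤ lam / c := by rw [le_div_iff₀ hc0]; linarith
  have e1 : (c + 1) * lam / c = lam + lam / c := by field_simp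
  have e2 : (c - 1) * lam / c = lam - lam / c := by field_simp
  rw [e1] at hnum
  rw [e2] at hden
  have hlam0 : 0 ≤ lam := le_trans (by positivity) hlam
  have hu := abs_nonneg u
  split_ifs with ha
  · have h1 : -|u| ≤ |a + u| - |a| := by
      have := abs_sub_abs_le_abs_sub a (a + u)
      rw [sub_add_cancel_left, abs_neg] at this
      linarith
    have h2 := mul_le_mul_of_nonneg_left h1 hlam0
    have h3 : (lam + h + k) * |u| ≤ num * |u| := mul_le_mul_of_nonneg_right (by linarith) hu
    linarith
  · rw [not_not] at ha
    subst ha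
    have h3 : den * |u| ≤ (lam - h - k) * |u| := mul_le_mul_of_nonneg_right (by linarith) hu
    rw [zero_add, abs_zero]
    linarith

lemma l1On_l1Compl_eq (Δ : Param p q) (num den : ℝ) :
    den * M.l1Compl Δ - num * M.l1On Δ
      = (∑ i, ∑ j, if M.Oyy i j ≠ 0 then -(num * |Δ.1 i j|) else den * |Δ.1 i j|)
        + ∑ i, ∑ j, if M.Oyx i j ≠ 0 then -(num * |Δ.2 i j|) else den * |Δ.2 i j| := by
  have h1 : den * M.l1Compl Δ - num * M.l1On Δ
      = ∑ x, if entry M.theta x ≠ 0 then -(num * |entry Δ x|) else den * |entry Δ x| := by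
    classical
    rw [l1Compl, l1On, Finset.mul_sum, Finset.mul_sum, sub_eq_neg_add, ← Finset.sum_neg_distrib,
      ← Finset.sum_add_sum_compl M.supp]
    congr 1
    · refine Finset.sum_congr rfl fun x hx => ?_
      rw [if_pos ((M.mem_supp x).1 hx)]
    · refine Finset.sum_congr rfl fun x hx => ?_
      rw [if_neg (fun h => Finset.mem_compl.1 hx ((M.mem_supp x).2 h))]
  rw [h1]
  simp only [Fintype.sum_sum_type, Fintype.sum_prod_type]
  rfl

/-- Off the support the penalty grows by the full size of the entry and outweighs the gradient; on
the support it drops by at most that size. The numerator and denominator of α are the resulting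
worst rates over the two blocks. -/
lemma penalty_ge {T : Tuning} (hT : T.Valid) {R : Reg} (h : M.H1)
    {S : Matrix (Fin q ⊕ Fin p) (Fin q ⊕ Fin p) ℝ} (hB : M.InBand T R S) (Δ : Param p q) :
    M.alphaDen T R * M.l1Compl Δ - M.alphaNum T R * M.l1On Δ
      ≤ R.lam * (l1NormOff (M.Oyy + Δ.1) - l1NormOff M.Oyy)
        + R.mu * (l1Norm (M.Oyx + Δ.2) - l1Norm M.Oyx)
        - ((M.ha S + M.kap R * M.ella) * l1Norm Δ.1
          + (M.hb S + M.kap R * M.ellb) * l1Norm Δ.2) := by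
  rw [l1On_l1Compl_eq]
  have hha : 0 ≤ M.ha S := maxNorm_nonneg _
  have hhb : 0 ≤ M.hb S := maxNorm_nonneg _
  have h1 : ∀ i j, (if M.Oyy i j ≠ 0 then -(M.alphaNum T R * |Δ.1 i j|)
        else M.alphaDen T R * |Δ.1 i j|) ≤
      R.lam * ((if i = j then 0 else |(M.Oyy + Δ.1) i j|) - (if i = j then 0 else |M.Oyy i j|))
        - (M.ha S + M.kap R * M.ella) * |Δ.1 i j| := by
    intro i j
    have key := penalty_entry_ge (a := M.Oyy i j) (u := Δ.1 i j) hT.one_lt_cl hB.lam_mem.1 hha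
      (le_max_left _ _ : _ ≤ M.alphaNum T R) (min_le_left _ _ : M.alphaDen T R ≤ _)
    -- Diagonal entries of Ω_yy are not penalized. They are positive at θ*, hence in the support,
    -- where only the gradient has to be paid for.
    by_cases hij : i = j
    · subst hij
      have h0 : M.Oyy i i ≠ 0 := h.Oyy_posDef.diag_pos.ne'
      rw [if_pos h0] at key ⊢
      have hc0 : 0 < T.cl := by linarith [hT.one_lt_cl]
      have hnum : (T.cl + 1) * R.lam / T.cl + M.kap R * M.ella ≤ M.alphaNum T R := le_max_left _ _
      have e1 : (T.cl + 1) * R.lam / T.cl = R.lam + R.lam / T.cl := by field_simp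
      have hl : M.ha S ≤ R.lam / T.cl := by rw [le_div_iff₀ hc0]; linarith [hB.lam_mem.1]
      have hl0 : 0 ≤ R.lam := le_trans (by positivity) hB.lam_mem.1
      rw [e1] at hnum
      have := mul_le_mul_of_nonneg_right
        (by linarith : M.ha S + M.kap R * M.ella ≤ M.alphaNum T R) (abs_nonneg (Δ.1 i i))
      simp only [if_true]
      linarith
    · simp only [if_neg hij, Matrix.add_apply]
      exact key
  have h2 : ∀ i j, (if M.Oyx i j ≠ 0 then -(M.alphaNum T R * |Δ.2 i j|)
        else M.alphaDen T R * |Δ.2 i j|) ≤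
      R.mu * (|(M.Oyx + Δ.2) i j| - |M.Oyx i j|) - (M.hb S + M.kap R * M.ellb) * |Δ.2 i j| := by
    intro i j
    exact penalty_entry_ge (a := M.Oyx i j) (u := Δ.2 i j) hT.one_lt_cm hB.mu_mem.1 hhb
      (le_max_right _ _ : _ ≤ M.alphaNum T R) (min_le_right _ _ : M.alphaDen T R ≤ _)
  have s1 := Finset.sum_le_sum fun i (_ : i ∈ Finset.univ) =>
    Finset.sum_le_sum fun j (_ : j ∈ Finset.univ) => h1 i j
  have s2 := Finset.sum_le_sum fun i (_ : i ∈ Finset.univ) =>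
    Finset.sum_le_sum fun j (_ : j ∈ Finset.univ) => h2 i j
  simp only [Finset.sum_sub_distrib, ← Finset.mul_sum] at s1 s2
  simp only [l1NormOff, l1Norm]
  linarith

/-- Lower bound of the increment of the objective at `θ*`. -/
lemma objective_theta_add_ge (hSig : M.Sig.PosDef) (hL : M.L.PosDef) (hβ : 1 ≤ M.β) (h : M.H1)
    {T : Tuning} (hT : T.Valid) {R : Reg} {S : Matrix (Fin q ⊕ Fin p) (Fin q ⊕ Fin p) ℝ}
    (hS : S.toBlocks₂₂.PosSemidef) (hB : M.InBand T R S) {Δ : Param p q}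
    (hΔ : (M.Oyy + Δ.1).PosDef) :
    M.objective R S M.theta + (logDetRem M.Oyy Δ.1 + phiRem S.toBlocks₂₂ M.theta Δ
      + M.kap R * phiRem M.L M.theta Δ)
      + (M.alphaDen T R * M.l1Compl Δ - M.alphaNum T R * M.l1On Δ)
      ≤ M.objective R S (M.theta + Δ) := by
  have hsL : 0 ≤ M.sL := phi_nonneg (θ := M.theta) hL.posSemidef h.Oyy_posDef
  have hη := hB.eta_mem.1
  have hk : 0 ≤ M.kap R := by rw [kap]; positivity
  have h1 := smooth_add_ge (M := M) (R := R) (θ := M.theta) (Δ := Δ)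
    (transpose_eq_of_isHermitian hS.1) hL hβ hη h.Oyy_posDef hΔ
  have h2 := smoothLin_theta_ge hSig h hk S Δ
  have h3 := penalty_ge hT h hB Δ
  have e : R.eta * (M.β * phi M.L M.theta ^ (M.β - 1)) = M.kap R := by
    rw [kap, ← mul_assoc]; rfl
  rw [e] at h1
  rw [objective_eq, objective_eq]
  simp only [Prod.fst_add, Prod.snd_add]
  have t1 : M.theta.1 = M.Oyy := rfl
  have t2 : M.theta.2 = M.Oyx := rfl
  rw [t1, t2]
  rw [t1] at h1
  linarith

end Model

end PGGM

/-! ### Curvature at θ*. -/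

namespace PGGM

/-! ### Perturbation of a positive definite matrix -/

section Perturb

variable {k l : ℕ}

lemma frobInner_sq_le (A B : Matrix (Fin k) (Fin l) ℝ) :
    frobInner A B ^ 2 ≤ frobInner A A * frobInner B B := by
  have h := Finset.sum_mul_sq_le_sq_mul_sq (Finset.univ : Finset (Fin k × Fin l))
    (fun x => A x.1 x.2) (fun x => B x.1 x.2)
  simp only [Fintype.sum_prod_type] at h
  simpa only [frobInner_eq_sum, ← sq] using h

lemma quad_eq_frobInner (U : Matrix (Fin k) (Fin k) ℝ) (x : Fin k → ℝ) :
    x ⬝ᵥ U *ᵥ x = frobInner U (vecMulVec x x) := by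
  simp only [frobInner_eq_sum, dotProduct, mulVec, vecMulVec_apply, Finset.mul_sum]
  exact Finset.sum_congr rfl fun i _ => Finset.sum_congr rfl fun j _ => by ring

/-- Cauchy-Schwarz between U and the rank one matrix xxᵗ, whose Frobenius norm is |x|². -/
lemma abs_quad_le {U : Matrix (Fin k) (Fin k) ℝ} {r : ℝ} (hr : 0 ≤ r)
    (hU : frobInner U U ≤ r ^ 2) (x : Fin k → ℝ) : |x ⬝ᵥ U *ᵥ x| ≤ r * (x ⬝ᵥ x) := by
  have hx : 0 ≤ x ⬝ᵥ x := by simpa using dotProduct_star_self_nonneg x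
  refine abs_le_of_sq_le_sq ?_ (by positivity)
  have h1 : frobInner (vecMulVec x x) (vecMulVec x x) = (x ⬝ᵥ x) ^ 2 := by
    simp only [frobInner_eq_sum, dotProduct, vecMulVec_apply, sq, Finset.sum_mul_sum]
    exact Finset.sum_congr rfl fun i _ => Finset.sum_congr rfl fun j _ => by ring
  rw [quad_eq_frobInner, mul_pow, ← h1]
  exact (frobInner_sq_le _ _).trans
    (mul_le_mul_of_nonneg_right hU (frobInner_self_nonneg _))

lemma smul_one_sub_posSemidef_of_frob {U : Matrix (Fin k) (Fin k) ℝ} (hUt : Uᵀ = U) {r : ℝ}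
    (hr : 0 ≤ r) (hU : frobInner U U ≤ r ^ 2) :
    (r • (1 : Matrix (Fin k) (Fin k) ℝ) - U).PosSemidef := by
  refine posSemidef_of_quad (by simp [hUt]) fun x => ?_
  rw [quad_smul_one_sub]
  linarith [(abs_le.1 (abs_quad_le hr hU x)).2]

lemma add_smul_one_posSemidef_of_frob {U : Matrix (Fin k) (Fin k) ℝ} (hUt : Uᵀ = U) {r : ℝ}
    (hr : 0 ≤ r) (hU : frobInner U U ≤ r ^ 2) :
    (U + r • (1 : Matrix (Fin k) (Fin k) ℝ)).PosSemidef := by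
  have h : frobInner (-U) (-U) = frobInner U U := by simp [frobInner]
  have := smul_one_sub_posSemidef_of_frob (U := -U) (by simp [hUt]) hr (h ▸ hU)
  rwa [sub_neg_eq_add, add_comm] at this

lemma posSemidef_smul_one {c : ℝ} (hc : 0 ≤ c) :
    (c • (1 : Matrix (Fin k) (Fin k) ℝ)).PosSemidef := PosSemidef.one.smul hc

/-- The radius λ_min(A)/2, which is `r1` for A = Ω*_yy, is what puts the relative eigenvalues above
-1/2, as `logDetRem_ge` demands. -/
lemma add_half_posSemidef {A U : Matrix (Fin k) (Fin k) ℝ} (hA : A.PosDef) (hk : 0 < k)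
    (hUt : Uᵀ = U) (hU : frobInner U U ≤ (lamMin A / 2) ^ 2) :
    (U + (1 / 2 : ℝ) • A).PosSemidef := by
  have h0 := lamMin_pos hA hk
  have h1 := add_smul_one_posSemidef_of_frob hUt (by linarith) hU
  have h2 := (sub_lamMin_posSemidef hA.1).smul (by norm_num : (0 : ℝ) ≤ 1 / 2)
  have : U + (1 / 2 : ℝ) • A = (U + (lamMin A / 2) • (1 : Matrix (Fin k) (Fin k) ℝ))
      + (1 / 2 : ℝ) • (A - lamMin A • (1 : Matrix (Fin k) (Fin k) ℝ)) := by
    module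
  rw [this]
  exact h1.add h2

lemma add_posDef_of_frob {A U : Matrix (Fin k) (Fin k) ℝ} (hA : A.PosDef) (hk : 0 < k)
    (hUt : Uᵀ = U) (hU : frobInner U U ≤ (lamMin A / 2) ^ 2) : (A + U).PosDef := by
  have : A + U = (U + (1 / 2 : ℝ) • A) + (1 / 2 : ℝ) • A := by module
  rw [this]
  exact PosDef.posSemidef_add (add_half_posSemidef hA hk hUt hU)
    (hA.smul (by norm_num : (0 : ℝ) < 1 / 2))

lemma smul_one_sub_add_posSemidef {A U : Matrix (Fin k) (Fin k) ℝ} (hA : A.PosDef) (hk : 0 < k)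
    (hUt : Uᵀ = U) (hU : frobInner U U ≤ (lamMin A / 2) ^ 2) :
    ((3 / 2 * lamMax A) • (1 : Matrix (Fin k) (Fin k) ℝ) - (A + U)).PosSemidef := by
  have h0 := lamMin_pos hA hk
  have h1 := smul_one_sub_posSemidef_of_frob hUt (by linarith) hU
  have h2 := lamMax_sub_posSemidef hA.1
  have h3 := posSemidef_smul_one (k := k) (c := lamMax A / 2 - lamMin A / 2)
    (by linarith [lamMin_le_lamMax hA.1 hk])
  have : (3 / 2 * lamMax A) • (1 : Matrix (Fin k) (Fin k) ℝ) - (A + U)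
      = ((lamMin A / 2) • (1 : Matrix (Fin k) (Fin k) ℝ) - U)
        + (lamMax A • (1 : Matrix (Fin k) (Fin k) ℝ) - A)
        + (lamMax A / 2 - lamMin A / 2) • (1 : Matrix (Fin k) (Fin k) ℝ) := by module
  rw [this]
  exact (h1.add h2).add h3

lemma frobInner_one_transpose_mul_self (V : Matrix (Fin k) (Fin l) ℝ) :
    frobInner 1 (Vᵀ * V) = frobInner V V := by
  rw [frobInner_transpose_mul, Matrix.mul_one]

/-- `⟪L, Vᵗ V⟫ ≥ λ_min(L) ‖V‖²`. -/
lemma lamMin_mul_le_frobInner {L : Matrix (Fin l) (Fin l) ℝ} (hL : L.PosDef)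
    (V : Matrix (Fin k) (Fin l) ℝ) : lamMin L * frobInner V V ≤ frobInner L (Vᵀ * V) := by
  have h := frobInner_conj_nonneg (sub_lamMin_posSemidef hL.1)
    (PosSemidef.one : (1 : Matrix (Fin k) (Fin k) ℝ).PosSemidef) V
  rw [Matrix.mul_one, frobInner_sub_left, frobInner_smul_left,
    frobInner_one_transpose_mul_self] at h
  linarith

/-- `⟪S, Vᵗ H⁻¹ V⟫ ≥ c⁻¹ ⟪S, Vᵗ V⟫` if `H ≤ c`. -/
lemma frobInner_inv_conj_ge {S : Matrix (Fin l) (Fin l) ℝ} (hS : S.PosSemidef)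
    {H : Matrix (Fin k) (Fin k) ℝ} (hH : H.PosDef) {c : ℝ} (hc : 0 < c)
    (h : (c • (1 : Matrix (Fin k) (Fin k) ℝ) - H).PosSemidef) (V : Matrix (Fin k) (Fin l) ℝ) :
    c⁻¹ * frobInner S (Vᵀ * V) ≤ frobInner S (Vᵀ * H⁻¹ * V) := by
  have h1 := frobInner_conj_nonneg hS (inv_sub_smul_one_posSemidef hH hc h) V
  rw [Matrix.mul_sub, Matrix.sub_mul, frobInner_sub_right, Matrix.mul_smul, Matrix.mul_one,
    Matrix.smul_mul, frobInner_smul_right] at h1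
  linarith

/-- The relative second order form of `-log det` dominates the Frobenius norm. -/
lemma trace_rel_ge {A U : Matrix (Fin k) (Fin k) ℝ} (hA : A.PosDef) (hk : 0 < k)
    (hUt : Uᵀ = U) (hU : frobInner U U ≤ (lamMin A / 2) ^ 2) :
    2 / 3 / lamMax A ^ 2 * frobInner U U ≤ (A⁻¹ * (U * (A + U)⁻¹ * U)).trace := by
  have hAU := add_posDef_of_frob hA hk hUt hU
  have hm := lamMax_pos hA hk
  -- The two inverses are removed in turn, using A + U ≤ (3/2) λ_max(A) and then A ≤ λ_max(A).
  have h1 := frobInner_inv_conj_ge (S := A⁻¹) hA.inv.posSemidef hAU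
    (by positivity : 0 < 3 / 2 * lamMax A) (smul_one_sub_add_posSemidef hA hk hUt hU) U
  have h2 := frobInner_inv_conj_ge (S := 1) (PosSemidef.one) hA hm (lamMax_sub_posSemidef hA.1) U
  have e1 : frobInner A⁻¹ (Uᵀ * (A + U)⁻¹ * U) = (A⁻¹ * (U * (A + U)⁻¹ * U)).trace := by
    rw [frobInner, inv_transpose_of_posDef hA, hUt]
  have e2 : frobInner 1 (Uᵀ * A⁻¹ * U) = frobInner A⁻¹ (Uᵀ * U) := by
    rw [Matrix.mul_assoc, frobInner_transpose_mul, Matrix.mul_one, frobInner_mul_right, frobInner,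
      frobInner, trace_mul_comm, hUt, trace_mul_comm, transpose_mul, hUt,
      inv_transpose_of_posDef hA, trace_mul_comm]
  rw [e2, frobInner_one_transpose_mul_self] at h2
  rw [e1] at h1
  refine le_trans (le_of_eq ?_) ((mul_le_mul_of_nonneg_left h2 (by positivity)).trans h1)
  field_simp

/-- Control of the cross term by the log-determinant. -/
lemma frobInner_cross_le {A U : Matrix (Fin k) (Fin k) ℝ} (hA : A.PosDef) (hUt : Uᵀ = U)
    (hAU : (A + U).PosDef) {S : Matrix (Fin l) (Fin l) ℝ} (B : Matrix (Fin k) (Fin l) ℝ) {c : ℝ}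
    (hS : Sᵀ = S) (h : (c • A - B * S * Bᵀ).PosSemidef) :
    frobInner S ((U * A⁻¹ * B)ᵀ * (A + U)⁻¹ * (U * A⁻¹ * B))
      ≤ c * (A⁻¹ * (U * (A + U)⁻¹ * U)).trace := by
  have hAd : IsUnit A.det := (isUnit_iff_isUnit_det A).1 hA.isUnit
  have hQ : (U * (A + U)⁻¹ * U).PosSemidef := by
    have := posSemidef_conj' hAU.inv.posSemidef U
    rwa [hUt] at this
  -- Conjugation by A⁻¹ turns the hypothesis into a comparison of the weights that the two sides put
  -- on the same form U(A + U)⁻¹U.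
  have hP : (c • A⁻¹ - A⁻¹ * B * S * Bᵀ * A⁻¹).PosSemidef := by
    have := posSemidef_conj' h A⁻¹
    rw [inv_transpose_of_posDef hA] at this
    convert this using 1
    rw [Matrix.mul_sub, Matrix.sub_mul, Matrix.mul_smul, nonsing_inv_mul _ hAd, Matrix.smul_mul,
      Matrix.one_mul]
    simp only [Matrix.mul_assoc]
  have h1 := trace_mul_le hP hQ
  rw [Matrix.smul_mul, trace_smul, smul_eq_mul] at h1
  refine le_trans (le_of_eq ?_) h1
  rw [frobInner, hS, transpose_mul, transpose_mul, inv_transpose_of_posDef hA, hUt]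
  calc (S * (Bᵀ * (A⁻¹ * U) * (A + U)⁻¹ * (U * A⁻¹ * B))).trace
      = ((S * Bᵀ * A⁻¹ * (U * (A + U)⁻¹ * U)) * (A⁻¹ * B)).trace := by
        simp only [Matrix.mul_assoc]
    _ = _ := by rw [trace_mul_comm]; simp only [Matrix.mul_assoc]

end Perturb

namespace Model

variable {p q : ℕ} {M : Model p q}

/-! ### Constants -/

lemma smul_Oyy_sub_posSemidef (h : M.H1) {N : Matrix (Fin q) (Fin q) ℝ} {c : ℝ} (hc : 0 ≤ c)
    (hN : (c • (1 : Matrix (Fin q) (Fin q) ℝ) - N).PosSemidef) :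
    ((c / lamMin M.Oyy) • M.Oyy - N).PosSemidef := by
  have hm := lamMin_pos h.Oyy_posDef (pos_of_H1 h).1
  have h1 := (sub_lamMin_posSemidef h.Oyy_posDef.1).smul (div_nonneg hc hm.le)
  have : (c / lamMin M.Oyy) • M.Oyy - N = (c • (1 : Matrix (Fin q) (Fin q) ℝ) - N)
      + (c / lamMin M.Oyy) • (M.Oyy - lamMin M.Oyy • (1 : Matrix (Fin q) (Fin q) ℝ)) := by
    rw [smul_sub, smul_smul, div_mul_cancel₀ _ hm.ne']
    abel
  rw [this]
  exact hN.add h1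

lemma sub_smul_Oyy_posSemidef (h : M.H1) {N : Matrix (Fin q) (Fin q) ℝ} {c : ℝ} (hc : 0 ≤ c)
    (hN : (N - c • (1 : Matrix (Fin q) (Fin q) ℝ)).PosSemidef) :
    (N - (c / lamMax M.Oyy) • M.Oyy).PosSemidef := by
  have hm := lamMax_pos h.Oyy_posDef (pos_of_H1 h).1
  have h1 := (lamMax_sub_posSemidef h.Oyy_posDef.1).smul (div_nonneg hc hm.le)
  have : N - (c / lamMax M.Oyy) • M.Oyy = (N - c • (1 : Matrix (Fin q) (Fin q) ℝ))
      + (c / lamMax M.Oyy) • (lamMax M.Oyy • (1 : Matrix (Fin q) (Fin q) ℝ) - M.Oyy) := by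
    rw [smul_sub, smul_smul, div_mul_cancel₀ _ hm.ne']
    abel
  rw [this]
  exact hN.add h1

lemma sL_eq_trace (hL : M.L.PosDef) :
    M.sL = (M.Oyx * M.L * M.Oyxᵀ * M.Oyy⁻¹).trace := by
  rw [sL, frobInner, transpose_eq_of_isHermitian hL.1, ← Matrix.mul_assoc, trace_mul_comm]
  simp only [Matrix.mul_assoc]

lemma trace_smul_Oyy_mul_inv (h : M.H1) (c : ℝ) : (c • M.Oyy * M.Oyy⁻¹).trace = c * q := by
  have hd : IsUnit M.Oyy.det := (isUnit_iff_isUnit_det _).1 h.Oyy_posDef.isUnit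
  rw [Matrix.smul_mul, mul_nonsing_inv _ hd, trace_smul, trace_one, Fintype.card_fin, smul_eq_mul]

/-- `sL` is the trace of Ω*_yx L Ω*_yxᵗ against Ω*_yy⁻¹, and the first matrix dominates a multiple
of Ω*_yy, which contributes q times the factor. The 4 in `omegaLLow` is slack. -/
lemma sL_ge (hL : M.L.PosDef) (h : M.H1) : q * M.omegaLLow ≤ M.sL := by
  have hq := (pos_of_H1 h).1
  have h0 := lamMin_pos h.OLO_posDef hq
  have hm := lamMax_pos h.Oyy_posDef hq
  have h1 := trace_mul_le (sub_smul_Oyy_posSemidef h h0.le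
    (sub_lamMin_posSemidef h.OLO_posDef.1)) h.Oyy_posDef.inv.posSemidef
  rw [trace_smul_Oyy_mul_inv h, ← sL_eq_trace hL] at h1
  refine le_trans ?_ h1
  rw [omegaLLow, mul_comm]
  refine mul_le_mul_of_nonneg_right ?_ (Nat.cast_nonneg _)
  exact div_le_div_of_nonneg_left h0.le hm (by linarith)

lemma omegaLLow_pos (h : M.H1) : 0 < M.omegaLLow := by
  have hq := (pos_of_H1 h).1
  have h0 := lamMin_pos h.OLO_posDef hq
  have hm := lamMax_pos h.Oyy_posDef hq
  rw [omegaLLow]; positivity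

lemma omegaLUp_pos (h : M.H1) : 0 < M.omegaLUp := by
  have hq := (pos_of_H1 h).1
  have h0 := lamMax_pos h.OLO_posDef hq
  have hm := lamMin_pos h.Oyy_posDef hq
  rw [omegaLUp]; positivity

lemma sL_pos (hL : M.L.PosDef) (h : M.H1) : 0 < M.sL := by
  have hq : (0 : ℝ) < q := by exact_mod_cast (pos_of_H1 h).1
  exact (mul_pos hq (omegaLLow_pos h)).trans_le (sL_ge hL h)

lemma sL_le (hL : M.L.PosDef) (h : M.H1) : M.sL ≤ p * M.omegaLUp := by
  have hq := (pos_of_H1 h).1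
  have h0 := lamMax_pos h.OLO_posDef hq
  have hm := lamMin_pos h.Oyy_posDef hq
  have h1 := trace_mul_le (smul_Oyy_sub_posSemidef h h0.le
    (lamMax_sub_posSemidef h.OLO_posDef.1)) h.Oyy_posDef.inv.posSemidef
  rw [trace_smul_Oyy_mul_inv h, ← sL_eq_trace hL] at h1
  refine h1.trans ?_
  have hqp : (q : ℝ) ≤ p := by exact_mod_cast q_le_p h
  rw [mul_comm]
  refine mul_le_mul hqp ?_ (by positivity) (Nat.cast_nonneg _)
  rw [omegaLUp]
  exact div_le_div_of_nonneg_right (by linarith) hm.le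

/-- Positive definiteness with L in the middle forces Ω*_yxᵗ to be injective, so L may be exchanged
for Σ*_xx. -/
lemma OSO_posDef (h : M.H1) : (M.Oyx * M.Sxx * M.Oyxᵀ).PosDef := by
  have hinj : Function.Injective M.Oyx.vecMul := by
    intro x y hxy
    by_contra hne
    have h1 := h.OLO_posDef.dotProduct_mulVec_pos (sub_ne_zero.2 hne)
    have h2 : M.Oyxᵀ *ᵥ (x - y) = 0 := by
      rw [mulVec_transpose, sub_vecMul, sub_eq_zero]; exact hxy
    rw [← mulVec_mulVec, h2, mulVec_zero, dotProduct_zero] at h1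
    exact lt_irrefl _ h1
  simpa [conjTranspose_eq_transpose_of_trivial] using h.Sxx_posDef.mul_mul_conjTranspose_same hinj

/-! ### Restricted strong convexity -/

/-- The upper bound of the sample covariance on the range of `Ω*_yxᵗ`. -/
def RangeBound (M : Model p q) (S : Matrix (Fin q ⊕ Fin p) (Fin q ⊕ Fin p) ℝ) : Prop :=
  ((5 / 4 * lamMax (M.Oyx * M.Sxx * M.Oyxᵀ)) • (1 : Matrix (Fin q) (Fin q) ℝ)
    - M.Oyx * S.toBlocks₂₂ * M.Oyxᵀ).PosSemidef

/-- The remainder of the smooth part at `θ*`. -/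
noncomputable def rem (M : Model p q) (R : Reg)
    (S : Matrix (Fin q ⊕ Fin p) (Fin q ⊕ Fin p) ℝ) (Δ : Param p q) : ℝ :=
  logDetRem M.Oyy Δ.1 + phiRem S.toBlocks₂₂ M.theta Δ + M.kap R * phiRem M.L M.theta Δ

/-- Let T be the relative second order form of -log det. The log-determinant supplies T/3. Young's
inequality on the two fractional remainders costs at most (5/32) ε_S ω_S T and (1/8) ε_L X T, with
ω_S = `omegaSUp` and X = ηβ p^(β-1) `omegaLUp` ^ β. Both rates are below 1/3, so at least a₁T/3
survives. The remaining Δ_yx terms are freed of (Ω*_yy + Δ_yy)⁻¹ through the bound (3/2)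
λ_max(Ω*_yy). -/
lemma rem_ge (hL : M.L.PosDef) (hβ : 1 ≤ M.β) (h : M.H1) {R : Reg} (hη : 0 ≤ R.eta)
    {S : Matrix (Fin q ⊕ Fin p) (Fin q ⊕ Fin p) ℝ} (hS : S.toBlocks₂₂.PosSemidef)
    (hR : M.RangeBound S) {εS εL : ℝ} (hεS : 0 < εS) (hεL : 0 < εL)
    {Δ : Param p q} (hΔt : Δ.1ᵀ = Δ.1) (hΔ : frobInner Δ.1 Δ.1 ≤ M.r1 ^ 2)
    (ha1 : 0 < M.a1 R εS εL) :
    2 / 9 * M.a1 R εS εL / lamMax M.Oyy ^ 2 * frobInner Δ.1 Δ.1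
      + a2 εS / (3 * lamMax M.Oyy) * frobInner S.toBlocks₂₂ (Δ.2ᵀ * Δ.2)
      + M.a3 R εL * lamMin M.L / (3 * lamMax M.Oyy) * frobInner Δ.2 Δ.2 ≤ M.rem R S Δ := by
  have hq := (pos_of_H1 h).1
  have hA := h.Oyy_posDef
  have hmax := lamMax_pos hA hq
  have hmin := lamMin_pos hA hq
  rw [r1] at hΔ
  have hAU := add_posDef_of_frob hA hq hΔt hΔ
  have hLmin := lamMin_pos hL (pos_of_H1 h).2
  have hsL := sL_pos hL h
  have hωL := omegaLUp_pos h
  set T := (M.Oyy⁻¹ * (Δ.1 * (M.Oyy + Δ.1)⁻¹ * Δ.1)).trace with hT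
  have i1 : T / 3 ≤ logDetRem M.Oyy Δ.1 :=
    logDetRem_ge hA hAU (add_half_posSemidef hA hq hΔt hΔ)
  have i2 : 2 / 3 / lamMax M.Oyy ^ 2 * frobInner Δ.1 Δ.1 ≤ T := trace_rel_ge hA hq hΔt hΔ
  have hT0 : 0 ≤ T := le_trans (mul_nonneg (by positivity) (frobInner_self_nonneg _)) i2
  -- the sample covariance
  have i3 := frobInner_conj_sub_ge hS hAU.inv.posSemidef Δ.2 (Δ.1 * M.Oyy⁻¹ * M.Oyx) hεS
  have hOSO := lamMax_pos (OSO_posDef h) hq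
  have i4 := frobInner_cross_le hA hΔt hAU M.Oyx (transpose_eq_of_isHermitian hS.1)
    (smul_Oyy_sub_posSemidef h (by positivity) hR)
  have e4 : 5 / 4 * lamMax (M.Oyx * M.Sxx * M.Oyxᵀ) / lamMin M.Oyy = 5 / 16 * M.omegaSUp := by
    rw [omegaSUp]; ring
  rw [e4] at i4
  have hc : 0 < 3 / 2 * lamMax M.Oyy := by positivity
  have i5 := frobInner_inv_conj_ge hS hAU hc (smul_one_sub_add_posSemidef hA hq hΔt hΔ) Δ.2
  -- the structure matrix
  have j3 := frobInner_conj_sub_ge hL.posSemidef hAU.inv.posSemidef Δ.2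
    (Δ.1 * M.Oyy⁻¹ * M.Oyx) hεL
  have hOLO := lamMax_pos h.OLO_posDef hq
  have j4 := frobInner_cross_le hA hΔt hAU M.Oyx (transpose_eq_of_isHermitian hL.1)
    (smul_Oyy_sub_posSemidef h hOLO.le (lamMax_sub_posSemidef h.OLO_posDef.1))
  have f4 : lamMax (M.Oyx * M.L * M.Oyxᵀ) / lamMin M.Oyy = 1 / 4 * M.omegaLUp := by
    rw [omegaLUp]; ring
  rw [f4] at j4
  have j5 := frobInner_inv_conj_ge hL.posSemidef hAU hc
    (smul_one_sub_add_posSemidef hA hq hΔt hΔ) Δ.2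
  have j6 := lamMin_mul_le_frobInner hL Δ.2
  -- constants
  have hβ1 : 0 ≤ M.β - 1 := by linarith
  have hk0 : 0 ≤ M.kap R := by rw [kap]; positivity
  -- One factor `omegaLUp` comes from the cross term, the other β - 1 from bounding `sL` inside κ.
  have k1 : M.kap R * M.omegaLUp
      ≤ R.eta * M.β * (p : ℝ) ^ (M.β - 1) * M.omegaLUp ^ M.β := by
    have e : M.omegaLUp ^ M.β = M.omegaLUp ^ (M.β - 1) * M.omegaLUp := by
      rw [← Real.rpow_add_one hωL.ne', sub_add_cancel]
    have h1 := Real.rpow_le_rpow hsL.le (sL_le hL h) hβ1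
    rw [Real.mul_rpow (Nat.cast_nonneg _) hωL.le] at h1
    rw [kap, e]
    calc R.eta * M.β * M.sL ^ (M.β - 1) * M.omegaLUp
        ≤ R.eta * M.β * ((p : ℝ) ^ (M.β - 1) * M.omegaLUp ^ (M.β - 1)) * M.omegaLUp := by gcongr
      _ = _ := by ring
  have k2 : M.a3 R εL ≤ M.kap R * (2 * εL / (2 + εL)) := by
    have hq0 : 0 ≤ (q : ℝ) * M.omegaLLow := mul_nonneg (Nat.cast_nonneg _) (omegaLLow_pos h).le
    have h1 := Real.rpow_le_rpow hq0 (sL_ge hL h) hβ1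
    rw [a3, kap]
    gcongr
  set X := R.eta * M.β * (p : ℝ) ^ (M.β - 1) * M.omegaLUp ^ M.β with hX
  have hXa : M.a1 R εS εL = 1 - εS * M.omegaSUp - X * εL := by rw [a1]
  have hωS : 0 ≤ M.omegaSUp := by rw [omegaSUp]; positivity
  have hX0 : 0 ≤ X := by positivity
  set PS := frobInner S.toBlocks₂₂ (Δ.2ᵀ * (M.Oyy + Δ.1)⁻¹ * Δ.2)
  set PL := frobInner M.L (Δ.2ᵀ * (M.Oyy + Δ.1)⁻¹ * Δ.2)
  set YS := frobInner S.toBlocks₂₂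
    ((Δ.1 * M.Oyy⁻¹ * M.Oyx)ᵀ * (M.Oyy + Δ.1)⁻¹ * (Δ.1 * M.Oyy⁻¹ * M.Oyx))
  set YL := frobInner M.L
    ((Δ.1 * M.Oyy⁻¹ * M.Oyx)ᵀ * (M.Oyy + Δ.1)⁻¹ * (Δ.1 * M.Oyy⁻¹ * M.Oyx))
  have rS : (a2 εS * PS - εS * YS) / 2 ≤ phiRem S.toBlocks₂₂ M.theta Δ := i3
  have rL : (2 * εL / (2 + εL) * PL - εL * YL) / 2 ≤ phiRem M.L M.theta Δ := j3
  have rL' := mul_le_mul_of_nonneg_left rL hk0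
  have ha2 : 0 < a2 εS := by rw [a2]; positivity
  have ha3 : 0 ≤ M.a3 R εL := by
    have := (omegaLLow_pos h).le
    rw [a3]; positivity
  -- collecting
  have c1 : εS * YS ≤ 5 / 16 * (εS * M.omegaSUp * T) := by
    calc εS * YS ≤ εS * (5 / 16 * M.omegaSUp * T) := mul_le_mul_of_nonneg_left i4 hεS.le
      _ = _ := by ring
  have c2 : M.kap R * (εL * YL) ≤ 1 / 4 * (X * εL * T) := by
    calc M.kap R * (εL * YL) ≤ M.kap R * (εL * (1 / 4 * M.omegaLUp * T)) := by gcongr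
      _ = 1 / 4 * ((M.kap R * M.omegaLUp) * εL * T) := by ring
      _ ≤ 1 / 4 * (X * εL * T) := by gcongr
  have d1 : 0 ≤ εS * M.omegaSUp * T := by positivity
  have d2 : 0 ≤ X * εL * T := by positivity
  have c3 : 2 / 9 * M.a1 R εS εL / lamMax M.Oyy ^ 2 * frobInner Δ.1 Δ.1
      ≤ M.a1 R εS εL * T / 3 := by
    have := mul_le_mul_of_nonneg_left i2 ha1.le
    calc 2 / 9 * M.a1 R εS εL / lamMax M.Oyy ^ 2 * frobInner Δ.1 Δ.1
        = M.a1 R εS εL * (2 / 3 / lamMax M.Oyy ^ 2 * frobInner Δ.1 Δ.1) / 3 := by ring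
      _ ≤ _ := by linarith
  have c4 : a2 εS / (3 * lamMax M.Oyy) * frobInner S.toBlocks₂₂ (Δ.2ᵀ * Δ.2) ≤ a2 εS * PS / 2 := by
    have := mul_le_mul_of_nonneg_left i5 ha2.le
    calc a2 εS / (3 * lamMax M.Oyy) * frobInner S.toBlocks₂₂ (Δ.2ᵀ * Δ.2)
        = a2 εS * ((3 / 2 * lamMax M.Oyy)⁻¹ * frobInner S.toBlocks₂₂ (Δ.2ᵀ * Δ.2)) / 2 := by
          field_simp
      _ ≤ _ := by linarith
  have hPL : (3 / 2 * lamMax M.Oyy)⁻¹ * (lamMin M.L * frobInner Δ.2 Δ.2) ≤ PL :=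
    (mul_le_mul_of_nonneg_left j6 (by positivity)).trans j5
  have hV0 := frobInner_self_nonneg Δ.2
  have hPL0 : 0 ≤ PL := le_trans (by positivity) hPL
  have c5 : M.a3 R εL * lamMin M.L / (3 * lamMax M.Oyy) * frobInner Δ.2 Δ.2
      ≤ M.kap R * (2 * εL / (2 + εL) * PL) / 2 := by
    have h1 := mul_le_mul_of_nonneg_left hPL ha3
    have h2 := mul_le_mul_of_nonneg_right k2 hPL0
    calc M.a3 R εL * lamMin M.L / (3 * lamMax M.Oyy) * frobInner Δ.2 Δ.2
        = M.a3 R εL * ((3 / 2 * lamMax M.Oyy)⁻¹ * (lamMin M.L * frobInner Δ.2 Δ.2)) / 2 := by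
          field_simp
      _ ≤ _ := by linarith
  have ha1T : M.a1 R εS εL * T = T - εS * M.omegaSUp * T - X * εL * T := by rw [hXa]; ring
  rw [rem]
  linarith

end Model

end PGGM

namespace PGGM

namespace Model

variable {p q : ℕ} {M : Model p q}

/-! ### Strong convexity on the cone -/

/-- The lower bound of the sample covariance of the predictors, up to an `ℓ¹` term. -/
def SparseBound (M : Model p q) (S : Matrix (Fin q ⊕ Fin p) (Fin q ⊕ Fin p) ℝ) (s : ℝ) : Prop :=
  ∀ v : Fin p → ℝ, 3 / 4 * (v ⬝ᵥ M.Sxx *ᵥ v) - 1 / 2 * lamMax M.Sxx * (∑ j, |v j|) ^ 2 / (s - 1)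
    ≤ v ⬝ᵥ S.toBlocks₂₂ *ᵥ v

lemma frobInner_gram_eq_sum {k l : ℕ} {S : Matrix (Fin l) (Fin l) ℝ}
    (V : Matrix (Fin k) (Fin l) ℝ) :
    frobInner S (Vᵀ * V) = ∑ i, V i ⬝ᵥ S *ᵥ V i := by
  rw [frobInner_transpose_mul, frobInner_eq_sum]
  refine Finset.sum_congr rfl fun i _ => ?_
  rw [dotProduct_mulVec]
  rfl

lemma frobInner_self_eq_sum {k l : ℕ} (V : Matrix (Fin k) (Fin l) ℝ) :
    frobInner V V = ∑ i, V i ⬝ᵥ V i := by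
  rw [frobInner_eq_sum]; rfl

/-- The vector bound is applied to each row; the squared ℓ¹ norms of the rows sum to at most the
square of the total ℓ¹ norm. -/
lemma SparseBound.frobInner_ge {S : Matrix (Fin q ⊕ Fin p) (Fin q ⊕ Fin p) ℝ} {s : ℝ}
    (hs : 1 < s) (h : M.SparseBound S s) (hH : M.H1) (V : Matrix (Fin q) (Fin p) ℝ) :
    3 / 4 * lamMin M.Sxx * frobInner V V - 1 / 2 * lamMax M.Sxx * l1Norm V ^ 2 / (s - 1)
      ≤ frobInner S.toBlocks₂₂ (Vᵀ * V) := by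
  have hm := lamMax_pos hH.Sxx_posDef (pos_of_H1 hH).2
  have h1 : ∑ i, (∑ j, |V i j|) ^ 2 ≤ l1Norm V ^ 2 :=
    Finset.sum_sq_le_sq_sum_of_nonneg fun i _ => Finset.sum_nonneg fun j _ => abs_nonneg _
  have h2 := Finset.sum_le_sum fun i (_ : i ∈ Finset.univ) => h (V i)
  rw [← frobInner_gram_eq_sum, Finset.sum_sub_distrib, ← Finset.mul_sum, ← Finset.sum_div,
    ← Finset.mul_sum] at h2
  refine le_trans (sub_le_sub ?_ ?_) h2
  · rw [frobInner_self_eq_sum, mul_assoc, Finset.mul_sum]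
    refine mul_le_mul_of_nonneg_left (Finset.sum_le_sum fun i _ => ?_) (by norm_num)
    exact lamMin_le_quad hH.Sxx_posDef.1 _
  · have : 0 < s - 1 := by linarith
    gcongr

lemma one_le_cardS (h : M.H1) : (1 : ℝ) ≤ M.cardS := by
  have : ∃ i j, M.Oyx i j ≠ 0 := by
    by_contra! hc
    exact h.Oyx_ne_zero (by ext i j; exact hc i j)
  obtain ⟨i, j, hij⟩ := this
  rw [M.cardS_eq, Nat.one_le_cast, Nat.succ_le_iff, Finset.card_pos]
  exact ⟨Sum.inr (i, j), (M.mem_supp _).2 hij⟩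

lemma a2_pos {ε : ℝ} (hε : 0 < ε) : 0 < a2 ε := by rw [a2]; positivity

lemma a3_nonneg (hβ : 1 ≤ M.β) (h : M.H1) {R : Reg} (hη : 0 ≤ R.eta) {ε : ℝ} (hε : 0 < ε) :
    0 ≤ M.a3 R ε := by
  have := (omegaLLow_pos h).le
  rw [a3]; positivity

lemma gam_pos (hL : M.L.PosDef) (hβ : 1 ≤ M.β) (h : M.H1) {R : Reg} (hη : 0 ≤ R.eta)
    {εS εL : ℝ} (hεS : 0 < εS) (hεL : 0 < εL) (ha1 : 0 < M.a1 R εS εL) : 0 < M.gam R εS εL := by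
  have hmax := lamMax_pos h.Oyy_posDef (pos_of_H1 h).1
  have hS := lamMin_pos h.Sxx_posDef (pos_of_H1 h).2
  have hLm := lamMin_pos hL (pos_of_H1 h).2
  have := a2_pos hεS
  have := a3_nonneg hβ h hη hεL
  rw [gam]
  refine lt_min ?_ ?_ <;> positivity

lemma one_le_alpha {T : Tuning} (hT : T.Valid) (hL : M.L.PosDef) (hβ : 1 ≤ M.β) (h : M.H1)
    {R : Reg} (hη : 0 ≤ R.eta) (hlam : 0 ≤ R.lam) (hd : 0 < M.alphaDen T R) :
    1 ≤ M.alpha T R := by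
  rw [alpha, one_le_div hd]
  have hc := hT.one_lt_cl
  have hsL := (sL_pos hL h).le
  have hk : 0 ≤ R.eta * M.β * M.sL ^ (M.β - 1) * M.ella := by
    have : 0 ≤ M.ella := maxNorm_nonneg _
    positivity
  refine (min_le_left _ _).trans (le_trans ?_ (le_max_left _ _))
  have h1 : (T.cl - 1) * R.lam / T.cl ≤ (T.cl + 1) * R.lam / T.cl := by
    have : 0 < T.cl := by linarith
    gcongr
    linarith
  linarith

/-- The cone condition makes the ℓ¹ correction of `SparseBound` a small multiple of ‖Δ_yx‖², but
only when Δ_yx carries a fair share of the norm of Δ. When it does not, the log-determinant alone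
provides the curvature. -/
lemma rem_ge_gam (hL : M.L.PosDef) (hβ : 1 ≤ M.β) (h : M.H1) {T : Tuning} (hT : T.Valid)
    {R : Reg} (hη : 0 ≤ R.eta) (hlam : 0 ≤ R.lam) (hd : 0 < M.alphaDen T R)
    {S : Matrix (Fin q ⊕ Fin p) (Fin q ⊕ Fin p) ℝ} (hS : S.toBlocks₂₂.PosSemidef)
    (hR : M.RangeBound S) {s : ℝ} (hs : M.sAlpha T R ≤ s) (hSB : M.SparseBound S s)
    {εS εL : ℝ} (hεS : 0 < εS) (hεL : 0 < εL)
    {Δ : Param p q} (hΔt : Δ.1ᵀ = Δ.1) (hΔ : normSq Δ ≤ M.r1 ^ 2) (ha1 : 0 < M.a1 R εS εL)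
    (hcone : M.alphaDen T R * M.l1Compl Δ ≤ M.alphaNum T R * M.l1On Δ) :
    M.gam R εS εL * normSq Δ ≤ M.rem R S Δ := by
  have hU0 := frobInner_self_nonneg Δ.1
  have hV0 := frobInner_self_nonneg Δ.2
  have hrem := rem_ge hL hβ h hη hS hR hεS hεL hΔt (by rw [normSq] at hΔ; linarith) ha1
  have hmax := lamMax_pos h.Oyy_posDef (pos_of_H1 h).1
  have hSmin := lamMin_pos h.Sxx_posDef (pos_of_H1 h).2
  have hSmax := lamMax_pos h.Sxx_posDef (pos_of_H1 h).2
  have hLm := lamMin_pos hL (pos_of_H1 h).2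
  have ha2 := a2_pos hεS
  have ha3 := a3_nonneg hβ h hη hεL
  have hγ := gam_pos hL hβ h hη hεS hεL ha1
  have hγ1 : M.gam R εS εL ≤ M.a1 R εS εL / (8 * lamMax M.Oyy ^ 2) := min_le_left _ _
  have hγ2 : M.gam R εS εL ≤ a2 εS * lamMin M.Sxx / (40 * lamMax M.Oyy)
    + M.a3 R εL * lamMin M.L / (4 * lamMax M.Oyy) := min_le_right _ _
  have hQ0 : 0 ≤ frobInner S.toBlocks₂₂ (Δ.2ᵀ * Δ.2) := by
    simpa using frobInner_conj_nonneg hS (PosSemidef.one : (1 : Matrix (Fin q) (Fin q) ℝ).PosSemidef)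
      Δ.2
  have e1 : 2 / 9 * M.a1 R εS εL / lamMax M.Oyy ^ 2 * frobInner Δ.1 Δ.1
      = 16 / 9 * (M.a1 R εS εL / (8 * lamMax M.Oyy ^ 2) * frobInner Δ.1 Δ.1) := by
    field_simp; ring
  have hA := mul_le_mul_of_nonneg_right hγ1 hU0
  rw [e1] at hrem
  rw [normSq]
  -- In the first case ‖Δ‖² ≤ (3/2)‖Δ_yy‖², covered by the spare factor 16/9. In the second ‖Δ‖² ≤
  -- 3‖Δ_yx‖².
  rcases le_total (2 * frobInner Δ.2 Δ.2) (frobInner Δ.1 Δ.1) with hc | hc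
  · have h1 : 0 ≤ a2 εS / (3 * lamMax M.Oyy) * frobInner S.toBlocks₂₂ (Δ.2ᵀ * Δ.2) := by positivity
    have h2 : 0 ≤ M.a3 R εL * lamMin M.L / (3 * lamMax M.Oyy) * frobInner Δ.2 Δ.2 := by positivity
    have h3 := mul_le_mul_of_nonneg_left hc hγ.le
    have h4 := mul_nonneg hγ.le hV0
    linarith
  · have hα := one_le_alpha hT hL hβ h hη hlam hd
    have hS1 := one_le_cardS h
    have hl0 := M.l1On_nonneg Δ
    have hcone' : M.l1Compl Δ ≤ M.alpha T R * M.l1On Δ := by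
      rw [alpha, div_mul_eq_mul_div, le_div_iff₀ hd]; linarith
    have hl1 : l1Norm Δ.2 ≤ 2 * M.alpha T R * M.l1On Δ := by
      have h1 := M.l1On_add_l1Compl Δ
      have h2 : 0 ≤ l1Norm Δ.1 :=
        Finset.sum_nonneg fun _ _ => Finset.sum_nonneg fun _ _ => abs_nonneg _
      have h3 := mul_le_mul_of_nonneg_right hα hl0
      linarith
    have hl1n : 0 ≤ l1Norm Δ.2 :=
      Finset.sum_nonneg fun _ _ => Finset.sum_nonneg fun _ _ => abs_nonneg _
    have hl2 : l1Norm Δ.2 ^ 2 ≤ 12 * M.alpha T R ^ 2 * M.cardS * frobInner Δ.2 Δ.2 := by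
      have hα2 : 0 ≤ 4 * M.alpha T R ^ 2 := by positivity
      calc l1Norm Δ.2 ^ 2 ≤ (2 * M.alpha T R * M.l1On Δ) ^ 2 := by gcongr
        _ = 4 * M.alpha T R ^ 2 * M.l1On Δ ^ 2 := by ring
        _ ≤ 4 * M.alpha T R ^ 2 * (M.cardS * normSq Δ) :=
          mul_le_mul_of_nonneg_left (M.l1On_sq_le Δ) hα2
        _ ≤ 4 * M.alpha T R ^ 2 * (M.cardS * (3 * frobInner Δ.2 Δ.2)) := by
          have : normSq Δ ≤ 3 * frobInner Δ.2 Δ.2 := by rw [normSq]; linarith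
          gcongr
        _ = _ := by ring
    -- The leading |S| ≥ 1 in s_α compensates the -1. The ℓ¹ correction then takes at most 1/2 of
    -- the available 3/4 of λ_min(Σ*_xx), leaving 1/4.
    have hsα : 12 * M.alpha T R ^ 2 * M.cardS * lamMax M.Sxx / lamMin M.Sxx ≤ s - 1 := by
      have : M.sAlpha T R
          = M.cardS + 12 * M.alpha T R ^ 2 * M.cardS * lamMax M.Sxx / lamMin M.Sxx := by
        rw [sAlpha]; ring
      linarith
    have hs1 : 0 < s - 1 := lt_of_lt_of_le (by positivity) hsα
    have hQ := hSB.frobInner_ge (by linarith) h Δ.2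
    have hl3 : 1 / 2 * lamMax M.Sxx * l1Norm Δ.2 ^ 2 / (s - 1)
        ≤ 1 / 2 * lamMin M.Sxx * frobInner Δ.2 Δ.2 := by
      rw [div_le_iff₀ hs1]
      rw [div_le_iff₀ hSmin] at hsα
      have h1 := mul_le_mul_of_nonneg_left hl2 hSmax.le
      have h2 := mul_le_mul_of_nonneg_right hsα hV0
      linarith
    have hQ' : lamMin M.Sxx / 4 * frobInner Δ.2 Δ.2 ≤ frobInner S.toBlocks₂₂ (Δ.2ᵀ * Δ.2) := by
      linarith
    have h1 : a2 εS * lamMin M.Sxx / (40 * lamMax M.Oyy) * frobInner Δ.2 Δ.2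
        ≤ a2 εS / (3 * lamMax M.Oyy) * frobInner S.toBlocks₂₂ (Δ.2ᵀ * Δ.2) := by
      calc a2 εS * lamMin M.Sxx / (40 * lamMax M.Oyy) * frobInner Δ.2 Δ.2
          ≤ a2 εS * lamMin M.Sxx / (12 * lamMax M.Oyy) * frobInner Δ.2 Δ.2 := by
            gcongr; norm_num
        _ = a2 εS / (3 * lamMax M.Oyy) * (lamMin M.Sxx / 4 * frobInner Δ.2 Δ.2) := by
            field_simp; ring
        _ ≤ _ := by gcongr
    have h2 : M.a3 R εL * lamMin M.L / (4 * lamMax M.Oyy) * frobInner Δ.2 Δ.2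
        ≤ M.a3 R εL * lamMin M.L / (3 * lamMax M.Oyy) * frobInner Δ.2 Δ.2 := by
      gcongr; norm_num
    have h3 := mul_le_mul_of_nonneg_right hγ2 hV0
    have h4 := mul_nonneg hγ.le hU0
    linarith

lemma rem_nonneg (hL : M.L.PosDef) (hβ : 1 ≤ M.β) (h : M.H1) {R : Reg} (hη : 0 ≤ R.eta)
    {S : Matrix (Fin q ⊕ Fin p) (Fin q ⊕ Fin p) ℝ} (hS : S.toBlocks₂₂.PosSemidef)
    {Δ : Param p q} (hΔ : (M.Oyy + Δ.1).PosDef) : 0 ≤ M.rem R S Δ := by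
  have h1 := logDetRem_nonneg h.Oyy_posDef hΔ
  have h2 := phiRem_nonneg (θ := M.theta) hS hΔ
  have h3 := phiRem_nonneg (θ := M.theta) hL.posSemidef hΔ
  have h4 := (sL_pos hL h).le
  rw [rem, kap]
  positivity

lemma InBand.kap_mul_le {T : Tuning} {R : Reg} {S : Matrix (Fin q ⊕ Fin p) (Fin q ⊕ Fin p) ℝ}
    (hB : M.InBand T R S) (hT : T.Valid) (hL : M.L.PosDef) (hβ : 1 ≤ M.β) (h : M.H1) :
    M.kap R * M.ella ≤ T.el * M.ha S ∧ M.kap R * M.ellb ≤ T.em * M.hb S := by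
  have hsL := sL_pos hL h
  have hden : 0 < M.β * M.sL ^ (M.β - 1) := mul_pos (by linarith) (Real.rpow_pos_of_pos hsL _)
  have h1 := hB.eta_mem.2
  rw [etaBar, le_div_iff₀ hden, ← mul_assoc] at h1
  have ha0 : 0 ≤ M.ella := maxNorm_nonneg _
  have hb0 : 0 ≤ M.ellb := mul_nonneg (by norm_num) (maxNorm_nonneg _)
  -- Division by zero being zero, nonnegativity of `ella` and `ellb` is enough here.
  exact ⟨mul_le_of_le_div₀ (mul_nonneg hT.el_pos.le (maxNorm_nonneg _)) ha0
      (h1.trans ((min_le_right _ _).trans (min_le_left _ _))),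
    mul_le_of_le_div₀ (mul_nonneg hT.em_pos.le (maxNorm_nonneg _)) hb0
      (h1.trans ((min_le_right _ _).trans (min_le_right _ _)))⟩

/-- The upper edges λ ≤ d_λ h_a, μ ≤ d_μ h_b and the e-terms of η̄ express everything in units of
h_a and h_b; c_{λ,μ} collects the coefficients. -/
lemma InBand.alphaNum_le {T : Tuning} {R : Reg} {S : Matrix (Fin q ⊕ Fin p) (Fin q ⊕ Fin p) ℝ}
    (hB : M.InBand T R S) (hT : T.Valid) (hL : M.L.PosDef) (hβ : 1 ≤ M.β) (h : M.H1) {H : ℝ}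
    (ha : M.ha S ≤ H) (hb : M.hb S ≤ H) : M.alphaNum T R ≤ T.cLamMu * H := by
  obtain ⟨h1, h2⟩ := hB.kap_mul_le hT hL hβ h
  have hH : 0 ≤ H := (maxNorm_nonneg _).trans ha
  have aux : ∀ c d e lam k x : ℝ, 1 < c → c < d → 0 < e → lam ≤ d * x → k ≤ e * x → x ≤ H →
      (c + 1) * d / c + e ≤ T.cLamMu → (c + 1) * lam / c + k ≤ T.cLamMu * H := by
    intro c d e lam k x hc hcd he hl hk hx hT
    have hc0 : 0 < c := by linarith
    have hd0 : 0 < d := by linarith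
    calc (c + 1) * lam / c + k ≤ (c + 1) * (d * x) / c + e * x := by gcongr
      _ = ((c + 1) * d / c + e) * x := by ring
      _ ≤ ((c + 1) * d / c + e) * H := by gcongr
      _ ≤ _ := by gcongr
  exact max_le
    (aux _ _ _ _ _ _ hT.one_lt_cl hT.cl_lt_dl hT.el_pos hB.lam_mem.2 h1 ha (le_max_left _ _))
    (aux _ _ _ _ _ _ hT.one_lt_cm hT.cm_lt_dm hT.em_pos hB.mu_mem.2 h2 hb (le_max_right _ _))

/-- The objective exceeds its value at `θ*` outside of a small ball. -/
lemma objective_lt_of_norm (hSig : M.Sig.PosDef) (hL : M.L.PosDef) (hβ : 1 ≤ M.β) (h : M.H1)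
    {T : Tuning} (hT : T.Valid) {R : Reg} {S : Matrix (Fin q ⊕ Fin p) (Fin q ⊕ Fin p) ℝ}
    (hB : M.InBand T R S) (hd : 0 < M.alphaDen T R) (hS : S.toBlocks₂₂.PosSemidef)
    (hR : M.RangeBound S) {s : ℝ} (hs : M.sAlpha T R ≤ s) (hSB : M.SparseBound S s)
    {εS εL : ℝ} (hεS : 0 < εS) (hεL : 0 < εL) (ha1 : 0 < M.a1 R εS εL)
    {H : ℝ} (ha : M.ha S ≤ H) (hb : M.hb S ≤ H)
    {Δ : Param p q} (hΔt : Δ.1ᵀ = Δ.1) (hΔ : normSq Δ ≤ M.r1 ^ 2)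
    (herr : T.cLamMu * H * √M.cardS / M.gam R εS εL < √(normSq Δ)) :
    M.objective R S M.theta < M.objective R S (M.theta + Δ) := by
  have hη := hB.eta_mem.1
  have hlam : 0 ≤ R.lam := le_trans (mul_nonneg (by linarith [hT.one_lt_cl]) (maxNorm_nonneg _))
    hB.lam_mem.1
  have hΔP : (M.Oyy + Δ.1).PosDef := add_posDef_of_frob h.Oyy_posDef (pos_of_H1 h).1 hΔt (by
    rw [normSq, r1] at hΔ
    linarith [frobInner_self_nonneg Δ.2])
  have key := objective_theta_add_ge hSig hL hβ h hT hS hB hΔP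
  have hremdef : logDetRem M.Oyy Δ.1 + phiRem S.toBlocks₂₂ M.theta Δ
      + M.kap R * phiRem M.L M.theta Δ = M.rem R S Δ := rfl
  rw [hremdef] at key
  -- On the cone the quadratic lower bound beats the ℓ¹ loss; off it the balance is already positive
  -- and `rem` only needs to be nonnegative.
  rcases le_or_gt (M.alphaDen T R * M.l1Compl Δ) (M.alphaNum T R * M.l1On Δ) with hc | hc
  · have h1 := rem_ge_gam hL hβ h hT hη hlam hd hS hR hs hSB hεS hεL hΔt hΔ ha1 hc
    have hγ := gam_pos hL hβ h hη hεS hεL ha1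
    have hnum := hB.alphaNum_le hT hL hβ h ha hb
    have hl1 : M.l1On Δ ≤ √M.cardS * √(normSq Δ) := by
      rw [← Real.sqrt_mul (Nat.cast_nonneg _)]
      exact Real.le_sqrt_of_sq_le (M.l1On_sq_le Δ)
    have hcl : 0 ≤ T.cLamMu := by
      refine le_trans ?_ (le_max_left _ _)
      have := hT.one_lt_cl
      have := hT.cl_lt_dl
      have := hT.el_pos
      have : 0 < T.dl := by linarith
      positivity
    have hH : 0 ≤ H := (maxNorm_nonneg _).trans ha
    have h2 : M.alphaNum T R * M.l1On Δ ≤ T.cLamMu * H * (√M.cardS * √(normSq Δ)) := by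
      calc M.alphaNum T R * M.l1On Δ ≤ (T.cLamMu * H) * M.l1On Δ :=
            mul_le_mul_of_nonneg_right hnum (M.l1On_nonneg Δ)
        _ ≤ _ := mul_le_mul_of_nonneg_left hl1 (by positivity)
    rw [div_lt_iff₀ hγ] at herr
    have hn : 0 < √(normSq Δ) := by
      refine lt_of_mul_lt_mul_right ?_ hγ.le
      rw [zero_mul]
      exact lt_of_le_of_lt (by positivity) herr
    have h3 := mul_lt_mul_of_pos_right herr hn
    have h4 : √(normSq Δ) * √(normSq Δ) = normSq Δ := Real.mul_self_sqrt (normSq_nonneg Δ)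
    have h5 := mul_nonneg hd.le (M.l1Compl_nonneg Δ)
    have h6 : √(normSq Δ) * M.gam R εS εL * √(normSq Δ) = M.gam R εS εL * normSq Δ := by
      calc √(normSq Δ) * M.gam R εS εL * √(normSq Δ)
          = M.gam R εS εL * (√(normSq Δ) * √(normSq Δ)) := by ring
        _ = _ := by rw [h4]
    rw [h6] at h3
    linarith
  · have := rem_nonneg hL hβ h hη hS hΔP
    linarith

end Model

end PGGM

namespace PGGM

namespace Model

variable {p q : ℕ} {M : Model p q}

/-! ### Existence and location of the minimizers -/

/-- Symmetric parameters in the closed ball of radius `r` around `θ*`. -/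
def symBall (M : Model p q) (r : ℝ) : Set (Param p q) :=
  {θ | θ.1ᵀ = θ.1 ∧ normSq (θ - M.theta) ≤ r ^ 2}

lemma continuous_frobInner {X : Type*} [TopologicalSpace X] {k l : ℕ}
    {f g : X → Matrix (Fin k) (Fin l) ℝ} (hf : Continuous f) (hg : Continuous g) :
    Continuous fun x => frobInner (f x) (g x) := by
  unfold frobInner
  fun_prop

lemma continuous_normSq : Continuous (normSq : Param p q → ℝ) := by
  unfold normSq
  exact (continuous_frobInner continuous_fst continuous_fst).add
    (continuous_frobInner continuous_snd continuous_snd)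

lemma abs_entry_le_of_normSq {Δ : Param p q} {r : ℝ} (hr : 0 ≤ r) (h : normSq Δ ≤ r ^ 2)
    (x : (Fin q × Fin q) ⊕ (Fin q × Fin p)) : |entry Δ x| ≤ r := by
  refine abs_le_of_sq_le_sq ?_ hr
  refine le_trans ?_ h
  rw [normSq_eq_sum]
  exact Finset.single_le_sum (f := fun x => entry Δ x ^ 2) (fun _ _ => sq_nonneg _)
    (Finset.mem_univ x)

open scoped Matrix.Norms.Elementwise in
lemma isCompact_symBall {r : ℝ} (hr : 0 ≤ r) : IsCompact (M.symBall r) := by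
  refine Metric.isCompact_of_isClosed_isBounded ?_ ?_
  · refine IsClosed.inter ?_ ?_
    · exact isClosed_eq (continuous_fst.matrix_transpose) continuous_fst
    · exact isClosed_le (continuous_normSq.comp (continuous_id.sub continuous_const))
        continuous_const
  · refine (Metric.isBounded_closedBall (x := M.theta) (r := r)).subset fun θ hθ => ?_
    rw [mem_closedBall_iff_norm, Prod.norm_def]
    refine max_le ((Matrix.norm_le_iff hr).2 fun i j => ?_) ((Matrix.norm_le_iff hr).2 fun i j => ?_)
    · exact abs_entry_le_of_normSq hr hθ.2 (Sum.inl (i, j))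
    · exact abs_entry_le_of_normSq hr hθ.2 (Sum.inr (i, j))

lemma continuousOn_objective (hβ : 1 ≤ M.β) (R : Reg)
    (S : Matrix (Fin q ⊕ Fin p) (Fin q ⊕ Fin p) ℝ) :
    ContinuousOn (M.objective R S) {θ | θ.1.PosDef} := by
  have hinv : ContinuousOn (fun θ : Param p q => θ.1⁻¹) {θ | θ.1.PosDef} := by
    intro θ hθ
    have hd : θ.1.det ≠ 0 := hθ.det_pos.ne'
    have : ContinuousAt (fun θ : Param p q => (θ.1.det)⁻¹ • θ.1.adjugate) θ := by
      have h1 : Continuous fun θ : Param p q => θ.1.det := continuous_fst.matrix_det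
      have h2 : Continuous fun θ : Param p q => θ.1.adjugate := continuous_fst.matrix_adjugate
      exact (h1.continuousAt.inv₀ hd).smul h2.continuousAt
    have e : (fun θ : Param p q => θ.1⁻¹) = fun θ : Param p q => (θ.1.det)⁻¹ • θ.1.adjugate := by
      funext θ; rw [Matrix.inv_def, Ring.inverse_eq_inv']
    rw [e]
    exact this.continuousWithinAt
  have hphi : ∀ K : Matrix (Fin p) (Fin p) ℝ,
      ContinuousOn (fun θ : Param p q => frobInner K (θ.2ᵀ * θ.1⁻¹ * θ.2)) {θ | θ.1.PosDef} := by
    intro K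
    have hX : ContinuousOn (fun θ : Param p q => θ.2ᵀ * θ.1⁻¹ * θ.2) {θ | θ.1.PosDef} := by
      have hs : ContinuousOn (fun θ : Param p q => θ.2) {θ | θ.1.PosDef} := continuousOn_snd
      have ht : ContinuousOn (fun θ : Param p q => θ.2ᵀ) {θ | θ.1.PosDef} :=
        (continuous_snd.matrix_transpose).continuousOn
      rw [continuousOn_iff_continuous_domRestrict] at hs ht hinv ⊢
      exact (ht.matrix_mul hinv).matrix_mul hs
    rw [continuousOn_iff_continuous_domRestrict] at hX ⊢
    exact continuous_frobInner continuous_const hX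
  have hdet : ContinuousOn (fun θ : Param p q => Real.log θ.1.det) {θ | θ.1.PosDef} :=
    ContinuousOn.log continuous_fst.matrix_det.continuousOn fun θ hθ => hθ.det_pos.ne'
  have hl1 : Continuous fun θ : Param p q => l1NormOff θ.1 := by
    unfold l1NormOff
    refine continuous_finsetSum _ fun i _ => continuous_finsetSum _ fun j _ => ?_
    split_ifs
    · exact continuous_const
    · exact (continuous_fst.matrix_elem i j).abs
  have hl2 : Continuous fun θ : Param p q => l1Norm θ.2 := by
    unfold l1Norm
    exact continuous_finsetSum _ fun i _ => continuous_finsetSum _ fun j _ =>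
      (continuous_snd.matrix_elem i j).abs
  have h3 : Continuous fun θ : Param p q => frobInner S.toBlocks₁₁ θ.1 :=
    continuous_frobInner continuous_const continuous_fst
  have h4 : Continuous fun θ : Param p q => frobInner S.toBlocks₁₂ θ.2 :=
    continuous_frobInner continuous_const continuous_snd
  unfold objective
  refine ContinuousOn.add (ContinuousOn.add (ContinuousOn.add (ContinuousOn.add (ContinuousOn.add
    (ContinuousOn.add hdet.neg h3.continuousOn) (continuousOn_const.mul h4.continuousOn))
    (hphi _)) (continuousOn_const.mul ((hphi _).rpow_const fun _ _ => Or.inr (by linarith))))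
    (continuousOn_const.mul hl1.continuousOn)) (continuousOn_const.mul hl2.continuousOn)

/-- A convex function that exceeds its value at `θ*` between two radii has its minimizers within the
smaller one. -/
lemma estimator_of_objective_lt (hL : M.L.PosDef) (hβ : 1 ≤ M.β) (h : M.H1) {R : Reg}
    {S : Matrix (Fin q ⊕ Fin p) (Fin q ⊕ Fin p) ℝ} (hS : S.toBlocks₂₂.PosSemidef)
    (hη : 0 ≤ R.eta) (hlam : 0 ≤ R.lam) (hmu : 0 ≤ R.mu) {e : ℝ} (he : e < M.r1)
    (hlt : ∀ Δ : Param p q, Δ.1ᵀ = Δ.1 → normSq Δ ≤ M.r1 ^ 2 → e < √(normSq Δ) →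
      M.objective R S M.theta < M.objective R S (M.theta + Δ)) :
    (∃ θ, M.IsEstimator R S θ) ∧ ∀ θ, M.IsEstimator R S θ → frobDist θ M.theta ≤ e := by
  have hq := (pos_of_H1 h).1
  have hr : 0 < M.r1 := by rw [r1]; linarith [lamMin_pos h.Oyy_posDef hq]
  have hsymm : M.Oyyᵀ = M.Oyy := transpose_eq_of_isHermitian h.Oyy_posDef.1
  have hout : ∀ θ : Param p q, θ.1.PosDef → e < √(normSq (θ - M.theta)) →
      M.objective R S M.theta < M.objective R S θ := by
    intro θ hθ hgt
    set Δ := θ - M.theta with hΔ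
    have hΔt : Δ.1ᵀ = Δ.1 := by
      have : Δ.1 = θ.1 - M.Oyy := rfl
      rw [this, transpose_sub, hsymm, transpose_eq_of_isHermitian hθ.1]
    have e0 : M.theta + Δ = θ := by rw [hΔ]; abel
    rcases le_or_gt (normSq Δ) (M.r1 ^ 2) with hle | hlt'
    · have := hlt Δ hΔt hle hgt
      rwa [e0] at this
    -- A point beyond the ball is pulled back along the segment to distance exactly `r1`, where the
    -- strict inequality is known; convexity transfers it to the endpoint.
    · have hn : M.r1 < √(normSq Δ) := Real.lt_sqrt_of_sq_lt hlt'
      have hn0 : 0 < √(normSq Δ) := hr.trans hn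
      set t := M.r1 / √(normSq Δ) with ht
      have ht0 : 0 < t := by positivity
      have ht1 : t ≤ 1 := (div_le_one hn0).2 hn.le
      have hnt : normSq (t • Δ) = M.r1 ^ 2 := by
        rw [normSq_smul, ht, div_pow, Real.sq_sqrt (normSq_nonneg _)]
        have : normSq Δ ≠ 0 := (lt_trans (by positivity) hlt').ne'
        field_simp
      have h1 := hlt (t • Δ) (by rw [Prod.smul_fst, transpose_smul, hΔt]) hnt.le (by
        rw [hnt, Real.sqrt_sq hr.le]; exact he)
      have h2 := objective_convex (M := M) (R := R) hS hL hβ hη hlam hmu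
        (θ := M.theta) h.Oyy_posDef hθ ht0.le ht1
      rw [← hΔ] at h2
      have h3 : t * M.objective R S M.theta < t * M.objective R S θ := by linarith
      exact lt_of_mul_lt_mul_left h3 ht0.le
  have hpd : M.symBall M.r1 ⊆ {θ | θ.1.PosDef} := by
    intro θ hθ
    have h1 : (θ.1 - M.Oyy)ᵀ = θ.1 - M.Oyy := by rw [transpose_sub, hsymm, hθ.1]
    have h2 := add_posDef_of_frob h.Oyy_posDef hq h1 (by
      have h3 := hθ.2
      rw [normSq, r1] at h3
      have h4 := frobInner_self_nonneg (θ - M.theta).2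
      have h5 : (θ - M.theta).1 = θ.1 - M.Oyy := rfl
      rw [h5] at h3
      linarith)
    rwa [add_sub_cancel] at h2
  have hmem : M.theta ∈ M.symBall M.r1 := by
    refine ⟨hsymm, ?_⟩
    rw [sub_self, normSq]
    simp [frobInner]
    positivity
  -- The ball stays inside the positive definite cone, where the objective is continuous. Points
  -- outside lose to θ*, so the local minimizer is global.
  obtain ⟨θ₀, hθ₀, hmin⟩ := (isCompact_symBall hr.le).exists_isMinOn ⟨_, hmem⟩
    ((continuousOn_objective hβ R S).mono hpd)
  refine ⟨⟨θ₀, hpd hθ₀, fun θ hθ => ?_⟩, fun θ hθ => ?_⟩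
  · by_cases hb : normSq (θ - M.theta) ≤ M.r1 ^ 2
    · exact hmin ⟨transpose_eq_of_isHermitian hθ.1, hb⟩
    · have h1 := hout θ hθ (he.trans (Real.lt_sqrt_of_sq_lt (not_le.1 hb)))
      exact (hmin hmem).trans h1.le
  · rw [frobDist_eq]
    by_contra hc
    exact absurd (hout θ hθ.1 (not_le.1 hc)) (not_lt.2 (hθ.2 M.theta h.Oyy_posDef))

open scoped Matrix.Norms.L2Operator in
lemma specNorm_pos {k l : ℕ} {A : Matrix (Fin k) (Fin l) ℝ} (hA : A ≠ 0) : 0 < specNorm A :=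
  norm_pos_iff.2 hA

lemma rStar_pos (hL : M.L.PosDef) (h : M.H1) : 0 < M.rStar := by
  obtain ⟨hq, hp⟩ := pos_of_H1 h
  have h1 := lamMin_pos h.Oyy_posDef hq
  have h2 := lamMax_pos (OSO_posDef h) hq
  have h3 := lamMax_pos h.Sxx_posDef hp
  have h4 := lamMin_pos h.OLO_posDef hq
  have h5 := lamMax_pos h.OLO_posDef hq
  have h6 := lamMax_pos hL hp
  have h7 : (0 : ℝ) < √10 - √7 := sub_pos.2 (Real.sqrt_lt_sqrt (by norm_num) (by norm_num))
  have h8 : (0 : ℝ) < √2 - 1 := by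
    rw [sub_pos]; exact Real.lt_sqrt_of_sq_lt (by norm_num)
  have h9 : 0 < specNorm (M.L * M.Oyxᵀ) := by
    refine specNorm_pos fun h0 => ?_
    have := h.OLO_posDef.diag_pos (i := ⟨0, hq⟩)
    rw [Matrix.mul_assoc, h0, Matrix.mul_zero] at this
    exact lt_irrefl _ this
  rw [rStar]
  refine lt_min (lt_min ?_ ?_) (lt_min ?_ ?_)
  · rw [r1]; positivity
  · rw [r2]; positivity
  · rw [r3]; positivity
  · rw [r4]; positivity

lemma mStar_nonneg : 0 ≤ M.mStar := add_nonneg (diagMax_nonneg _) (diagMax_nonneg _)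

/-- The first term of n₀ is the squared inequality solved for n. -/
lemma errorBound_lt_rStar (hL : M.L.PosDef) (hβ : 1 ≤ M.β) (h : M.H1) {T : Tuning}
    {R : Reg} (hη : 0 ≤ R.eta) {εS εL b₁ b₃ : ℝ} (hεS : 0 < εS) (hεL : 0 < εL)
    (ha1 : 0 < M.a1 R εS εL) {n : ℕ} (hn0 : 0 < n)
    (hn : M.nZero T R εS εL b₁ b₃ < n) (hl : 0 ≤ logTerm p q b₃) :
    M.errorBound T R εS εL b₃ n < M.rStar := by
  have hr := rStar_pos hL h
  have hγ := gam_pos hL hβ h hη hεS hεL ha1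
  have hn0' : (0 : ℝ) < n := by exact_mod_cast hn0
  have h1 := lt_of_le_of_lt (le_max_left _ _) hn
  rw [div_lt_iff₀ (by positivity)] at h1
  refine lt_of_pow_lt_pow_left₀ 2 hr.le ?_
  rw [errorBound, mul_pow, div_pow, mul_pow, mul_pow, Real.sq_sqrt (Nat.cast_nonneg _),
    Real.sq_sqrt (by positivity), div_mul_div_comm, div_lt_iff₀ (by positivity)]
  linarith

/-- The deterministic part of the theorem. -/
lemma estimator_bound (hSig : M.Sig.PosDef) (hL : M.L.PosDef) (hβ : 1 ≤ M.β) (h : M.H1)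
    {T : Tuning} (hT : T.Valid) {R : Reg} {S : Matrix (Fin q ⊕ Fin p) (Fin q ⊕ Fin p) ℝ}
    (hB : M.InBand T R S) (hd : 0 < M.alphaDen T R) (hS : S.toBlocks₂₂.PosSemidef)
    (hR : M.RangeBound S) {s : ℝ} (hs : M.sAlpha T R ≤ s) (hSB : M.SparseBound S s)
    {εS εL b₁ b₃ : ℝ} (hεS : 0 < εS) (hεL : 0 < εL) (ha1 : 0 < M.a1 R εS εL)
    {n : ℕ} (hn0 : 0 < n) (hn : M.nZero T R εS εL b₁ b₃ < n) (hl : 0 ≤ logTerm p q b₃)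
    (ha : M.ha S ≤ 16 * M.mStar * √(logTerm p q b₃ / n))
    (hb : M.hb S ≤ 16 * M.mStar * √(logTerm p q b₃ / n)) :
    (∃ θ, M.IsEstimator R S θ) ∧
      ∀ θ, M.IsEstimator R S θ → frobDist θ M.theta ≤ M.errorBound T R εS εL b₃ n := by
  have hη := hB.eta_mem.1
  have hlam : 0 ≤ R.lam := le_trans (mul_nonneg (by linarith [hT.one_lt_cl]) (maxNorm_nonneg _))
    hB.lam_mem.1
  have hmu : 0 ≤ R.mu := le_trans (mul_nonneg (by linarith [hT.one_lt_cm]) (maxNorm_nonneg _))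
    hB.mu_mem.1
  refine estimator_of_objective_lt hL hβ h hS hη hlam hmu
    ((errorBound_lt_rStar hL hβ h hη hεS hεL ha1 hn0 hn hl).trans_le
      ((min_le_left _ _).trans (min_le_left _ _))) fun Δ hΔt hΔ hgt => ?_
  refine objective_lt_of_norm hSig hL hβ h hT hB hd hS hR hs hSB hεS hεL ha1 ha hb hΔt hΔ ?_
  refine lt_of_eq_of_lt ?_ hgt
  rw [errorBound]
  ring

end Model

end PGGM

/-! ### Coverings and sparsification of quadratic forms. -/

namespace PGGM

/-! ### Nets -/

section Net

open Metric Module Set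

/-- A `1/4`-separated subset of the unit ball has at most `9 ^ d` points. -/
lemma card_le_of_quarter_separated {E : Type*} [NormedAddCommGroup E] [NormedSpace ℝ E]
    [FiniteDimensional ℝ E] (s : Finset E) (hs : ∀ c ∈ s, ‖c‖ ≤ 1)
    (h : ∀ c ∈ s, ∀ d ∈ s, c ≠ d → 1 / 4 ≤ ‖c - d‖) : s.card ≤ 9 ^ finrank ℝ E := by
  borelize E
  let μ : Measure E := Measure.addHaar
  -- Disjoint balls of radius 1/8 fit into a ball of radius 9/8; the volume ratio is 9 ^ d.
  have D : Set.Pairwise (s : Set E) (Function.onFun Disjoint fun c => ball (c : E) (1 / 8)) := by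
    rintro c hc d hd hcd
    apply ball_disjoint_ball
    rw [dist_eq_norm]
    exact le_trans (by norm_num) (h c hc d hd hcd)
  have hsub : (⋃ c ∈ s, ball (c : E) (1 / 8)) ⊆ ball (0 : E) (9 / 8) := by
    refine iUnion₂_subset fun x hx => ball_subset_ball' ?_
    rw [dist_zero_right]
    linarith [hs x hx]
  have I : (s.card : ENNReal) * ENNReal.ofReal ((1 / 8 : ℝ) ^ finrank ℝ E) * μ (ball 0 1) ≤
      ENNReal.ofReal ((9 / 8 : ℝ) ^ finrank ℝ E) * μ (ball 0 1) :=
    calc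
      (s.card : ENNReal) * ENNReal.ofReal ((1 / 8 : ℝ) ^ finrank ℝ E) * μ (ball 0 1)
          = μ (⋃ c ∈ s, ball (c : E) (1 / 8)) := by
        rw [measure_biUnion_finset D fun c _ => measurableSet_ball]
        simp only [μ.addHaar_ball_of_pos _ (by norm_num : (0 : ℝ) < 1 / 8), Finset.sum_const,
          nsmul_eq_mul, mul_assoc]
      _ ≤ μ (ball (0 : E) (9 / 8)) := measure_mono hsub
      _ = _ := by rw [μ.addHaar_ball_of_pos _ (by norm_num)]
  have J : (s.card : ENNReal) * ENNReal.ofReal ((1 / 8 : ℝ) ^ finrank ℝ E) ≤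
      ENNReal.ofReal ((9 / 8 : ℝ) ^ finrank ℝ E) :=
    (ENNReal.mul_le_mul_iff_left (measure_ball_pos _ _ zero_lt_one).ne' measure_ball_lt_top.ne).1 I
  have K : (s.card : ℝ) ≤ (9 : ℝ) ^ finrank ℝ E := by
    have := ENNReal.toReal_le_of_le_ofReal (by positivity) J
    rw [ENNReal.toReal_mul, ENNReal.toReal_ofReal (by positivity), ENNReal.toReal_natCast,
      div_pow, div_pow, one_pow, mul_one_div] at this
    exact (div_le_div_iff_of_pos_right (by positivity)).1 this
  exact_mod_cast K

/-- A separated set of maximal cardinality is a net: an uncovered point could be added to it. -/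
lemma exists_quarter_net (E : Type*) [NormedAddCommGroup E] [NormedSpace ℝ E]
    [FiniteDimensional ℝ E] :
    ∃ N : Finset E, N.card ≤ 9 ^ finrank ℝ E ∧ (∀ y ∈ N, ‖y‖ ≤ 1) ∧
      ∀ x : E, ‖x‖ ≤ 1 → ∃ y ∈ N, ‖x - y‖ ≤ 1 / 4 := by
  classical
  let P : Finset E → Prop := fun s => (∀ c ∈ s, ‖c‖ ≤ 1) ∧
    ∀ c ∈ s, ∀ d ∈ s, c ≠ d → 1 / 4 ≤ ‖c - d‖
  let C : Set ℕ := {k | ∃ s : Finset E, P s ∧ s.card = k}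
  have hne : C.Nonempty := ⟨0, ∅, ⟨by simp, by simp⟩, rfl⟩
  have hbd : BddAbove C := ⟨9 ^ finrank ℝ E, by
    rintro _ ⟨s, hs, rfl⟩
    exact card_le_of_quarter_separated s hs.1 hs.2⟩
  obtain ⟨N, hN, hcard⟩ := Nat.sSup_mem hne hbd
  refine ⟨N, card_le_of_quarter_separated N hN.1 hN.2, hN.1, fun x hx => ?_⟩
  by_contra! hc
  have hxN : x ∉ N := fun hxN => by
    have := hc x hxN
    rw [sub_self, norm_zero] at this
    norm_num at this
  have hP : P (insert x N) := by
    refine ⟨fun c hcm => ?_, fun c hcm d hdm hcd => ?_⟩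
    · rcases Finset.mem_insert.1 hcm with rfl | hcm
      · exact hx
      · exact hN.1 c hcm
    · rcases Finset.mem_insert.1 hcm with hc' | hc' <;>
        rcases Finset.mem_insert.1 hdm with hd' | hd'
      · exact absurd (hc'.trans hd'.symm) hcd
      · rw [hc']; exact (hc d hd').le
      · rw [hd', norm_sub_rev]; exact (hc c hc').le
      · exact hN.2 c hc' d hd' hcd
  have := le_csSup hbd ⟨_, hP, rfl⟩
  rw [Finset.card_insert_of_notMem hxN, hcard] at this
  omega

variable {m : Type*} [Fintype m] [DecidableEq m]

/-- A net of the unit ball of a subspace for the norm of a positive definite matrix. -/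
lemma exists_net_of_posDef {A : Matrix m m ℝ} (hA : A.PosDef) (F : Submodule ℝ (m → ℝ)) :
    ∃ N : Finset (m → ℝ), N.card ≤ 9 ^ finrank ℝ F ∧ (∀ y ∈ N, y ∈ F ∧ y ⬝ᵥ A *ᵥ y ≤ 1) ∧
      ∀ x ∈ F, x ⬝ᵥ A *ᵥ x ≤ 1 → ∃ y ∈ N, (x - y) ⬝ᵥ A *ᵥ (x - y) ≤ 1 / 16 := by
  classical
  obtain ⟨C, hC⟩ := exists_eq_transpose_mul_self hA.posSemidef
  -- Writing A = CᵗC makes x ↦ Cx isometric from the A-norm to the Euclidean norm. The net is found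
  -- in the image of F and pulled back.
  let φ : (m → ℝ) →ₗ[ℝ] EuclideanSpace ℝ m :=
    (WithLp.linearEquiv 2 ℝ (m → ℝ)).symm.toLinearMap ∘ₗ C.mulVecLin
  have hφ : ∀ x, ‖φ x‖ ^ 2 = x ⬝ᵥ A *ᵥ x := by
    intro x
    have e : x ⬝ᵥ A *ᵥ x = (C *ᵥ x) ⬝ᵥ (C *ᵥ x) := by
      rw [hC, ← mulVec_mulVec, dotProduct_mulVec, vecMul_transpose]
    rw [EuclideanSpace.real_norm_sq_eq, e, dotProduct]
    exact Finset.sum_congr rfl fun i _ => sq _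
  obtain ⟨N, hcard, hN, hnet⟩ := exists_quarter_net (F.map φ)
  have hpre : ∀ y : F.map φ, ∃ x ∈ F, φ x = y := fun y => Submodule.mem_map.1 y.2
  choose g hgF hg using hpre
  refine ⟨N.image g, Finset.card_image_le.trans (hcard.trans
    (Nat.pow_le_pow_right (by norm_num) (Submodule.finrank_map_le φ F))), ?_, ?_⟩
  · intro x hx
    obtain ⟨y, hy, rfl⟩ := Finset.mem_image.1 hx
    refine ⟨hgF y, ?_⟩
    rw [← hφ, hg]
    exact pow_le_one₀ (norm_nonneg _) (hN y hy)
  · intro x hx hx1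
    rw [← hφ] at hx1
    obtain ⟨y, hy, hxy⟩ := hnet ⟨φ x, Submodule.mem_map_of_mem hx⟩
      ((pow_le_one_iff_of_nonneg (norm_nonneg _) two_ne_zero).1 hx1)
    refine ⟨g y, Finset.mem_image_of_mem g hy, ?_⟩
    rw [← hφ, map_sub, hg]
    calc ‖φ x - (y : EuclideanSpace ℝ m)‖ ^ 2 ≤ (1 / 4) ^ 2 :=
          pow_le_pow_left₀ (norm_nonneg _) hxy 2
      _ = 1 / 16 := by norm_num

end Net

/-! ### Quadratic forms on nets -/

section Quad

variable {m : Type*} [Fintype m]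

lemma quad_add (D : Matrix m m ℝ) (x y : m → ℝ) :
    (x + y) ⬝ᵥ D *ᵥ (x + y) = x ⬝ᵥ D *ᵥ x + x ⬝ᵥ D *ᵥ y + y ⬝ᵥ D *ᵥ x + y ⬝ᵥ D *ᵥ y := by
  simp only [mulVec_add, add_dotProduct, dotProduct_add]; ring

lemma quad_sub (D : Matrix m m ℝ) (x y : m → ℝ) :
    (x - y) ⬝ᵥ D *ᵥ (x - y) = x ⬝ᵥ D *ᵥ x - x ⬝ᵥ D *ᵥ y - y ⬝ᵥ D *ᵥ x + y ⬝ᵥ D *ᵥ y := by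
  simp only [mulVec_sub, sub_dotProduct, dotProduct_sub]; ring

lemma quad_smul (D : Matrix m m ℝ) (c : ℝ) (x : m → ℝ) :
    (c • x) ⬝ᵥ D *ᵥ (c • x) = c ^ 2 * (x ⬝ᵥ D *ᵥ x) := by
  simp only [mulVec_smul, smul_dotProduct, dotProduct_smul, smul_eq_mul]; ring

lemma bilin_comm {D : Matrix m m ℝ} (hD : Dᵀ = D) (x y : m → ℝ) :
    x ⬝ᵥ D *ᵥ y = y ⬝ᵥ D *ᵥ x := by
  rw [dotProduct_mulVec, ← mulVec_transpose, hD, dotProduct_comm]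

lemma exists_abs_quad_le [DecidableEq m] {A D : Matrix m m ℝ} (hA : A.PosDef) (hD : Dᵀ = D) :
    ∃ K : ℝ, 0 ≤ K ∧ ∀ x : m → ℝ, |x ⬝ᵥ D *ᵥ x| ≤ K * (x ⬝ᵥ A *ᵥ x) := by
  obtain ⟨C, ν, -, hAC, hDC⟩ := exists_simultaneous_diagonal (U := D) hA
    (by rw [IsHermitian, conjTranspose_eq_transpose_of_trivial, hD])
  have hν : ∀ i, |ν i| ≤ ∑ j, |ν j| := fun i =>
    Finset.single_le_sum (f := fun j => |ν j|) (fun _ _ => abs_nonneg _) (Finset.mem_univ i)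
  refine ⟨∑ i, |ν i|, Finset.sum_nonneg fun _ _ => abs_nonneg _, fun x => ?_⟩
  have e1 : x ⬝ᵥ A *ᵥ x = ∑ i, (C *ᵥ x) i ^ 2 := by
    rw [hAC, ← mulVec_mulVec, dotProduct_mulVec, vecMul_transpose, dotProduct]
    simp [sq]
  have e2 : x ⬝ᵥ D *ᵥ x = ∑ i, ν i * (C *ᵥ x) i ^ 2 := by
    rw [hDC, Matrix.mul_assoc, ← mulVec_mulVec, dotProduct_mulVec, vecMul_transpose,
      ← mulVec_mulVec, dotProduct]
    refine Finset.sum_congr rfl fun i _ => ?_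
    rw [mulVec_diagonal]; ring
  rw [e1, e2, Finset.mul_sum]
  refine (Finset.abs_sum_le_sum_abs _ _).trans (Finset.sum_le_sum fun i _ => ?_)
  rw [abs_mul, abs_of_nonneg (sq_nonneg ((C *ᵥ x) i))]
  exact mul_le_mul_of_nonneg_right (hν i) (sq_nonneg _)

/-- Polarization followed by the parallelogram identity for A. -/
lemma abs_bilin_le {A D : Matrix m m ℝ} (hD : Dᵀ = D) {F : Submodule ℝ (m → ℝ)}
    {K : ℝ} (hK : ∀ x ∈ F, |x ⬝ᵥ D *ᵥ x| ≤ K * (x ⬝ᵥ A *ᵥ x)) {x y : m → ℝ} (hx : x ∈ F)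
    (hy : y ∈ F) : |x ⬝ᵥ D *ᵥ y| ≤ K / 2 * (x ⬝ᵥ A *ᵥ x + y ⬝ᵥ A *ᵥ y) := by
  have h1 := abs_le.1 (hK _ (F.add_mem hx hy))
  have h2 := abs_le.1 (hK _ (F.sub_mem hx hy))
  rw [quad_add, quad_add] at h1
  rw [quad_sub, quad_sub] at h2
  have h3 := bilin_comm hD x y
  rw [abs_le]
  constructor <;> nlinarith [h1.1, h1.2, h2.1, h2.2]

/-- Control of a quadratic form on a net of a subspace controls it on the subspace. -/
lemma abs_quad_le_of_net [DecidableEq m] {A D : Matrix m m ℝ} (hA : A.PosDef) (hD : Dᵀ = D)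
    {F : Submodule ℝ (m → ℝ)} {N : Finset (m → ℝ)} (hN : ∀ y ∈ N, y ∈ F ∧ y ⬝ᵥ A *ᵥ y ≤ 1)
    (hnet : ∀ x ∈ F, x ⬝ᵥ A *ᵥ x ≤ 1 → ∃ y ∈ N, (x - y) ⬝ᵥ A *ᵥ (x - y) ≤ 1 / 16)
    (hDN : ∀ y ∈ N, |y ⬝ᵥ D *ᵥ y| ≤ 1 / 8 * (y ⬝ᵥ A *ᵥ y)) :
    ∀ x ∈ F, |x ⬝ᵥ D *ᵥ x| ≤ 1 / 4 * (x ⬝ᵥ A *ᵥ x) := by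
  have hA0 : ∀ x : m → ℝ, 0 ≤ x ⬝ᵥ A *ᵥ x := quad_nonneg hA.posSemidef
  -- The best constant K on F is attained. Passing from a unit vector to the net shows K ≤ 1/8 +
  -- K/2, that is K ≤ 1/4.
  let C : Set ℝ := {K | 0 ≤ K ∧ ∀ x ∈ F, |x ⬝ᵥ D *ᵥ x| ≤ K * (x ⬝ᵥ A *ᵥ x)}
  have hne : C.Nonempty := by
    obtain ⟨K, h0, hK⟩ := exists_abs_quad_le hA hD
    exact ⟨K, h0, fun x _ => hK x⟩
  have hbd : BddBelow C := ⟨0, fun K hK => hK.1⟩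
  have hmem : sInf C ∈ C := by
    refine IsClosed.csInf_mem ?_ hne hbd
    have e : C = Set.Ici 0 ∩ ⋂ x ∈ F, {K : ℝ | |x ⬝ᵥ D *ᵥ x| ≤ K * (x ⬝ᵥ A *ᵥ x)} := by
      ext K; simp [C]
    rw [e]
    refine isClosed_Ici.inter (isClosed_biInter fun x _ => ?_)
    exact isClosed_le continuous_const (continuous_id.mul continuous_const)
  set K := sInf C with hKdef
  obtain ⟨hK0, hK⟩ := hmem
  have hunit : ∀ x ∈ F, x ⬝ᵥ A *ᵥ x ≤ 1 → |x ⬝ᵥ D *ᵥ x| ≤ 1 / 8 + K / 2 := by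
    intro x hx hx1
    obtain ⟨y, hy, hxy⟩ := hnet x hx hx1
    obtain ⟨hyF, hy1⟩ := hN y hy
    have h1 := hDN y hy
    -- The scalings 4 and 1/2 balance ‖x - y‖² ≤ 1/16 against ‖x + y‖² ≤ 4 in the A-norm: both
    -- scaled vectors have norm at most 1.
    have h2 := abs_bilin_le hD hK (F.smul_mem 4 (F.sub_mem hx hyF))
      (F.smul_mem (1 / 2) (F.add_mem hx hyF))
    rw [quad_smul, quad_smul] at h2
    have hp : (x + y) ⬝ᵥ A *ᵥ (x + y) ≤ 4 := by
      have h3 := hA0 (x - y)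
      rw [quad_sub] at h3
      rw [quad_add]
      linarith
    have e1 : (4 : ℝ) • (x - y) ⬝ᵥ D *ᵥ ((1 / 2 : ℝ) • (x + y))
        = 2 * (x ⬝ᵥ D *ᵥ x - y ⬝ᵥ D *ᵥ y) := by
      simp only [mulVec_smul, smul_dotProduct, dotProduct_smul, smul_eq_mul, mulVec_add,
        sub_dotProduct, dotProduct_add]
      rw [bilin_comm hD y x]; ring
    rw [e1] at h2
    have h4 : K / 2 * (4 ^ 2 * ((x - y) ⬝ᵥ A *ᵥ (x - y))
        + (1 / 2) ^ 2 * ((x + y) ⬝ᵥ A *ᵥ (x + y))) ≤ K / 2 * 2 :=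
      mul_le_mul_of_nonneg_left (by linarith) (by linarith)
    have h5 := abs_le.1 (h2.trans h4)
    have h6 := abs_le.1 h1
    rw [abs_le]
    constructor <;> linarith [h5.1, h5.2, h6.1, h6.2]
  have hle : K ≤ 1 / 8 + K / 2 := by
    refine csInf_le hbd ⟨by linarith, fun x hx => ?_⟩
    rcases (hA0 x).eq_or_lt with h0 | h0
    · have := hK x hx
      rw [← h0] at this ⊢
      simpa using this
    · set t := √(x ⬝ᵥ A *ᵥ x) with ht
      have ht0 : 0 < t := Real.sqrt_pos.2 h0
      have htt : t ^ 2 = x ⬝ᵥ A *ᵥ x := Real.sq_sqrt h0.le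
      have h1 := hunit (t⁻¹ • x) (F.smul_mem _ hx) (by
        rw [quad_smul, ← htt, inv_pow, inv_mul_cancel₀ (by positivity)])
      rw [quad_smul, abs_mul, abs_of_nonneg (by positivity), inv_pow, htt,
        inv_mul_le_iff₀ h0] at h1
      linarith
  intro x hx
  exact (hK x hx).trans (mul_le_mul_of_nonneg_right (by linarith) (hA0 x))

/-! ### From sparse to general vectors -/

/-- Empirical method of Maurey: nonnegativity of a quadratic form on sums of `k` atoms. -/
lemma quad_nonneg_of_atoms {ι : Type*} [Fintype ι] (Q : Matrix m m ℝ) (w : ι → ℝ)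
    (hw0 : ∀ i, 0 ≤ w i) (hw1 : ∑ i, w i = 1) (x : ι → m → ℝ) (k : ℕ) (u : m → ℝ)
    (h : ∀ f : Fin k → ι, 0 ≤ (u + ∑ i, x (f i)) ⬝ᵥ Q *ᵥ (u + ∑ i, x (f i))) :
    0 ≤ (u + (k : ℝ) • ∑ i, w i • x i) ⬝ᵥ Q *ᵥ (u + (k : ℝ) • ∑ i, w i • x i)
      + k * (∑ i, w i * (x i ⬝ᵥ Q *ᵥ x i)
        - (∑ i, w i • x i) ⬝ᵥ Q *ᵥ (∑ i, w i • x i)) := by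
  induction k generalizing u with
  | zero => simpa using h Fin.elim0
  | succ k ih =>
    -- One atom at a time is moved into the shift and averaged with the weights w; each averaging
    -- replaces the atom by its mean v and adds one variance D.
    set v := ∑ i, w i • x i with hv
    set D := ∑ i, w i * (x i ⬝ᵥ Q *ᵥ x i) - v ⬝ᵥ Q *ᵥ v with hD
    have h1 : ∀ i, 0 ≤ (u + x i + (k : ℝ) • v) ⬝ᵥ Q *ᵥ (u + x i + (k : ℝ) • v) + k * D := by
      intro i
      refine ih (u + x i) fun f => ?_
      have := h (Fin.cons i f)
      rw [Fin.sum_univ_succ] at this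
      simp only [Fin.cons_zero, Fin.cons_succ] at this
      rwa [← add_assoc] at this
    have h2 : 0 ≤ ∑ i, w i * ((u + x i + (k : ℝ) • v) ⬝ᵥ Q *ᵥ (u + x i + (k : ℝ) • v) + k * D) :=
      Finset.sum_nonneg fun i _ => mul_nonneg (hw0 i) (h1 i)
    refine h2.trans (le_of_eq ?_)
    set y := u + (k : ℝ) • v with hy
    have e1 : ∀ i, u + x i + (k : ℝ) • v = y + x i := fun i => by rw [hy]; abel
    have e2 : u + ((k + 1 : ℕ) : ℝ) • v = y + v := by
      rw [hy, Nat.cast_succ, add_smul, one_smul, add_assoc]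
    have e3 : y ⬝ᵥ Q *ᵥ v = ∑ i, w i * (y ⬝ᵥ Q *ᵥ x i) := by
      rw [hv, mulVec_sum, dotProduct_sum]
      exact Finset.sum_congr rfl fun i _ => by rw [mulVec_smul, dotProduct_smul, smul_eq_mul]
    have e4 : v ⬝ᵥ Q *ᵥ y = ∑ i, w i * (x i ⬝ᵥ Q *ᵥ y) := by
      rw [hv, sum_dotProduct]
      exact Finset.sum_congr rfl fun i _ => by rw [smul_dotProduct, smul_eq_mul]
    have e5 : ∑ i, w i * ((u + x i + (k : ℝ) • v) ⬝ᵥ Q *ᵥ (u + x i + (k : ℝ) • v) + k * D)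
        = (∑ i, w i) * (y ⬝ᵥ Q *ᵥ y + k * D) + ∑ i, w i * (y ⬝ᵥ Q *ᵥ x i)
          + ∑ i, w i * (x i ⬝ᵥ Q *ᵥ y) + ∑ i, w i * (x i ⬝ᵥ Q *ᵥ x i) := by
      rw [Finset.sum_mul, ← Finset.sum_add_distrib, ← Finset.sum_add_distrib,
        ← Finset.sum_add_distrib]
      refine Finset.sum_congr rfl fun i _ => ?_
      rw [e1, quad_add]; ring
    rw [e5, e2, quad_add Q y v, hw1, ← e3, ← e4, Nat.cast_succ]
    have e6 : ∑ i, w i * (x i ⬝ᵥ Q *ᵥ x i) = D + v ⬝ᵥ Q *ᵥ v := by rw [hD]; ring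
    rw [e6]
    ring

/-- A quadratic form that is nonnegative on `k`-sparse vectors. -/
lemma quad_ge_of_sparse [DecidableEq m] {Q : Matrix m m ℝ} {k : ℕ} (hk : 2 ≤ k) {c : ℝ}
    (hc : ∀ j, Q j j ≤ c)
    (h : ∀ (f : Fin k → m) (a : Fin k → ℝ),
      0 ≤ (∑ i, a i • Pi.single (f i) (1 : ℝ)) ⬝ᵥ Q *ᵥ (∑ i, a i • Pi.single (f i) (1 : ℝ)))
    (v : m → ℝ) : -(c * (∑ j, |v j|) ^ 2 / (k - 1)) ≤ v ⬝ᵥ Q *ᵥ v := by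
  set l := ∑ j, |v j| with hl
  have hl0 : 0 ≤ l := Finset.sum_nonneg fun _ _ => abs_nonneg _
  rcases hl0.eq_or_lt with h0 | h0
  · have : v = 0 := by
      funext j
      have := (Finset.sum_eq_zero_iff_of_nonneg fun _ _ => abs_nonneg _).1 h0.symm j
        (Finset.mem_univ j)
      simpa using this
    rw [← h0, this]; simp
  have hw1 : ∑ j, |v j| / l = 1 := by rw [← Finset.sum_div, ← hl, div_self h0.ne']
  have hvs : ∑ j, (|v j| / l) • ((l * SignType.sign (v j)) • Pi.single (M := fun _ => ℝ) j (1 : ℝ))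
      = v := by
    have e : ∀ j, (|v j| / l) • ((l * SignType.sign (v j)) • Pi.single (M := fun _ => ℝ) j (1 : ℝ))
        = Pi.single (M := fun _ => ℝ) j (v j) := by
      intro j
      rw [smul_smul, ← Pi.single_smul]
      congr 1
      have h1 : |v j| / l * (l * (SignType.sign (v j) : ℝ)) = v j := by
        calc |v j| / l * (l * (SignType.sign (v j) : ℝ))
            = (SignType.sign (v j) : ℝ) * |v j| := by field_simp
          _ = v j := sign_mul_abs _
      rw [h1, smul_eq_mul, mul_one]
    simp only [e]
    exact Finset.univ_sum_single v
  -- Here v is the mean of the signed atoms l·sign(v_j)e_j. The averaged inequality reads k²·vᵗQv +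
  -- k(c l² - vᵗQv) ≥ 0; dividing by k produces the factor k - 1.
  have key := quad_nonneg_of_atoms Q (fun j => |v j| / l) (fun j => by positivity) hw1
    (fun j => (l * SignType.sign (v j)) • Pi.single (M := fun _ => ℝ) j (1 : ℝ)) k 0 (fun f => by
      rw [zero_add]
      exact h f fun i => l * SignType.sign (v (f i)))
  rw [hvs, zero_add, quad_smul] at key
  have hD : ∑ j, |v j| / l * (((l * SignType.sign (v j)) • Pi.single (M := fun _ => ℝ) j (1 : ℝ))
      ⬝ᵥ Q *ᵥ ((l * SignType.sign (v j)) • Pi.single (M := fun _ => ℝ) j (1 : ℝ))) ≤ c * l ^ 2 := by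
    have e : ∀ j, |v j| / l * (((l * SignType.sign (v j)) • Pi.single (M := fun _ => ℝ) j (1 : ℝ))
        ⬝ᵥ Q *ᵥ ((l * SignType.sign (v j)) • Pi.single (M := fun _ => ℝ) j (1 : ℝ)))
        ≤ |v j| * (l * c) := by
      intro j
      rw [quad_smul]
      have e1 : Pi.single (M := fun _ => ℝ) j (1 : ℝ) ⬝ᵥ Q *ᵥ Pi.single (M := fun _ => ℝ) j (1 : ℝ)
          = Q j j := by simp
      rw [e1]
      rcases eq_or_ne (v j) 0 with hv | hv
      · simp [hv]
      have hs : (SignType.sign (v j) : ℝ) ^ 2 = 1 := by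
        rcases hv.lt_or_gt with h' | h' <;> simp [h']
      calc |v j| / l * ((l * (SignType.sign (v j) : ℝ)) ^ 2 * Q j j) = |v j| * (l * Q j j) := by
            rw [mul_pow, hs]; field_simp
        _ ≤ _ := by
          have := hc j
          gcongr
    refine (Finset.sum_le_sum fun j _ => e j).trans (le_of_eq ?_)
    rw [← Finset.sum_mul, ← hl]; ring
  have hk2 : (2 : ℝ) ≤ k := by exact_mod_cast hk
  have hk1 : (0 : ℝ) < k - 1 := by linarith
  rw [neg_le_iff_add_nonneg', div_add' _ _ _ hk1.ne']
  refine div_nonneg ?_ hk1.le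
  have hk0 : (0 : ℝ) < k := by linarith
  have h3 : 0 ≤ (k : ℝ) * ((v ⬝ᵥ Q *ᵥ v) * (k - 1) + c * l ^ 2) := by nlinarith
  have := nonneg_of_mul_nonneg_right h3 hk0
  linarith

end Quad

end PGGM

namespace PGGM

/-! ### Concentration of the sample variance -/

section Tail

lemma integral_exp_mul_sq_gaussian {t : ℝ} (ht : t < 1 / 2) :
    ∫ x, Real.exp (t * x ^ 2) ∂(gaussianReal 0 1) = (√(1 - 2 * t))⁻¹ := by
  rw [integral_gaussianReal_eq_integral_smul one_ne_zero]
  have e : ∀ x : ℝ, gaussianPDFReal 0 1 x • Real.exp (t * x ^ 2)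
      = (√(2 * Real.pi))⁻¹ * Real.exp (-(1 / 2 - t) * x ^ 2) := by
    intro x
    rw [gaussianPDFReal, smul_eq_mul, mul_assoc, ← Real.exp_add]
    simp only [NNReal.coe_one, mul_one, sub_zero]
    congr 2
    ring
  simp only [e]
  rw [integral_const_mul, integral_gaussian, ← Real.sqrt_inv, ← Real.sqrt_mul (by positivity),
    ← Real.sqrt_inv]
  congr 1
  have h1 : (1 / 2 - t) ≠ 0 := by linarith
  have h2 : (1 - 2 * t) ≠ 0 := by linarith
  have := Real.pi_ne_zero
  field_simp

/-- A subgaussian bound, with mean removed, of the moment generating function of one squared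
standard Gaussian near 0; it serves both tails. -/
lemma inv_sqrt_le_exp {t : ℝ} (h : |t| ≤ 1 / 3) :
    (√(1 - 2 * t))⁻¹ ≤ Real.exp (t + 3 * t ^ 2) := by
  obtain ⟨h1, h2⟩ := abs_le.1 h
  have hpos : 0 < 1 - 2 * t := by linarith
  have e : (√(1 - 2 * t))⁻¹ = Real.exp (-(Real.log (1 - 2 * t) / 2)) := by
    rw [← Real.log_sqrt hpos.le, Real.exp_neg, Real.exp_log (Real.sqrt_pos.2 hpos)]
  rw [e, Real.exp_le_exp]
  rcases le_total 0 t with h0 | h0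
  · have h3 := log_le_half_sub_inv (t := (1 - 2 * t)⁻¹) ((one_le_inv₀ hpos).2 (by linarith))
    rw [Real.log_inv, inv_inv] at h3
    have h4 : ((1 - 2 * t)⁻¹ - (1 - 2 * t)) / 2 ≤ 2 * (t + 3 * t ^ 2) := by
      have h5 : (1 - 2 * t)⁻¹ - (1 - 2 * t) = 4 * t * (1 - t) / (1 - 2 * t) := by
        field_simp; ring
      rw [h5, div_div, div_le_iff₀ (by linarith)]
      nlinarith [mul_nonneg (sq_nonneg t) (by linarith : 0 ≤ 1 - 3 * t)]
    linarith
  · have h3 := Real.le_log_one_add_of_nonneg (x := -(2 * t)) (by linarith)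
    rw [← sub_eq_add_neg] at h3
    have h4 : -(2 * (t + 3 * t ^ 2)) ≤ 2 * -(2 * t) / (-(2 * t) + 2) := by
      rw [le_div_iff₀ (by linarith)]
      nlinarith [mul_nonneg (sq_nonneg t) (by linarith : 0 ≤ -t)]
    linarith

variable {Ω : Type*} [MeasurableSpace Ω] {P : Measure Ω} {n : ℕ}

/-- The moment generating function of a chi-squared variable. -/
lemma mgf_sum_sq {X : Fin n → Ω → ℝ} (hX : ∀ i, HasLaw (X i) (gaussianReal 0 1) P)
    (hi : iIndepFun X P) {t : ℝ} (ht : t < 1 / 2) :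
    mgf (∑ i, fun ω => X i ω ^ 2) P t = ((√(1 - 2 * t))⁻¹) ^ n := by
  have hi2 : iIndepFun (fun i ω => X i ω ^ 2) P :=
    hi.comp (fun _ x => x ^ 2) fun _ => measurable_id.pow_const 2
  rw [hi2.mgf_sum₀ fun i => (hX i).aemeasurable.pow_const 2]
  have : ∀ i, mgf (fun ω => X i ω ^ 2) P t = (√(1 - 2 * t))⁻¹ := by
    intro i
    rw [mgf, ← integral_exp_mul_sq_gaussian ht, ← (hX i).integral_comp]
    · rfl
    · exact (by fun_prop : Measurable fun x : ℝ => Real.exp (t * x ^ 2)).aestronglyMeasurable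
  simp [this]

/-- The integral of a non-integrable function is 0 by convention, so a nonzero value certifies
integrability. -/
lemma integrable_of_mgf_ne_zero {X : Ω → ℝ} {t : ℝ} (h : mgf X P t ≠ 0) :
    Integrable (fun ω => Real.exp (t * X ω)) P := by
  by_contra hc
  exact h (integral_undef hc)

/-- Chernoff's bound at t = ±u/3 gives the exponent n(u²/3 - 4u²/3) = -nu² in both directions. The
restriction u ≤ 1 keeps t within the range of `inv_sqrt_le_exp`. -/
lemma chiSq_tail [IsProbabilityMeasure P] {X : Fin n → Ω → ℝ} (hX : ∀ i, HasLaw (X i) (gaussianReal 0 1) P)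
    (hi : iIndepFun X P) {u : ℝ} (hu0 : 0 ≤ u) (hu1 : u ≤ 1) :
    P.real {ω | 4 * u * n < |∑ i, X i ω ^ 2 - n|} ≤ 2 * Real.exp (-(n * u ^ 2)) := by
  set Y : Ω → ℝ := ∑ i, fun ω => X i ω ^ 2 with hY
  have hYω : ∀ ω, Y ω = ∑ i, X i ω ^ 2 := fun ω => by rw [hY, Finset.sum_apply]
  have hn : (0 : ℝ) ≤ n := Nat.cast_nonneg n
  have bound : ∀ t : ℝ, |t| ≤ 1 / 3 → mgf Y P t ≤ Real.exp (n * (t + 3 * t ^ 2)) ∧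
      Integrable (fun ω => Real.exp (t * Y ω)) P := by
    intro t ht
    have ht' : t < 1 / 2 := lt_of_le_of_lt ((le_abs_self t).trans ht) (by norm_num)
    have h1 := mgf_sum_sq hX hi ht'
    refine ⟨?_, integrable_of_mgf_ne_zero ?_⟩
    · rw [h1, Real.exp_nat_mul]
      exact pow_le_pow_left₀ (by positivity) (inv_sqrt_le_exp ht) n
    · rw [h1]
      have : 0 < 1 - 2 * t := by linarith
      positivity
  have habs : |u / 3| ≤ 1 / 3 := by rw [abs_of_nonneg (by positivity)]; linarith
  have habs' : |-(u / 3)| ≤ 1 / 3 := by rwa [abs_neg]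
  have up : P.real {ω | n + 4 * u * n ≤ Y ω} ≤ Real.exp (-(n * u ^ 2)) := by
    obtain ⟨h1, h2⟩ := bound _ habs
    refine (measure_ge_le_exp_mul_mgf _ (by positivity) h2).trans ?_
    refine (mul_le_mul_of_nonneg_left h1 (Real.exp_pos _).le).trans ?_
    rw [← Real.exp_add, Real.exp_le_exp]
    apply le_of_eq
    ring
  have low : P.real {ω | Y ω ≤ n - 4 * u * n} ≤ Real.exp (-(n * u ^ 2)) := by
    obtain ⟨h1, h2⟩ := bound _ habs'
    refine (measure_le_le_exp_mul_mgf _ (by linarith) h2).trans ?_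
    refine (mul_le_mul_of_nonneg_left h1 (Real.exp_pos _).le).trans ?_
    rw [← Real.exp_add, Real.exp_le_exp]
    apply le_of_eq
    ring
  have hsub : {ω | 4 * u * n < |∑ i, X i ω ^ 2 - n|}
      ⊆ {ω | n + 4 * u * n ≤ Y ω} ∪ {ω | Y ω ≤ n - 4 * u * n} := by
    intro ω hω
    rw [Set.mem_ofPred_eq, lt_abs, ← hYω] at hω
    rcases hω with h | h
    · left; rw [Set.mem_ofPred_eq]; linarith
    · right; rw [Set.mem_ofPred_eq]; linarith
  calc P.real {ω | 4 * u * n < |∑ i, X i ω ^ 2 - n|}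
      ≤ P.real ({ω | n + 4 * u * n ≤ Y ω} ∪ {ω | Y ω ≤ n - 4 * u * n}) := measureReal_mono hsub
    _ ≤ _ := measureReal_union_le _ _
    _ ≤ _ := by linarith

variable {p q : ℕ}

/-- Linear functionals of a centered Gaussian vector. -/
lemma hasLaw_linear {Sig : Matrix (Fin q ⊕ Fin p) (Fin q ⊕ Fin p) ℝ} (hS : Sig.PosSemidef)
    {Z : Ω → EuclideanSpace ℝ (Fin q ⊕ Fin p)} (hZ : HasLaw Z (multivariateGaussian 0 Sig) P)
    (w : Fin q ⊕ Fin p → ℝ) :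
    HasLaw (fun ω => ∑ a, w a * Z ω a) (gaussianReal 0 (w ⬝ᵥ Sig *ᵥ w).toNNReal) P := by
  set L := innerSL ℝ (WithLp.toLp 2 w : EuclideanSpace ℝ (Fin q ⊕ Fin p)) with hL
  have hLz : ∀ z, L z = ∑ a, w a * z a := by
    intro z
    rw [hL, innerSL_apply_apply, PiLp.inner_apply]
    simp [mul_comm]
  have hmap : HasLaw L (gaussianReal 0 (w ⬝ᵥ Sig *ᵥ w).toNNReal) (multivariateGaussian 0 Sig) := by
    refine ⟨by fun_prop, ?_⟩
    rw [IsGaussian.map_eq_gaussianReal, ContinuousLinearMap.integral_comp_id_comm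
      IsGaussian.integrable_id]
    congr 2
    · simp
    · have h1 := covarianceBilin_self (μ := multivariateGaussian 0 Sig) IsGaussian.memLp_two_id
        (WithLp.toLp 2 w : EuclideanSpace ℝ (Fin q ⊕ Fin p))
      rw [covarianceBilin_multivariateGaussian hS] at h1
      exact h1.symm
  have := hmap.comp hZ
  convert this using 1
  funext ω
  rw [Function.comp_apply, hLz]

lemma sampleCov_transpose (z : Fin n → EuclideanSpace ℝ (Fin q ⊕ Fin p)) :
    (sampleCov z)ᵀ = sampleCov z := by
  ext a b
  simp only [sampleCov, Matrix.transpose_apply, Matrix.of_apply, mul_comm (z _ b)]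

lemma quad_sampleCov (z : Fin n → EuclideanSpace ℝ (Fin q ⊕ Fin p)) (w : Fin q ⊕ Fin p → ℝ) :
    w ⬝ᵥ sampleCov z *ᵥ w = 1 / (n : ℝ) * ∑ i, (∑ a, w a * z i a) ^ 2 := by
  have e : sampleCov z = (1 / (n : ℝ)) • ∑ i, vecMulVec (z i) (z i) := by
    ext a b
    simp [sampleCov, Matrix.sum_apply, vecMulVec_apply]
  rw [e, Matrix.smul_mulVec, dotProduct_smul, Matrix.sum_mulVec, dotProduct_sum, smul_eq_mul]
  congr 1
  refine Finset.sum_congr rfl fun i _ => ?_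
  rw [vecMulVec_mulVec, dotProduct_smul, sq, dotProduct_comm _ w]
  exact rfl

/-- Concentration of the empirical variance of a linear functional. -/
lemma sampleCov_tail [IsProbabilityMeasure P]
    {Sig : Matrix (Fin q ⊕ Fin p) (Fin q ⊕ Fin p) ℝ} (hS : Sig.PosDef)
    {Z : Fin n → Ω → EuclideanSpace ℝ (Fin q ⊕ Fin p)}
    (hZ : ∀ i, HasLaw (Z i) (multivariateGaussian 0 Sig) P) (hi : iIndepFun Z P)
    (hn : 0 < n) (w : Fin q ⊕ Fin p → ℝ) {u : ℝ} (hu0 : 0 ≤ u) (hu1 : u ≤ 1) :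
    P.real {ω | 4 * u * (w ⬝ᵥ Sig *ᵥ w)
        < |w ⬝ᵥ (sampleCov (fun i => Z i ω) - Sig) *ᵥ w|} ≤ 2 * Real.exp (-(n * u ^ 2)) := by
  rcases eq_or_ne w 0 with rfl | hw
  · simp [Real.exp_nonneg]
  have hv : 0 < w ⬝ᵥ Sig *ᵥ w := by simpa using hS.dotProduct_mulVec_pos hw
  set v := w ⬝ᵥ Sig *ᵥ w with hvdef
  have hX : ∀ i, HasLaw (fun ω => (∑ a, w a * Z i ω a) / √v) (gaussianReal 0 1) P := by
    intro i
    have h := gaussianReal_div_const (hasLaw_linear hS.posSemidef (hZ i) w) (√v)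
    convert h using 2
    · simp
    · rw [← hvdef]
      apply NNReal.eq
      simp [Real.sq_sqrt hv.le, hv.le, hv.ne']
  have hind : iIndepFun (fun i ω => (∑ a, w a * Z i ω a) / √v) P :=
    hi.comp (fun _ z => (∑ a, w a * z a) / √v) fun _ => by fun_prop
  refine le_trans (measureReal_mono fun ω hω => ?_) (chiSq_tail hX hind hu0 hu1)
  rw [Set.mem_ofPred_eq] at hω ⊢
  have hn' : (0 : ℝ) < n := by exact_mod_cast hn
  have e : w ⬝ᵥ (sampleCov (fun i => Z i ω) - Sig) *ᵥ w
      = v / n * (∑ i, ((∑ a, w a * Z i ω a) / √v) ^ 2 - n) := by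
    rw [sub_mulVec, dotProduct_sub, quad_sampleCov, ← hvdef]
    simp only [div_pow, Real.sq_sqrt hv.le]
    rw [← Finset.sum_div]
    field_simp
  rw [e, abs_mul, abs_of_pos (by positivity : 0 < v / n), div_mul_eq_mul_div, lt_div_iff₀ hn'] at hω
  refine lt_of_mul_lt_mul_left ?_ hv.le
  linarith

end Tail

end PGGM

namespace PGGM

/-! ### The favourable event -/

section Blocks

variable {p q : ℕ}

/-- The embedding of the coordinates of the predictor. -/
noncomputable def inrEmb (p q : ℕ) : (Fin p → ℝ) →ₗ[ℝ] (Fin q ⊕ Fin p → ℝ) where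
  toFun v := Sum.elim 0 v
  map_add' v w := by ext (i | i) <;> simp
  map_smul' c v := by ext (i | i) <;> simp

lemma bilin_inrEmb (D : Matrix (Fin q ⊕ Fin p) (Fin q ⊕ Fin p) ℝ) (v w : Fin p → ℝ) :
    inrEmb p q v ⬝ᵥ D *ᵥ inrEmb p q w = v ⬝ᵥ D.toBlocks₂₂ *ᵥ w := by
  simp [inrEmb, dotProduct, mulVec, toBlocks₂₂]

lemma toBlocks₂₂_sub (A B : Matrix (Fin q ⊕ Fin p) (Fin q ⊕ Fin p) ℝ) :
    (A - B).toBlocks₂₂ = A.toBlocks₂₂ - B.toBlocks₂₂ := rfl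

lemma quad_conj {k l : ℕ} (X : Matrix (Fin k) (Fin l) ℝ) (D : Matrix (Fin l) (Fin l) ℝ)
    (u : Fin k → ℝ) : (Xᵀ *ᵥ u) ⬝ᵥ D *ᵥ (Xᵀ *ᵥ u) = u ⬝ᵥ (X * D * Xᵀ) *ᵥ u := by
  rw [mulVec_transpose, ← dotProduct_mulVec, ← mulVec_transpose, mulVec_mulVec, mulVec_mulVec]

lemma sampleCov_toBlocks₂₂_posSemidef {n : ℕ} (z : Fin n → EuclideanSpace ℝ (Fin q ⊕ Fin p)) :
    (sampleCov z).toBlocks₂₂.PosSemidef := by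
  refine posSemidef_of_quad ?_ fun v => ?_
  · ext i j
    exact congrFun (congrFun (sampleCov_transpose z) (Sum.inr i)) (Sum.inr j)
  · rw [← bilin_inrEmb, quad_sampleCov]
    positivity

end Blocks

section Event

variable {Ω : Type*} [MeasurableSpace Ω] {P : Measure Ω} {n p q : ℕ}

lemma measureReal_iUnion_le_card_mul {ι : Type*} [Fintype ι] (B : ι → Set Ω) {c : ℝ}
    (h : ∀ i, P.real (B i) ≤ c) : P.real (⋃ i, B i) ≤ Fintype.card ι * c := by
  refine (measureReal_iUnion_fintype_le B).trans ((Finset.sum_le_sum fun i _ => h i).trans ?_)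
  simp

/-- Uniform relative concentration of the sample covariance on a subspace. -/
lemma subspace_tail [IsProbabilityMeasure P]
    {Sig : Matrix (Fin q ⊕ Fin p) (Fin q ⊕ Fin p) ℝ} (hS : Sig.PosDef)
    {Z : Fin n → Ω → EuclideanSpace ℝ (Fin q ⊕ Fin p)}
    (hZ : ∀ i, HasLaw (Z i) (multivariateGaussian 0 Sig) P) (hi : iIndepFun Z P) (hn : 0 < n)
    (F : Submodule ℝ (Fin q ⊕ Fin p → ℝ)) {d : ℕ} (hF : Module.finrank ℝ F ≤ d) :
    ∃ B : Set Ω, P.real B ≤ 9 ^ d * (2 * Real.exp (-(n / 1024))) ∧ ∀ ω ∉ B, ∀ x ∈ F,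
      |x ⬝ᵥ (sampleCov (fun i => Z i ω) - Sig) *ᵥ x| ≤ 1 / 4 * (x ⬝ᵥ Sig *ᵥ x) := by
  obtain ⟨N, hcard, hN, hnet⟩ := exists_net_of_posDef hS F
  -- The level u = 1/32 gives the accuracy 4u = 1/8 needed on the net, and u² = 1/1024 in the
  -- exponent.
  refine ⟨⋃ y : N, {ω | 4 * (1 / 32) * (y.1 ⬝ᵥ Sig *ᵥ y.1)
    < |y.1 ⬝ᵥ (sampleCov (fun i => Z i ω) - Sig) *ᵥ y.1|}, ?_, fun ω hω => ?_⟩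
  · have h0 := fun y : N => sampleCov_tail hS hZ hi hn y.1 (u := 1 / 32)
      (by norm_num) (by norm_num)
    refine (measureReal_iUnion_le_card_mul _ h0).trans ?_
    have h1 : (n : ℝ) * (1 / 32) ^ 2 = n / 1024 := by ring
    rw [h1]
    refine mul_le_mul_of_nonneg_right ?_ (by positivity)
    rw [Fintype.card_coe]
    exact_mod_cast hcard.trans (Nat.pow_le_pow_right (by norm_num) hF)
  · refine abs_quad_le_of_net hS ?_ hN hnet fun y hy => ?_
    · rw [transpose_sub, sampleCov_transpose, transpose_eq_of_isHermitian hS.1]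
    · by_contra hc
      refine hω (Set.mem_iUnion.2 ⟨⟨y, hy⟩, ?_⟩)
      rw [Set.mem_ofPred_eq]
      push Not at hc
      linarith

variable {M : Model p q}

/-- Only the directions Ω*_yxᵗu matter. They span a subspace of dimension at most q, so the net does
not see p. -/
lemma range_tail [IsProbabilityMeasure P] (hS : M.Sig.PosDef)
    {Z : Fin n → Ω → EuclideanSpace ℝ (Fin q ⊕ Fin p)}
    (hZ : ∀ i, HasLaw (Z i) (multivariateGaussian 0 M.Sig) P) (hi : iIndepFun Z P) (hn : 0 < n)
    (h : M.H1) :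
    ∃ B : Set Ω, P.real B ≤ 9 ^ q * (2 * Real.exp (-(n / 1024))) ∧
      ∀ ω ∉ B, M.RangeBound (sampleCov fun i => Z i ω) := by
  obtain ⟨B, hB, hω⟩ := subspace_tail hS hZ hi hn
    (LinearMap.range (inrEmb p q ∘ₗ M.Oyxᵀ.mulVecLin)) (d := q)
    ((LinearMap.finrank_range_le _).trans (by simp))
  refine ⟨B, hB, fun ω hωB => posSemidef_of_quad ?_ fun u => ?_⟩
  · have h1 := transpose_eq_of_isHermitian (sampleCov_toBlocks₂₂_posSemidef fun i => Z i ω).1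
    simp only [transpose_sub, transpose_smul, transpose_one, transpose_mul, transpose_transpose, h1,
      Matrix.mul_assoc]
  · have h1 := hω ω hωB _ (LinearMap.mem_range_self _ u)
    rw [LinearMap.comp_apply, mulVecLin_apply, bilin_inrEmb, bilin_inrEmb, toBlocks₂₂_sub,
      sub_mulVec, dotProduct_sub, quad_conj, quad_conj] at h1
    have h2 : u ⬝ᵥ (M.Oyx * M.Sxx * M.Oyxᵀ) *ᵥ u ≤ lamMax (M.Oyx * M.Sxx * M.Oyxᵀ) * (u ⬝ᵥ u) :=
      quad_le_lamMax (by
        have := isHermitian_mul_mul_conjTranspose M.Oyx h.Sxx_posDef.1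
        rwa [conjTranspose_eq_transpose_of_trivial] at this) u
    have h3 := (abs_le.1 h1).2
    rw [quad_smul_one_sub]
    rw [Model.Sxx] at h2
    rw [Model.Sxx]
    linarith

/-- The p ^ s coordinate choices, with repetition, are handled by a union bound. On their spans S_xx
- (3/4)Σ*_xx is nonnegative, and Maurey's method extends this to all vectors at the price of an ℓ¹
term. -/
lemma sparse_tail [IsProbabilityMeasure P] (hS : M.Sig.PosDef)
    {Z : Fin n → Ω → EuclideanSpace ℝ (Fin q ⊕ Fin p)}
    (hZ : ∀ i, HasLaw (Z i) (multivariateGaussian 0 M.Sig) P) (hi : iIndepFun Z P) (hn : 0 < n)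
    (h : M.H1) {s : ℕ} (hs : 2 ≤ s) :
    ∃ B : Set Ω, P.real B ≤ (9 * p) ^ s * (2 * Real.exp (-(n / 1024))) ∧
      ∀ ω ∉ B, M.SparseBound (sampleCov fun i => Z i ω) s := by
  have key := fun f : Fin s → Fin p => subspace_tail hS hZ hi hn
    (Submodule.span ℝ (Set.range fun k => inrEmb p q (Pi.single (f k) 1))) (d := s)
    ((finrank_range_le_card _).trans (by simp))
  choose B hB hω using key
  refine ⟨⋃ f, B f, (measureReal_iUnion_le_card_mul _ hB).trans (le_of_eq ?_), fun ω hωB v => ?_⟩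
  · rw [Fintype.card_fun, Fintype.card_fin, Fintype.card_fin, mul_pow]
    push_cast
    ring
  have hgood : ∀ (f : Fin s → Fin p) (a : Fin s → ℝ),
      |(∑ i, a i • Pi.single (f i) (1 : ℝ)) ⬝ᵥ ((sampleCov fun i => Z i ω).toBlocks₂₂ - M.Sxx) *ᵥ
        (∑ i, a i • Pi.single (f i) (1 : ℝ))| ≤ 1 / 4 * ((∑ i, a i • Pi.single (f i) (1 : ℝ)) ⬝ᵥ
          M.Sxx *ᵥ (∑ i, a i • Pi.single (f i) (1 : ℝ))) := by
    intro f a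
    have h1 := hω f ω (fun hc => hωB (Set.mem_iUnion.2 ⟨f, hc⟩))
      (inrEmb p q (∑ i, a i • Pi.single (f i) (1 : ℝ))) (by
        rw [map_sum]
        refine Submodule.sum_mem _ fun i _ => ?_
        rw [map_smul]
        exact Submodule.smul_mem _ _ (Submodule.subset_span ⟨i, rfl⟩))
    rwa [bilin_inrEmb, bilin_inrEmb, toBlocks₂₂_sub] at h1
  -- A constant tuple yields a single coordinate, where the same concentration gives 5/4 - 3/4 =
  -- 1/2.
  have hdiag : ∀ j, ((sampleCov fun i => Z i ω).toBlocks₂₂ - (3 / 4 : ℝ) • M.Sxx) j j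
      ≤ 1 / 2 * lamMax M.Sxx := by
    intro j
    have h1 := hgood (fun _ => j) (Pi.single ⟨0, by omega⟩ 1)
    simp only [Pi.single_apply, ite_smul, one_smul, zero_smul, Finset.sum_ite_eq',
      Finset.mem_univ, if_true] at h1
    have h2 := diag_le_lamMax h.Sxx_posDef.1 j
    have h3 : |((sampleCov fun i => Z i ω).toBlocks₂₂ - M.Sxx) j j| ≤ 1 / 4 * M.Sxx j j := by
      simpa using h1
    have h4 := (abs_le.1 h3).2
    rw [Matrix.sub_apply] at h4 ⊢
    rw [Matrix.smul_apply, smul_eq_mul]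
    linarith
  have h1 := quad_ge_of_sparse hs hdiag (fun f a => by
    have h2 := (abs_le.1 (hgood f a)).1
    rw [sub_mulVec, dotProduct_sub] at h2 ⊢
    rw [smul_mulVec, dotProduct_smul, smul_eq_mul]
    linarith) v
  rw [sub_mulVec, dotProduct_sub, smul_mulVec, dotProduct_smul, smul_eq_mul] at h1
  linarith

/-- Concentration of an entry of the sample covariance, in arbitrary coordinates. -/
lemma bilin_tail [IsProbabilityMeasure P]
    {Sig : Matrix (Fin q ⊕ Fin p) (Fin q ⊕ Fin p) ℝ} (hS : Sig.PosDef)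
    {Z : Fin n → Ω → EuclideanSpace ℝ (Fin q ⊕ Fin p)}
    (hZ : ∀ i, HasLaw (Z i) (multivariateGaussian 0 Sig) P) (hi : iIndepFun Z P) (hn : 0 < n)
    {u : ℝ} (hu0 : 0 ≤ u) (hu1 : u ≤ 1) (v w : Fin q ⊕ Fin p → ℝ) :
    ∃ B : Set Ω, P.real B ≤ 4 * Real.exp (-(n * u ^ 2)) ∧ ∀ ω ∉ B,
      |v ⬝ᵥ (sampleCov (fun i => Z i ω) - Sig) *ᵥ w|
        ≤ 2 * u * (v ⬝ᵥ Sig *ᵥ v + w ⬝ᵥ Sig *ᵥ w) := by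
  refine ⟨_, (measureReal_union_le _ _).trans ((add_le_add
    (sampleCov_tail hS hZ hi hn (v + w) hu0 hu1)
    (sampleCov_tail hS hZ hi hn (v - w) hu0 hu1)).trans (le_of_eq (by ring))), fun ω hω => ?_⟩
  rw [Set.mem_union, not_or, Set.mem_ofPred_eq, Set.mem_ofPred_eq, not_lt, not_lt] at hω
  obtain ⟨h1, h2⟩ := hω
  have hD : (sampleCov (fun i => Z i ω) - Sig)ᵀ = sampleCov (fun i => Z i ω) - Sig := by
    rw [transpose_sub, sampleCov_transpose, transpose_eq_of_isHermitian hS.1]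
  rw [quad_add, quad_add, bilin_comm hD w v] at h1
  rw [quad_sub, quad_sub, bilin_comm hD w v] at h2
  obtain ⟨h3, h4⟩ := abs_le.1 h1
  obtain ⟨h5, h6⟩ := abs_le.1 h2
  rw [abs_le]
  constructor <;> linarith

lemma matA_apply (h : M.H1) (S : Matrix (Fin q ⊕ Fin p) (Fin q ⊕ Fin p) ℝ) (i j : Fin q) :
    M.matA S i j = Pi.single (Sum.inl i) 1 ⬝ᵥ (S - M.Sig) *ᵥ Pi.single (Sum.inl j) 1
      - inrEmb p q ((M.Oyy⁻¹ * M.Oyx) i) ⬝ᵥ (S - M.Sig) *ᵥ inrEmb p q ((M.Oyy⁻¹ * M.Oyx) j) := by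
  have ht : M.Oyxᵀ * M.Oyy⁻¹ = (M.Oyy⁻¹ * M.Oyx)ᵀ := by
    rw [transpose_mul, transpose_nonsing_inv, transpose_eq_of_isHermitian h.Oyy_posDef.1]
  rw [Model.matA, Matrix.mul_assoc _ M.Oyxᵀ, ht, bilin_inrEmb, toBlocks₂₂_sub, Matrix.sub_apply]
  congr 1
  · simp [toBlocks₁₁, Model.Syy]
  · rw [Matrix.mul_assoc (M.Oyy⁻¹ * M.Oyx)]
    rfl

lemma matB_apply (S : Matrix (Fin q ⊕ Fin p) (Fin q ⊕ Fin p) ℝ) (i : Fin q) (j : Fin p) :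
    M.matB S i j = 2 * (Pi.single (Sum.inl i) 1 ⬝ᵥ (S - M.Sig) *ᵥ Pi.single (Sum.inr j) 1
      + inrEmb p q ((M.Oyy⁻¹ * M.Oyx) i) ⬝ᵥ (S - M.Sig) *ᵥ inrEmb p q (Pi.single j 1)) := by
  rw [Model.matB, Matrix.smul_apply, smul_eq_mul, Matrix.add_apply, bilin_inrEmb, toBlocks₂₂_sub]
  congr 2
  · simp [toBlocks₁₂, Model.Syx]
  · rw [Matrix.mulVec_single_one]
    rfl

/-- Each entry of A_n or B_n combines two bilinear forms of S - Σ*, evaluated at coordinate vectors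
or at rows of Ω*_yy⁻¹Ω*_yx. With weight 4 per form, two families of q² and two of qp forms add up to
8q(q + p). The variances involved are diagonal entries bounded by the two summands of m*. -/
lemma score_tail [IsProbabilityMeasure P] (hS : M.Sig.PosDef)
    {Z : Fin n → Ω → EuclideanSpace ℝ (Fin q ⊕ Fin p)}
    (hZ : ∀ i, HasLaw (Z i) (multivariateGaussian 0 M.Sig) P) (hi : iIndepFun Z P) (hn : 0 < n)
    (h : M.H1) {u : ℝ} (hu0 : 0 ≤ u) (hu1 : u ≤ 1) :
    ∃ B : Set Ω, P.real B ≤ 8 * (q * (q + p)) * Real.exp (-(n * u ^ 2)) ∧ ∀ ω ∉ B,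
      M.ha (sampleCov fun i => Z i ω) ≤ 16 * M.mStar * u ∧
      M.hb (sampleCov fun i => Z i ω) ≤ 16 * M.mStar * u := by
  set c : Fin q → Fin q ⊕ Fin p → ℝ := fun i => inrEmb p q ((M.Oyy⁻¹ * M.Oyx) i) with hc
  have tail := bilin_tail hS hZ hi hn hu0 hu1
  choose B₁ hB₁ hω₁ using fun ij : Fin q × Fin q =>
    tail (Pi.single (Sum.inl ij.1) 1) (Pi.single (Sum.inl ij.2) 1)
  choose B₂ hB₂ hω₂ using fun ij : Fin q × Fin q => tail (c ij.1) (c ij.2)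
  choose B₃ hB₃ hω₃ using fun ij : Fin q × Fin p =>
    tail (Pi.single (Sum.inl ij.1) 1) (Pi.single (Sum.inr ij.2) 1)
  choose B₄ hB₄ hω₄ using fun ij : Fin q × Fin p => tail (c ij.1) (inrEmb p q (Pi.single ij.2 1))
  have hd0 := diagMax_nonneg M.Sig
  have hd1 := diagMax_nonneg (M.Oyy⁻¹ * M.Oyx * M.Sxx * M.Oyxᵀ * M.Oyy⁻¹)
  have he : ∀ a, (Pi.single a (1 : ℝ)) ⬝ᵥ M.Sig *ᵥ (Pi.single a (1 : ℝ)) ≤ diagMax M.Sig := by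
    intro a
    simpa using (le_abs_self _).trans (abs_le_diagMax M.Sig a)
  have he' : ∀ j : Fin p, inrEmb p q (Pi.single j 1) ⬝ᵥ M.Sig *ᵥ inrEmb p q (Pi.single j 1)
      ≤ diagMax M.Sig := by
    intro j
    rw [bilin_inrEmb]
    simpa [toBlocks₂₂] using (le_abs_self _).trans (abs_le_diagMax M.Sig (Sum.inr j))
  have hcc : ∀ i, c i ⬝ᵥ M.Sig *ᵥ c i
      ≤ diagMax (M.Oyy⁻¹ * M.Oyx * M.Sxx * M.Oyxᵀ * M.Oyy⁻¹) := by
    intro i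
    have ht : M.Oyxᵀ * M.Oyy⁻¹ = (M.Oyy⁻¹ * M.Oyx)ᵀ := by
      rw [transpose_mul, transpose_nonsing_inv, transpose_eq_of_isHermitian h.Oyy_posDef.1]
    refine le_of_eq_of_le ?_ ((le_abs_self _).trans (abs_le_diagMax _ i))
    rw [bilin_inrEmb, Matrix.mul_assoc _ M.Oyxᵀ, ht, Matrix.mul_assoc (M.Oyy⁻¹ * M.Oyx)]
    rfl
  refine ⟨(⋃ ij, B₁ ij) ∪ (⋃ ij, B₂ ij) ∪ ((⋃ ij, B₃ ij) ∪ (⋃ ij, B₄ ij)), ?_, fun ω hω => ?_⟩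
  · have e1 := measureReal_iUnion_le_card_mul _ hB₁
    have e2 := measureReal_iUnion_le_card_mul _ hB₂
    have e3 := measureReal_iUnion_le_card_mul _ hB₃
    have e4 := measureReal_iUnion_le_card_mul _ hB₄
    simp only [Fintype.card_prod, Fintype.card_fin, Nat.cast_mul] at e1 e2 e3 e4
    refine (measureReal_union_le _ _).trans ((add_le_add ((measureReal_union_le _ _).trans
      (add_le_add e1 e2)) ((measureReal_union_le _ _).trans (add_le_add e3 e4))).trans
        (le_of_eq ?_))
    ring
  · simp only [Set.mem_union, Set.mem_iUnion, not_or, not_exists] at hω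
    obtain ⟨⟨h1, h2⟩, h3, h4⟩ := hω
    have hm : 0 ≤ 16 * M.mStar * u := by
      have := M.mStar_nonneg
      positivity
    constructor
    · refine maxNorm_le hm fun i j => ?_
      have b1 := hω₁ (i, j) ω (h1 _)
      have b2 := hω₂ (i, j) ω (h2 _)
      have c1 := mul_le_mul_of_nonneg_left (add_le_add (he (Sum.inl i)) (he (Sum.inl j)))
        (by positivity : 0 ≤ 2 * u)
      have c2 := mul_le_mul_of_nonneg_left (add_le_add (hcc i) (hcc j)) (by positivity : 0 ≤ 2 * u)
      rw [matA_apply h]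
      refine (abs_sub _ _).trans ((add_le_add (b1.trans c1) (b2.trans c2)).trans ?_)
      rw [Model.mStar]
      nlinarith [mul_nonneg hu0 hd0, mul_nonneg hu0 hd1]
    · refine maxNorm_le hm fun i j => ?_
      have b3 := hω₃ (i, j) ω (h3 _)
      have b4 := hω₄ (i, j) ω (h4 _)
      have c3 := mul_le_mul_of_nonneg_left (add_le_add (he (Sum.inl i)) (he (Sum.inr j)))
        (by positivity : 0 ≤ 2 * u)
      have c4 := mul_le_mul_of_nonneg_left (add_le_add (hcc i) (he' j)) (by positivity : 0 ≤ 2 * u)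
      rw [matB_apply, abs_mul, abs_two]
      refine (mul_le_mul_of_nonneg_left ((abs_add_le _ _).trans (add_le_add (b3.trans c3)
        (b4.trans c4))) zero_le_two).trans ?_
      rw [Model.mStar]
      nlinarith [mul_nonneg hu0 hd0, mul_nonneg hu0 hd1]

end Event

end PGGM

namespace PGGM

/-! ### Numerical accounting of the failure probabilities. -/

section Budget

lemma two_le_add_of_pos {p q : ℕ} (hp : 0 < p) (hq : 0 < q) : (2 : ℝ) ≤ (p : ℝ) + q := by
  exact_mod_cast (by omega : 2 ≤ p + q)

/-- The total weight of the nets is compensated by the sample size. -/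
lemma net_budget {p q s n : ℕ} (hp : 0 < p) (hq : 0 < q)
    (h : 20480 * (q + s * Real.log ((p : ℝ) + q)) ≤ n) :
    9 ^ q * (2 * Real.exp (-(n / 1024))) + (9 * p) ^ s * (2 * Real.exp (-(n / 1024)))
      ≤ Real.exp (-(1 / 2048 * n)) := by
  have hm := two_le_add_of_pos hp hq
  have hq1 : (1 : ℝ) ≤ q := by exact_mod_cast hq
  have hp0 : (0 : ℝ) ≤ p := Nat.cast_nonneg p
  have hlog : 0 ≤ Real.log ((p : ℝ) + q) := Real.log_nonneg (by linarith)
  have hsl : 0 ≤ s * Real.log ((p : ℝ) + q) := by positivity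
  have he : (9 : ℝ) ≤ Real.exp 3 := by
    have h1 : Real.exp 3 = Real.exp 1 ^ 3 := by rw [← Real.exp_nat_mul]; norm_num
    rw [h1]
    have h2 : (2.1 : ℝ) ≤ Real.exp 1 := by linarith [Real.exp_one_gt_d9]
    calc (9 : ℝ) ≤ 2.1 ^ 3 := by norm_num
      _ ≤ _ := by gcongr
  -- The constant 20480 is 5 · 4096: the nets cost at most 3 per dimension here and 5 log(p + q) per
  -- sparse coordinate below. Each factor exp(n/4096), including the one absorbing the 4, is a
  -- quarter of the exponent n/1024, and half of that exponent remains.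
  have h1 : (9 : ℝ) ^ q ≤ Real.exp (n / 4096) := by
    calc (9 : ℝ) ^ q ≤ Real.exp 3 ^ q := by gcongr
      _ = Real.exp (q * 3) := by rw [Real.exp_nat_mul]
      _ ≤ _ := Real.exp_le_exp.2 (by linarith)
  have h2 : (9 * (p : ℝ)) ^ s ≤ Real.exp (n / 4096) := by
    have h3 : 9 * (p : ℝ) ≤ Real.exp (5 * Real.log ((p : ℝ) + q)) := by
      have h4 : Real.exp (5 * Real.log ((p : ℝ) + q)) = ((p : ℝ) + q) ^ 5 := by
        rw [show (5 : ℝ) = ((5 : ℕ) : ℝ) by norm_num, Real.exp_nat_mul,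
          Real.exp_log (by linarith)]
      rw [h4]
      have h5 : (2 : ℝ) ^ 4 ≤ ((p : ℝ) + q) ^ 4 := by gcongr
      nlinarith
    calc (9 * (p : ℝ)) ^ s ≤ Real.exp (5 * Real.log ((p : ℝ) + q)) ^ s := by gcongr
      _ = Real.exp (s * (5 * Real.log ((p : ℝ) + q))) := by rw [Real.exp_nat_mul]
      _ ≤ _ := Real.exp_le_exp.2 (by linarith)
  have h3 : (4 : ℝ) ≤ Real.exp (n / 4096) := by
    have := Real.add_one_le_exp ((n : ℝ) / 4096)
    linarith
  have h4 : Real.exp (n / 4096) * Real.exp (n / 4096) * Real.exp (-(n / 1024))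
      = Real.exp (-(1 / 2048 * n)) := by
    rw [← Real.exp_add, ← Real.exp_add]
    congr 1
    ring
  rw [← h4]
  have h5 : (9 : ℝ) ^ q + (9 * p) ^ s ≤ 2 * Real.exp (n / 4096) := by linarith
  calc (9 : ℝ) ^ q * (2 * Real.exp (-(n / 1024))) + (9 * p) ^ s * (2 * Real.exp (-(n / 1024)))
      = 2 * ((9 : ℝ) ^ q + (9 * p) ^ s) * Real.exp (-(n / 1024)) := by ring
    _ ≤ 2 * (2 * Real.exp (n / 4096)) * Real.exp (-(n / 1024)) := by gcongr
    _ = 4 * Real.exp (n / 4096) * Real.exp (-(n / 1024)) := by ring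
    _ ≤ _ := by gcongr

lemma logTerm_nonneg {p q : ℕ} (hp : 0 < p) (hq : 0 < q) {b₃ : ℝ} (h0 : 0 < b₃) (h1 : b₃ < 1) :
    0 ≤ logTerm p q b₃ := by
  have hm := two_le_add_of_pos hp hq
  have h2 : 0 ≤ Real.log (10 * ((p : ℝ) + q) ^ 2) := Real.log_nonneg (by nlinarith)
  have h3 := Real.log_nonpos h0.le h1.le
  rw [logTerm]
  linarith

/-- The exponential equals b₃ / (10(p + q)²), and 8q(q + p) is at most 10(p + q)². -/
lemma score_budget {p q : ℕ} (hp : 0 < p) (hq : 0 < q) {b₃ : ℝ} (h0 : 0 < b₃) :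
    8 * ((q : ℝ) * (q + p)) * Real.exp (-logTerm p q b₃) ≤ b₃ := by
  have hm := two_le_add_of_pos hp hq
  have hp0 : (0 : ℝ) ≤ p := Nat.cast_nonneg p
  have hq0 : (0 : ℝ) ≤ q := Nat.cast_nonneg q
  have hpos : 0 < 10 * ((p : ℝ) + q) ^ 2 := by positivity
  rw [logTerm, neg_sub, Real.exp_sub, Real.exp_log h0, Real.exp_log hpos, ← mul_div_assoc,
    div_le_iff₀ hpos, mul_comm b₃]
  refine mul_le_mul_of_nonneg_right ?_ h0.le
  nlinarith [mul_nonneg hp0 hq0]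

/-- Since |S| ≥ 1 and α ≥ 1, s_α exceeds 1 strictly. The division by s - 1 in `SparseBound` relies
on s ≥ 2. -/
lemma two_le_ceil_sAlpha {p q : ℕ} {M : Model p q} {T : Tuning} (hT : T.Valid)
    (hL : M.L.PosDef) (hβ : 1 ≤ M.β) (h : M.H1) {R : Reg}
    {S : Matrix (Fin q ⊕ Fin p) (Fin q ⊕ Fin p) ℝ} (hB : M.InBand T R S)
    (hd : 0 < M.alphaDen T R) : 2 ≤ ⌈M.sAlpha T R⌉₊ := by
  have hlam : 0 ≤ R.lam := le_trans (mul_nonneg (by linarith [hT.one_lt_cl]) (maxNorm_nonneg _))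
    hB.lam_mem.1
  have hα := Model.one_le_alpha hT hL hβ h hB.eta_mem.1 hlam hd
  have hS := Model.one_le_cardS h
  have hSmin := lamMin_pos h.Sxx_posDef (Model.pos_of_H1 h).2
  have hSmax := lamMax_pos h.Sxx_posDef (Model.pos_of_H1 h).2
  have h1 : 1 < M.sAlpha T R := by
    rw [Model.sAlpha]
    have : 0 < 12 * M.alpha T R ^ 2 * lamMax M.Sxx / lamMin M.Sxx := by positivity
    nlinarith
  rw [Nat.succ_le_iff, Nat.lt_ceil]
  exact_mod_cast h1

end Budget

/-- The three concentration properties hold simultaneously with high probability. -/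
lemma exists_good_event {p q n : ℕ} {M : Model p q} (hSig : M.Sig.PosDef) (h : M.H1)
    {Ω : Type*} [MeasurableSpace Ω] {P : Measure Ω} [IsProbabilityMeasure P]
    {Z : Fin n → Ω → EuclideanSpace ℝ (Fin q ⊕ Fin p)}
    (hZ : ∀ i, HasLaw (Z i) (multivariateGaussian 0 M.Sig) P) (hi : iIndepFun Z P)
    {b₃ : ℝ} (h0 : 0 < b₃) (h1 : b₃ < 1) (hn : 0 < n) (hlog : logTerm p q b₃ ≤ n)
    {s : ℕ} (hs : 2 ≤ s) (hsn : 20480 * (q + s * Real.log ((p : ℝ) + q)) ≤ n) :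
    ∃ E : Set Ω, MeasurableSet E ∧ 1 - Real.exp (-(1 / 2048 * n)) - b₃ ≤ P.real E ∧
      ∀ ω ∈ E, M.RangeBound (sampleCov fun i => Z i ω) ∧
        M.SparseBound (sampleCov fun i => Z i ω) s ∧
        M.ha (sampleCov fun i => Z i ω) ≤ 16 * M.mStar * √(logTerm p q b₃ / n) ∧
        M.hb (sampleCov fun i => Z i ω) ≤ 16 * M.mStar * √(logTerm p q b₃ / n) := by
  obtain ⟨hq, hp⟩ := Model.pos_of_H1 h
  have hn' : (0 : ℝ) < n := by exact_mod_cast hn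
  have hl := logTerm_nonneg hp hq h0 h1
  have hu1 : √(logTerm p q b₃ / n) ≤ 1 := by
    exact Real.sqrt_le_iff.2 ⟨zero_le_one, by rwa [one_pow, div_le_one hn']⟩
  have hu2 : (n : ℝ) * √(logTerm p q b₃ / n) ^ 2 = logTerm p q b₃ := by
    rw [Real.sq_sqrt (by positivity)]
    field_simp
  obtain ⟨B₁, hB₁, hω₁⟩ := range_tail hSig hZ hi hn h
  obtain ⟨B₂, hB₂, hω₂⟩ := sparse_tail hSig hZ hi hn h hs
  obtain ⟨B₃, hB₃, hω₃⟩ := score_tail hSig hZ hi hn h (Real.sqrt_nonneg _) hu1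
  rw [hu2] at hB₃
  have hB : P.real (B₁ ∪ B₂ ∪ B₃) ≤ Real.exp (-(1 / 2048 * n)) + b₃ :=
    (measureReal_union_le _ _).trans (add_le_add ((measureReal_union_le _ _).trans
      ((add_le_add hB₁ hB₂).trans (net_budget hp hq hsn))) (hB₃.trans (score_budget hp hq h0)))
  -- The bad sets are controlled only in outer measure; a measurable hull of the same measure makes
  -- the good event measurable.
  refine ⟨(toMeasurable P (B₁ ∪ B₂ ∪ B₃))ᶜ, (measurableSet_toMeasurable _ _).compl, ?_,
    fun ω hω => ?_⟩
  · rw [probReal_compl_eq_one_sub (measurableSet_toMeasurable _ _), measureReal_def,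
      measure_toMeasurable, ← measureReal_def]
    linarith
  · have hω' : ω ∉ B₁ ∪ B₂ ∪ B₃ := fun hc => hω (subset_toMeasurable _ _ hc)
    simp only [Set.mem_union, not_or] at hω'
    exact ⟨hω₁ ω hω'.1.1, hω₂ ω hω'.1.2, hω₃ ω hω'.2⟩

end PGGM

open PGGM in
theorem theorem2p1 :
    ∃ b₁ : ℝ, 0 < b₁ ∧ ∃ b₂ : ℝ, 0 < b₂ ∧
      ∀ (p q n : ℕ) (M : Model p q) (T : Tuning),
        M.Sig.PosDef → M.L.PosDef → 1 ≤ M.β → M.H1 → T.Valid →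
      ∀ (Ω : Type*) [MeasurableSpace Ω] (P : Measure Ω) [IsProbabilityMeasure P]
        (Z : Fin n → Ω → EuclideanSpace ℝ (Fin q ⊕ Fin p)),
        (∀ i, HasLaw (Z i) (multivariateGaussian 0 M.Sig) P) → iIndepFun Z P →
      ∀ b₃ : ℝ, 0 < b₃ → b₃ < 1 →
        ∃ E : Set Ω, MeasurableSet E ∧ 1 - Real.exp (-(b₂ * n)) - b₃ ≤ P.real E ∧
          ∀ ω ∈ E, ∀ (R : Reg) (εS εL : ℝ),
            M.InBand T R (sampleCov fun i => Z i ω) →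
            0 < M.alphaDen T R →
            0 < εS → 0 < εL →
            εS * M.omegaSUp + R.eta * M.β * (p : ℝ) ^ (M.β - 1) * M.omegaLUp ^ M.β * εL < 1 →
            M.nZero T R εS εL b₁ b₃ < n →
              (∃ θ, M.IsEstimator R (sampleCov fun i => Z i ω) θ) ∧
              ∀ θ, M.IsEstimator R (sampleCov fun i => Z i ω) θ →
                frobDist θ M.theta ≤ M.errorBound T R εS εL b₃ n := by
  refine ⟨20480, by norm_num, 1 / 2048, by norm_num, ?_⟩
  intro p q n M T hSig hL hβ h hT Ω _ P _ Z hZ hi b₃ h0 h1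
  obtain ⟨hq, hp⟩ := Model.pos_of_H1 h
  have hlog0 : 0 < Real.log ((p : ℝ) + q) := Real.log_pos (by linarith [two_le_add_of_pos hp hq])
  have hl := logTerm_nonneg hp hq h0 h1
  -- the largest sparsity allowed by the sample size
  set s : ℕ := ⌊((n : ℝ) / 20480 - q) / Real.log ((p : ℝ) + q)⌋₊ with hs
  -- This makes the event uniform: the fixed s dominates ⌈s_α⌉ for every parameter to which the
  -- conclusion applies.
  have hn₀ : ∀ (R : Reg) (εS εL : ℝ), M.nZero T R εS εL 20480 b₃ < n →
      logTerm p q b₃ < n ∧ ⌈M.sAlpha T R⌉₊ ≤ s := by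
    intro R εS εL hn
    rw [Model.nZero, max_lt_iff, max_lt_iff] at hn
    refine ⟨hn.2.2, Nat.le_floor ?_⟩
    rw [le_div_iff₀ hlog0]
    linarith [hn.2.1]
  -- If this fails, no admissible parameter satisfies n > n₀, so the whole space serves as event.
  by_cases hc : logTerm p q b₃ < n ∧ 2 ≤ s
  · have hn : 0 < n := by exact_mod_cast hl.trans_lt hc.1
    have hsn : 20480 * (q + s * Real.log ((p : ℝ) + q)) ≤ n := by
      -- The natural floor of a negative quotient is 0; s ≥ 2 rules this out.
      have h2 := (Nat.le_floor_iff' (by omega)).1 hs.le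
      rw [le_div_iff₀ hlog0] at h2
      linarith
    obtain ⟨E, hE, hPE, hgood⟩ := exists_good_event hSig h hZ hi h0 h1 hn hc.1.le hc.2 hsn
    refine ⟨E, hE, hPE, fun ω hω R εS εL hB hd hεS hεL hε hnZ => ?_⟩
    obtain ⟨g1, g2, g3, g4⟩ := hgood ω hω
    refine Model.estimator_bound hSig hL hβ h hT hB hd (sampleCov_toBlocks₂₂_posSemidef _) g1
      ((Nat.le_ceil _).trans (Nat.cast_le.2 (hn₀ R εS εL hnZ).2)) g2 hεS hεL ?_ hn hnZ hl g3 g4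
    rw [Model.a1]
    linarith
  · refine ⟨Set.univ, MeasurableSet.univ, ?_, fun ω _ R εS εL hB hd _ _ _ hnZ => ?_⟩
    · rw [probReal_univ]
      linarith [Real.exp_pos (-(1 / 2048 * (n : ℝ)))]
    · obtain ⟨h2, h3⟩ := hn₀ R εS εL hnZ
      exact absurd ⟨h2, (two_le_ceil_sAlpha hT hL hβ h hB hd).trans h3⟩ hc
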